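/- **Setting.** All graphs are finite and simple. Let $k$ be a positive integer and let $\gamma$ be a real-valued function on the isomorphism classes of $k$-vertex graphs. For a graph $G=(V,E)$ of order $n\ge k$ put $$\Lambda(G)=\sum_{X\in\binom Vk}\gamma(G[X]),\qquad \lambda(G)=\binom nk^{-1}\Lambda(G),$$ let $\lambda(n)$ be the maximum of $\lambda(G)$ over graphs of order $n$, and let $\lambda_{\max}=\lim_{n\to\infty}\lambda(n)$. **Symmetrisability.** $\lambda$ is *symmetrisable* if for every $\varepsilon>0$ there is $n_0>0$ such that the following hold for every graph $G=(V,E)$ of order $n\ge n_0$. * (Sym1) There are graphs $G_0=G,G_1,\dots,G_m$ on $V$ such that $G_m$ is complete partite and, for all $1\le i\le m$, $\lambda(G_{i-1})\le\lambda(G_i)$ and $|E(G_{i-1})\triangle E(G_i)|<\varepsilon\binom n2$. * (Sym2) If $z\in V$ and $G-z$ is complete partite with partite sets $V_1,\dots,V_t$, then there are graphs $G_0=G,G_1,\dots,G_m$ on $V$ with $G_i-z=G-z$ for all $i$, with $\lambda(G_{i-1})\le\lambda(G_i)$ and $|E(G_{i-1})\triangle E(G_i)|\le\varepsilon(n-1)$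 for $1\le i\le m$, and such that for each $j$ either $V_j\subseteq N_{G_m}(z)$ or $V_j\cap N_{G_m}(z)=\varnothing$. **Limit space.** Let $\overline{\mathcal P}$ be the set of real sequences $\mathbf x=(x_1,x_2,\dots)$ with $x_1\ge x_2\ge\dots\ge0$ and $\sum_{i\ge1}x_i\le1$. Put $x_0=1-\sum_{i\ge1}x_i$ and $\mathrm{supp}^*(\mathbf x)=\{i\ge0:x_i>0\}$. The *realisation* $G_{n,\mathbf x}$ is the complete partite graph on $[n]$ with independent parts $V_1,V_2,\dots$ (some possibly empty) and a set $V_0$ of universal vertices (singleton parts) such that: if $x_0=0$, then $V_0=\varnothing$ and $\big||V_i|-x_in\big|<1$ for all $i\ge1$; if $x_0>0$, then for $i\ge1$ we have $|V_i|=\lfloor x_in\rfloor$ when $x_in\ge2$ and $V_i=\varnothing$ otherwise, and $V_0$ consists of the remaining vertices. (The limits below exist and do not depend on the choice of the parts.) Put $$\lambda(\mathbf x)=\lim_{n\to\infty}\lambda(G_{n,\mathbf x}),\qquad \mathrm{OPT}=\{\mathbf x\in\overline{\mathcal P}:\lambda(\mathbf x)\ge\lambda(\mathbf y)\text{ for all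 }\mathbf y\in\overline{\mathcal P}\}.$$ **Strictness.** For $i_1,i_2\in\mathrm{supp}^*(\mathbf x)$ let $$\nabla^{\bullet\bullet}_{i_1i_2}\lambda(\mathbf x)=\lim_{n\to\infty}\binom{n-2}{k-2}^{-1}\big(\Lambda(G_{n,\mathbf x})-\Lambda(G_{n,\mathbf x}\oplus v_1v_2)\big),$$ where $v_1\in V_{i_1}$ and $v_2\in V_{i_2}$ are distinct vertices of $G_{n,\mathbf x}$ and $\oplus\, v_1v_2$ flips the adjacency of this pair. (For $k=1$ the normalising binomial is irrelevant, since then $\mathrm{OPT}=\overline{\mathcal P}$ is infinite.) For $b:\{1,2,\dots\}\to\{0,1\}$ and $\alpha\in[0,1]$ let $G_{n,\mathbf x}+_{b,\alpha}u$ be obtained from $G_{n,\mathbf x}$ by adding a vertex $u$ that is joined, for each $i\ge1$, to all of $V_i$ if $b(i)=1$ and to none of $V_i$ if $b(i)=0$, and that is joined to exactly $\lfloor\alpha|V_0|\rfloor$ vertices of $V_0$. Let $e_1(j)=0$ if $j=1$ and $e_1(j)=1$ otherwise, and put $$\nabla^{\bullet}_{b,\alpha}\lambda(\mathbf x)=\lim_{n\to\infty}\binom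 n{k-1}^{-1}\big(\Lambda(G_{n,\mathbf x}+_{e_1,1}u)-\Lambda(G_{n,\mathbf x}+_{b,\alpha}u)\big).$$ $\lambda$ is *strict* if there is $c>0$ such that for every $\mathbf x\in\mathrm{OPT}$: * (Str1) $\nabla^{\bullet\bullet}_{i_1i_2}\lambda(\mathbf x)\ge c$ for all $i_1,i_2\in\mathrm{supp}^*(\mathbf x)$; * (Str2) for all $b$ and $\alpha$, $\nabla^{\bullet}_{b,\alpha}\lambda(\mathbf x)\ge c\big((1-\alpha)x_0+\inf_{i\in\mathrm{supp}^*(\mathbf x)}w_i\big)$, where $w_i=\mathbf 1_{i>0}\,b(i)x_i+\sum_{j\in\mathrm{supp}^*(\mathbf x)\setminus\{0,i\}}(1-b(j))x_j$. **Edit distance.** For graphs $G,H$ of the same order $n$ let $\hat\delta_1(G,H)=\frac2{n^2}\min_\sigma|E(H)\triangle E(\sigma(G))|$, the minimum being over all bijections $\sigma:V(G)\to V(H)$. For a graph $G$ with at least one vertex let $G^{(n)}$ be an $n$-vertex blow-up of $G$, in which each vertex of $G$ is replaced by an independent set, the sizes of these sets differing by at most $1$. For $\mathbf x\in\overline{\mathcal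 P}$ put $\delta_{\mathrm{edit}}(G,\mathbf x)=\lim_{n\to\infty}\hat\delta_1(G_{n,\mathbf x},G^{(n)})$. **Statement.** Suppose that $\lambda$ is symmetrisable, that $\mathrm{OPT}$ is finite and that $\lambda$ is strict. Then for every $\varepsilon>0$ there are $\delta>0$ and $n_0>0$ such that for every graph $G$ of order $n\ge n_0$ with $\lambda(G)\ge\lambda_{\max}-\delta$ there is $\mathbf x\in\mathrm{OPT}$ with $\delta_{\mathrm{edit}}(G,\mathbf x)\le\varepsilon$. -/

import Mathlib

open Filter Topology

namespace PartiteStability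

noncomputable section

/-! ### Graph parameters given by a function on `k`-vertex graphs -/

/-- `Γ` depends only on the isomorphism class, that is, `Γ` is a function on the family of all
`k`-vertex graphs up to isomorphism. -/
def IsoInvariant {k : ℕ} (Γ : SimpleGraph (Fin k) → ℝ) : Prop :=
  ∀ F F' : SimpleGraph (Fin k), Nonempty (F ≃g F') → Γ F = Γ F'

/-- `Λ(G)`, the sum of `Γ(G[X])` over all `k`-subsets `X` of the vertex set. The induced graph
`G[X]` is transported to `Fin k` by an arbitrary bijection. -/
def lamSum {k : ℕ} (Γ : SimpleGraph (Fin k) → ℝ) {V : Type*} [Fintype V]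
    (G : SimpleGraph V) : ℝ :=
  ∑ X : {X : Finset V // X.card = k},
    Γ (G.comap fun i => (((X.1.equivFinOfCardEq X.2).symm i : X.1) : V))

/-- `λ(G)`, the average of `Γ(G[X])` over all `k`-subsets `X` of the vertex set. -/
def lam {k : ℕ} (Γ : SimpleGraph (Fin k) → ℝ) {V : Type*} [Fintype V]
    (G : SimpleGraph V) : ℝ :=
  lamSum Γ G / ((Fintype.card V).choose k : ℝ)

/-- `λ(n)`, the maximum of `λ(G)` over the (finitely many) graphs on `n` vertices. -/
def lamOrder {k : ℕ} (Γ : SimpleGraph (Fin k) → ℝ) (n : ℕ) : ℝ :=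
  ⨆ G : SimpleGraph (Fin n), lam Γ G

/-- `λ_max`, the limit of `λ(n)`. -/
def lamMax {k : ℕ} (Γ : SimpleGraph (Fin k) → ℝ) : ℝ :=
  limUnder atTop fun n : ℕ => lamOrder Γ n

/-! ### Symmetrisability -/

/-- `|E(G) Δ E(H)|` for two graphs on the same vertex set. -/
def edgeDiff {V : Type*} (G H : SimpleGraph V) : ℕ :=
  (symmDiff G.edgeSet H.edgeSet).ncard

/-- The conclusion of the first symmetrisation property for the graph `G`: the graphs
`S 0, …, S m` lead from `G` to a complete partite graph. -/
def SymOne {k : ℕ} (Γ : SimpleGraph (Fin k) → ℝ) (ε : ℝ) {n : ℕ}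
    (G : SimpleGraph (Fin n)) : Prop :=
  ∃ (m : ℕ) (S : ℕ → SimpleGraph (Fin n)),
    S 0 = G ∧ (S m).IsCompleteMultipartite ∧
    ∀ i < m, lam Γ (S i) ≤ lam Γ (S (i + 1)) ∧
      (edgeDiff (S i) (S (i + 1)) : ℝ) < ε * (n.choose 2 : ℝ)

/-- The second symmetrisation property for the graph `G`. The partite sets of the complete partite
graph `G - z` are the classes of the non-adjacency relation. -/
def SymTwo {k : ℕ} (Γ : SimpleGraph (Fin k) → ℝ) (ε : ℝ) {n : ℕ}
    (G : SimpleGraph (Fin n)) : Prop :=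
  ∀ (z : Fin n) (hz : (G.induce {v | v ≠ z}).IsCompleteMultipartite),
    ∃ (m : ℕ) (S : ℕ → SimpleGraph (Fin n)),
      S 0 = G ∧
      (∀ i ≤ m, (S i).induce {v | v ≠ z} = G.induce {v | v ≠ z}) ∧
      (∀ i < m, lam Γ (S i) ≤ lam Γ (S (i + 1)) ∧
        (edgeDiff (S i) (S (i + 1)) : ℝ) ≤ ε * ((n : ℝ) - 1)) ∧
      ∀ P ∈ hz.setoid.classes,
        (∀ v ∈ P, (S m).Adj z v) ∨ (∀ v ∈ P, ¬ (S m).Adj z v)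

/-- `λ` is symmetrisable. -/
def Symmetrisable {k : ℕ} (Γ : SimpleGraph (Fin k) → ℝ) : Prop :=
  ∀ ε : ℝ, 0 < ε → ∃ n₀ : ℕ, 0 < n₀ ∧ ∀ n : ℕ, n₀ ≤ n →
    ∀ G : SimpleGraph (Fin n), SymOne Γ ε G ∧ SymTwo Γ ε G

/-! ### The partite limit space and realisations -/

/-- An element `(x₁, x₂, …)` of the partite limit space. The entry `x_{i+1}` is `part i`. -/
@[ext]
structure PartiteLimit where
  part : ℕ → ℝ
  antitone_part : Antitone part
  part_nonneg : ∀ i, 0 ≤ part i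
  summable_part : Summable part
  tsum_part_le : ∑' i, part i ≤ 1

/-- The index set `ℕ₀` of an element of the partite limit space is modelled as `Option ℕ`: the index
`0` is `none` and the index `i + 1` is `some i`. The value of `weight` at `none` is
`x₀ = 1 - ∑ x_i`. -/
def PartiteLimit.weight (x : PartiteLimit) : Option ℕ → ℝ
  | none => 1 - ∑' i, x.part i
  | some i => x.part i

/-- The support including the index `0` if `x₀ > 0`. -/
def PartiteLimit.suppStar (x : PartiteLimit) : Set (Option ℕ) := {i | 0 < x.weight i}

/-- The complete partite graph in which the vertices labelled `some i` form an independent part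
and those labelled `none` are singleton parts (universal vertices). -/
def labelGraph {V : Type*} (c : V → Option ℕ) : SimpleGraph V where
  Adj u v := u ≠ v ∧ (c u ≠ c v ∨ c u = none)
  symm.symm u v h := ⟨h.1.symm, h.2.elim (fun h => Or.inl h.symm) fun h' => by
    by_cases hv : c v = none
    · exact Or.inr hv
    · exact Or.inl (by rw [h']; exact hv)⟩
  loopless.irrefl u h := h.1 rfl

/-- The vertices with label `i`. -/
def labelClass {n : ℕ} (c : Fin n → Option ℕ) (i : Option ℕ) : Finset (Fin n) :=
  Finset.univ.filter fun v => c v = i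

/-- `c` describes the parts `V₀, V₁, …` of an `n`-vertex realisation of `x`. -/
def IsRealisation (x : PartiteLimit) {n : ℕ} (c : Fin n → Option ℕ) : Prop :=
  (x.weight none = 0 →
    labelClass c none = ∅ ∧
    ∀ i : ℕ, |((labelClass c (some i)).card : ℝ) - x.part i * n| < 1) ∧
  (x.weight none ≠ 0 →
    ∀ i : ℕ, (labelClass c (some i)).card =
      if 2 ≤ x.part i * n then ⌊x.part i * n⌋₊ else 0)

lemma exists_label {n : ℕ} (T : ℕ → ℕ) (hT : Monotone T) (h0 : T 0 = 0) (hn : ∀ i, T i ≤ n) :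
    ∃ c : Fin n → Option ℕ, (∀ i, (labelClass c (some i)).card = T (i + 1) - T i) ∧
      ((∃ i, T i = n) → labelClass c none = ∅) := by
  classical
  refine ⟨fun v => if h : ∃ i, v.val < T (i + 1) then some (Nat.find h) else none, ?_, ?_⟩
  · intro i
    have key : ∀ v : Fin n,
        ((if h : ∃ i, v.val < T (i + 1) then some (Nat.find h) else none) = some i) ↔
          (T i ≤ v.val ∧ v.val < T (i + 1)) := by
      intro v
      constructor
      · intro h
        split_ifs at h with hv
        have hi : Nat.find hv = i := by simpa using h
        have h1 := Nat.find_spec hv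
        rw [hi] at h1
        refine ⟨?_, h1⟩
        rcases i with _ | j
        · simp [h0]
        · have := Nat.find_min hv (m := j) (by omega)
          omega
      · rintro ⟨h1, h2⟩
        have hv : ∃ i, v.val < T (i + 1) := ⟨i, h2⟩
        rw [dif_pos hv]
        congr 1
        rw [Nat.find_eq_iff]
        refine ⟨h2, fun j hj => ?_⟩
        have := hT (show j + 1 ≤ i by omega)
        omega
    have : (labelClass (fun v : Fin n =>
        if h : ∃ i, v.val < T (i + 1) then some (Nat.find h) else none) (some i)).map
          Fin.valEmbedding = Finset.Ico (T i) (T (i + 1)) := by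
      ext a
      simp only [labelClass, Finset.mem_map, Finset.mem_filter, Finset.mem_univ, true_and, key,
        Fin.valEmbedding_apply, Finset.mem_Ico]
      constructor
      · rintro ⟨v, hv, rfl⟩
        exact hv
      · intro ha
        exact ⟨⟨a, lt_of_lt_of_le ha.2 (hn _)⟩, ha, rfl⟩
    rw [← Finset.card_map Fin.valEmbedding, this, Nat.card_Ico]
  · rintro ⟨i, hi⟩
    refine Finset.filter_eq_empty_iff.2 fun v _ => ?_
    have hv : ∃ i, v.val < T (i + 1) := ⟨i, by
      have := hT (Nat.le_succ i)
      have := v.2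
      simp only [Nat.succ_eq_add_one] at *
      omega⟩
    simp [hv]

lemma exists_isRealisation (x : PartiteLimit) (n : ℕ) :
    ∃ c : Fin n → Option ℕ, IsRealisation x c := by
  have hS : ∀ i, ∑ j ∈ Finset.range i, x.part j ≤ ∑' j, x.part j := fun i =>
    x.summable_part.sum_le_tsum _ fun j _ => x.part_nonneg j
  have hn0 : (0 : ℝ) ≤ n := Nat.cast_nonneg n
  by_cases h : x.weight none = 0
  · have h1 : ∑' j, x.part j = 1 := by
      simp only [PartiteLimit.weight] at h
      linarith
    obtain ⟨c, hc, hc0⟩ := exists_label (n := n)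
      (fun i => ⌈(∑ j ∈ Finset.range i, x.part j) * n⌉₊)
      (by
        refine monotone_nat_of_le_succ fun i => Nat.ceil_mono ?_
        rw [Finset.sum_range_succ]
        have := x.part_nonneg i
        nlinarith)
      (by simp)
      (by
        intro i
        refine Nat.ceil_le.2 ?_
        have := hS i
        nlinarith)
    refine ⟨c, fun _ => ⟨hc0 ?_, fun i => ?_⟩, fun h' => absurd h h'⟩
    · have ht := x.summable_part.hasSum.tendsto_sum_nat
      rw [h1] at ht
      have hlt : 1 - 1 / ((n : ℝ) + 1) < 1 := by
        have : 0 < 1 / ((n : ℝ) + 1) := by positivity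
        linarith
      obtain ⟨i, hi⟩ := (ht.eventually (lt_mem_nhds hlt)).exists
      refine ⟨i, le_antisymm (Nat.ceil_le.2 ?_) ?_⟩
      · have := hS i
        nlinarith
      · have h2 : (n : ℝ) - 1 < (∑ j ∈ Finset.range i, x.part j) * n := by
          have h3 : 1 / ((n : ℝ) + 1) * ((n : ℝ) + 1) = 1 := by field_simp
          have h4 : 0 < 1 / ((n : ℝ) + 1) := by positivity
          nlinarith
        have h5 := Nat.le_ceil ((∑ j ∈ Finset.range i, x.part j) * (n : ℝ))
        have h6 : (n : ℝ) < (⌈(∑ j ∈ Finset.range i, x.part j) * (n : ℝ)⌉₊ : ℝ) + 1 := by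
          linarith
        have h7 : n < ⌈(∑ j ∈ Finset.range i, x.part j) * (n : ℝ)⌉₊ + 1 := by
          exact_mod_cast h6
        exact Nat.lt_succ_iff.1 h7
    · have hs : (∑ j ∈ Finset.range (i + 1), x.part j) * n
          = (∑ j ∈ Finset.range i, x.part j) * n + x.part i * n := by
        rw [Finset.sum_range_succ]
        ring
      have hp : 0 ≤ x.part i * n := mul_nonneg (x.part_nonneg i) hn0
      have ha : 0 ≤ (∑ j ∈ Finset.range i, x.part j) * (n : ℝ) :=
        mul_nonneg (Finset.sum_nonneg fun j _ => x.part_nonneg j) hn0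
      have hle : ⌈(∑ j ∈ Finset.range i, x.part j) * (n : ℝ)⌉₊
          ≤ ⌈(∑ j ∈ Finset.range (i + 1), x.part j) * (n : ℝ)⌉₊ :=
        Nat.ceil_mono (by linarith)
      rw [hc i, Nat.cast_sub hle]
      have b1 := Nat.le_ceil ((∑ j ∈ Finset.range i, x.part j) * (n : ℝ))
      have b2 := Nat.ceil_lt_add_one ha
      have b3 := Nat.le_ceil ((∑ j ∈ Finset.range (i + 1), x.part j) * (n : ℝ))
      have b4 := Nat.ceil_lt_add_one (show
        0 ≤ (∑ j ∈ Finset.range (i + 1), x.part j) * (n : ℝ) by linarith)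
      rw [abs_lt]
      constructor <;> linarith
  · obtain ⟨c, hc, -⟩ := exists_label (n := n)
      (fun i => ∑ j ∈ Finset.range i,
        if 2 ≤ x.part j * n then ⌊x.part j * n⌋₊ else 0)
      (monotone_nat_of_le_succ fun i => by
        rw [Finset.sum_range_succ]
        exact Nat.le_add_right _ _)
      (by simp)
      (by
        intro i
        have h1 : ((∑ j ∈ Finset.range i,
            if 2 ≤ x.part j * n then ⌊x.part j * n⌋₊ else 0 : ℕ) : ℝ)
            ≤ ∑ j ∈ Finset.range i, x.part j * n := by
          rw [Nat.cast_sum]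
          refine Finset.sum_le_sum fun j _ => ?_
          have hj : 0 ≤ x.part j * n := mul_nonneg (x.part_nonneg j) hn0
          split_ifs
          · exact Nat.floor_le hj
          · simpa using hj
        rw [← Finset.sum_mul] at h1
        have h2 := hS i
        have h3 := x.tsum_part_le
        have h4 : (∑ j ∈ Finset.range i, x.part j) * (n : ℝ) ≤ n := by nlinarith
        exact_mod_cast h1.trans h4)
    refine ⟨c, fun h' => absurd h' h, fun _ i => ?_⟩
    rw [hc i, Finset.sum_range_succ, Nat.add_sub_cancel_left]

/-- The parts of the `n`-vertex realisation of `x` (any admissible choice of them). -/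
def realisationLabel (x : PartiteLimit) (n : ℕ) : Fin n → Option ℕ :=
  Classical.choose (exists_isRealisation x n)

lemma realisationLabel_spec (x : PartiteLimit) (n : ℕ) :
    IsRealisation x (realisationLabel x n) :=
  Classical.choose_spec (exists_isRealisation x n)

/-- The `n`-vertex realisation `G_{n,x}`. -/
def realisation (x : PartiteLimit) (n : ℕ) : SimpleGraph (Fin n) :=
  labelGraph (realisationLabel x n)

/-- `λ(x)`, the limit of `λ(G_{n,x})`. -/
def lamLimit {k : ℕ} (Γ : SimpleGraph (Fin k) → ℝ) (x : PartiteLimit) : ℝ :=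
  limUnder atTop fun n : ℕ => lam Γ (realisation x n)

/-- `OPT(λ)`, the set of maximisers of `λ` on the partite limit space. -/
def OPT {k : ℕ} (Γ : SimpleGraph (Fin k) → ℝ) : Set PartiteLimit :=
  {x | ∀ y : PartiteLimit, lamLimit Γ y ≤ lamLimit Γ x}

/-! ### Strictness -/

/-- `G ⊕ uv`: the adjacency of the pair `uv` is flipped. -/
def flipPair {V : Type*} (G : SimpleGraph V) (u v : V) : SimpleGraph V :=
  symmDiff G (SimpleGraph.edge u v)

/-- The normalised loss in `Λ(G)` when the pair `uv` is flipped. -/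
def flipLoss {k : ℕ} (Γ : SimpleGraph (Fin k) → ℝ) {n : ℕ} (G : SimpleGraph (Fin n))
    (u v : Fin n) : ℝ :=
  1 / ((n - 2).choose (k - 2) : ℝ) * (lamSum Γ G - lamSum Γ (flipPair G u v))

open Classical in
/-- The limit of the flip loss in `G_{n,x}` for distinct vertices `u ∈ V_i`, `v ∈ V_j`; such
vertices exist for all large `n` if `i` and `j` lie in `x.suppStar`. -/
def flipLossLimit {k : ℕ} (Γ : SimpleGraph (Fin k) → ℝ) (x : PartiteLimit)
    (i j : Option ℕ) : ℝ :=
  limUnder atTop fun n : ℕ =>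
    if h : ∃ p : Fin n × Fin n,
        p.1 ≠ p.2 ∧ realisationLabel x n p.1 = i ∧ realisationLabel x n p.2 = j then
      flipLoss Γ (realisation x n) h.choose.1 h.choose.2
    else 0

/-- The graph obtained from `G` by adding a new vertex with neighbourhood `N`. -/
def addVertex {V : Type*} (G : SimpleGraph V) (N : Set V) : SimpleGraph (Option V) where
  Adj
    | none, none => False
    | none, some v => v ∈ N
    | some u, none => u ∈ N
    | some u, some v => G.Adj u v
  symm.symm u v h := by
    cases u <;> cases v
    · exact h
    · exact h
    · exact h
    · exact SimpleGraph.Adj.symm h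
  loopless.irrefl u h := by
    cases u
    · exact h
    · exact SimpleGraph.irrefl _ h

lemma exists_subset_labelClass {n : ℕ} (c : Fin n → Option ℕ) (α : unitInterval) :
    ∃ A : Finset (Fin n), A ⊆ labelClass c none ∧
      A.card = ⌊(α : ℝ) * ((labelClass c none).card : ℝ)⌋₊ := by
  refine Finset.exists_subset_card_eq (Nat.floor_le_of_le ?_)
  exact mul_le_of_le_one_left (Nat.cast_nonneg _) α.2.2

/-- The graph `G +_{b,α} u`, where `G` is the complete partite graph with parts given by `c`. The
new vertex is joined to all of the part `some i` if `b i = true`, to none of it otherwise, and to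
`⌊α |V₀|⌋` of the universal vertices. -/
def attach {n : ℕ} (c : Fin n → Option ℕ) (b : ℕ → Bool) (α : unitInterval) :
    SimpleGraph (Option (Fin n)) :=
  addVertex (labelGraph c)
    ({v | ∃ i : ℕ, c v = some i ∧ b i = true} ∪
      ((Classical.choose (exists_subset_labelClass c α) : Finset (Fin n)) : Set (Fin n)))

/-- The function `e₁`, which is zero exactly at the first part. -/
def eOne : ℕ → Bool := fun i => decide (i ≠ 0)

/-- The normalised loss in `Λ` when a new vertex is attached according to `(b, α)` rather than
to `(e₁, 1)`. -/
def attachLoss {k : ℕ} (Γ : SimpleGraph (Fin k) → ℝ) {n : ℕ} (c : Fin n → Option ℕ)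
    (b : ℕ → Bool) (α : unitInterval) : ℝ :=
  1 / (n.choose (k - 1) : ℝ) * (lamSum Γ (attach c eOne 1) - lamSum Γ (attach c b α))

/-- The limit of the attachment loss along the realisations of `x`. -/
def attachLossLimit {k : ℕ} (Γ : SimpleGraph (Fin k) → ℝ) (x : PartiteLimit)
    (b : ℕ → Bool) (α : unitInterval) : ℝ :=
  limUnder atTop fun n : ℕ => attachLoss Γ (realisationLabel x n) b α

/-- `w_i`, the sum of `b_i x_i` (only if the index `i` is not `0`) and of all `(1 - b_j) x_j` with
`j ≠ 0`, `j ≠ i`. Indices `j` outside the support contribute zero. -/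
def editWeight (x : PartiteLimit) (b : ℕ → Bool) : Option ℕ → ℝ
  | none => ∑' j : ℕ, if b j = true then 0 else x.part j
  | some i => (if b i = true then x.part i else 0) +
      ∑' j : ℕ, if j = i ∨ b j = true then 0 else x.part j

/-- `λ` is strict with constant `c`. When `x₀ = 0`, the realisations have no universal vertices
and the value of `α` is irrelevant. -/
def StrictWith {k : ℕ} (Γ : SimpleGraph (Fin k) → ℝ) (c : ℝ) : Prop :=
  ∀ x ∈ OPT Γ,
    (∀ i ∈ x.suppStar, ∀ j ∈ x.suppStar, c ≤ flipLossLimit Γ x i j) ∧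
    ∀ (b : ℕ → Bool) (α : unitInterval),
      c * ((1 - (α : ℝ)) * x.weight none + ⨅ i : x.suppStar, editWeight x b i) ≤
        attachLossLimit Γ x b α

/-- `λ` is strict. -/
def IsStrict {k : ℕ} (Γ : SimpleGraph (Fin k) → ℝ) : Prop :=
  ∃ c : ℝ, 0 < c ∧ StrictWith Γ c

/-! ### Edit distance -/

/-- The normalised edit distance of two graphs on `n` vertices. -/
def editDist {n : ℕ} (G H : SimpleGraph (Fin n)) : ℝ :=
  2 / (n : ℝ) ^ 2 *
    ((⨅ σ : Equiv.Perm (Fin n), edgeDiff H (G.map σ) : ℕ) : ℝ)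

/-- The almost uniform `n`-vertex blow-up `G^{(n)}` of a graph `G` on `Fin N`: the vertex `a` of `G`
is replaced by the independent set of all `u < n` with `u ≡ a` modulo `N`. -/
def blowUp {N : ℕ} (G : SimpleGraph (Fin N)) (n : ℕ) : SimpleGraph (Fin n) where
  Adj u v := ∃ a a' : Fin N, a.val = u.val % N ∧ a'.val = v.val % N ∧ G.Adj a a'
  symm.symm _ _ := fun ⟨a, a', h, h', hG⟩ => ⟨a', a, h', h, hG.symm⟩
  loopless.irrefl _ := fun ⟨_, _, h, h', hG⟩ => hG.ne (Fin.ext (h.trans h'.symm))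

/-- The edit distance between a graph and an element of the partite limit space, the limit of
the normalised edit distances between `G_{n,x}` and `G^{(n)}`. -/
def editDistLimit {N : ℕ} (G : SimpleGraph (Fin N)) (x : PartiteLimit) : ℝ :=
  limUnder atTop fun n : ℕ => editDist (realisation x n) (blowUp G n)

end

end PartiteStability

namespace PartiteStability

noncomputable section

/-! ### Averages over maps `Fin k → V` -/

/-! The heart of the matter is a local statement, `exists_label_gain`: near a realisation of an
optimal `x`, every graph `H` can be replaced by a complete partite graph `L` whose density exceeds
that of `H` by at least a constant times the normalised distance between `H` and `L`. So a graph
that is nearly optimal and moderately close to an optimal realisation is close to a complete partite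
graph. This graph is itself nearly optimal, hence close to a possibly different optimal realisation.
This is the bootstrap `exists_close_of_close`.

Symmetrisability makes this global in `exists_close_of_lam`. A nearly optimal `G` is joined to a
complete partite graph by a path of short steps along which `λ` does not decrease. The end of the
path is close to an optimal realisation by compactness (`exists_close_of_le_lam`). Walking back
towards `G`, each short step leaves the graph moderately close, and the bootstrap restores the small
distance before errors can accumulate. Finiteness of `OPT` makes the constants uniform.

The local statement has three ingredients. First, the reference labelling is changed so that each
vertex of `H` either has nearly the neighbourhood of its part or has one far from those of all parts
(`exists_relabel`). Second, each vertex of the latter kind is corrected at a gain of order `1/n`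
(`exists_star_gain`). To see this, (Sym2) moves its neighbourhood until it either respects the
parts, where (Str2) applies, or reaches a small but linear distance from some part, where (Str1)
applies. Third, the remaining differences have small degrees. Their effects are almost additive, and
(Str1) makes every flip cost a constant over `n ^ 2` (`le_dens_sub_of_flips`).

All estimates use densities over maps from `Fin k`, normalised by `n ^ k`: fixing one or two
coordinates then costs an exact factor, and densities of labelled graphs converge to expectations
over independent labels (`tendsto_avg`). Thus the limits defining strictness become `flipMean` and
differences of `starMean`, and uniform statements follow by contradiction along an ultrafilter.
Condition (Str1) also forces finite support (`finite_suppStar`).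

For the final translation into `editDistLimit`, blow-ups of different orders are folded onto each
other. This shows both that the limit exists and that it is controlled by a single labelling
(`limit_editDist_le`, `tendsto_editDist`). -/

/-- The average of `g` over all maps `Fin k → V`. -/
def avg {k : ℕ} {V : Type} [Fintype V] (g : (Fin k → V) → ℝ) : ℝ :=
  (∑ f, g f) / (Fintype.card V : ℝ) ^ k

section avg

variable {k : ℕ} {V : Type} [Fintype V]

lemma avg_sub (g h : (Fin k → V) → ℝ) : avg (fun f => g f - h f) = avg g - avg h := by
  simp [avg, Finset.sum_sub_distrib, sub_div]

lemma avg_sum {ι : Type*} (s : Finset ι) (g : ι → (Fin k → V) → ℝ) :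
    avg (fun f => ∑ i ∈ s, g i f) = ∑ i ∈ s, avg (g i) := by
  simp only [avg]
  rw [Finset.sum_comm, Finset.sum_div]

lemma avg_const_mul (a : ℝ) (g : (Fin k → V) → ℝ) : avg (fun f => a * g f) = a * avg g := by
  simp [avg, ← Finset.mul_sum, mul_div_assoc]

lemma avg_mono {g h : (Fin k → V) → ℝ} (H : ∀ f, g f ≤ h f) : avg g ≤ avg h :=
  div_le_div_of_nonneg_right (Finset.sum_le_sum fun f _ => H f) (by positivity)

lemma abs_avg_le (g : (Fin k → V) → ℝ) : |avg g| ≤ avg fun f => |g f| := by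
  rw [avg, abs_div, abs_of_nonneg (by positivity : (0 : ℝ) ≤ (Fintype.card V : ℝ) ^ k)]
  exact div_le_div_of_nonneg_right (Finset.abs_sum_le_sum_abs _ _) (by positivity)

lemma avg_const [Nonempty V] (a : ℝ) : avg (fun _ : Fin k → V => a) = a := by
  have : (Fintype.card V : ℝ) ≠ 0 := by exact_mod_cast Fintype.card_ne_zero
  simp [avg]

/-- After overwriting, the old value at `a` is irrelevant, so every map with value `u` at `a` arises
once for each element of `V`. -/
lemma sum_update [DecidableEq V] (a : Fin k) (u : V) (g : (Fin k → V) → ℝ) :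
    ∑ f, g (Function.update f a u) =
      Fintype.card V * ∑ f, if f a = u then g f else 0 := by
  have key : ∀ h : (Fin k → V) → ℝ, ∑ f, h f =
      ∑ p : V × ({j // j ≠ a} → V), h ((Equiv.funSplitAt a V).symm p) := fun h =>
    (Equiv.sum_comp (Equiv.funSplitAt a V).symm h).symm
  rw [key, key, Fintype.sum_prod_type, Fintype.sum_prod_type]
  have e1 : ∀ (v : V) (r : {j // j ≠ a} → V),
      Function.update ((Equiv.funSplitAt a V).symm (v, r)) a u =
        (Equiv.funSplitAt a V).symm (u, r) := by
    intro v r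
    ext j
    by_cases hj : j = a
    · subst hj
      simp [Equiv.funSplitAt]
    · simp [Equiv.funSplitAt, hj]
  have e2 : ∀ (v : V) (r : {j // j ≠ a} → V), (Equiv.funSplitAt a V).symm (v, r) a = v := by
    intro v r
    simp [Equiv.funSplitAt]
  simp only [e1, e2, Finset.sum_const, Finset.card_univ, nsmul_eq_mul]
  congr 1
  rw [Finset.sum_eq_single u]
  · simp
  · intro b _ hb
    simp [hb]
  · simp

/-- Conditioning on one coordinate costs exactly one factor of the order. This turns a change at a
single vertex into a quantity of order `1/n`, and two pins give the order `1/n ^ 2` of a single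
pair. -/
lemma avg_pin [DecidableEq V] (a : Fin k) (u : V) (g : (Fin k → V) → ℝ) :
    avg (fun f => if f a = u then g f else 0) =
      avg (fun f => g (Function.update f a u)) / Fintype.card V := by
  have : Nonempty V := ⟨u⟩
  have hn : (Fintype.card V : ℝ) ≠ 0 := by exact_mod_cast Fintype.card_ne_zero
  rw [avg, avg, sum_update]
  field_simp

lemma avg_pin_pin [DecidableEq V] {a b : Fin k} (hab : a ≠ b) (u v : V)
    (g : (Fin k → V) → ℝ) :
    avg (fun f => if f a = u ∧ f b = v then g f else 0) =
      avg (fun f => g (Function.update (Function.update f a u) b v)) /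
        (Fintype.card V : ℝ) ^ 2 := by
  simp only [ite_and]
  rw [avg_pin]
  have : (fun f : Fin k → V => if (Function.update f a u) b = v then g (Function.update f a u)
      else 0) = fun f => if f b = v then g (Function.update f a u) else 0 := by
    ext f
    rw [Function.update_of_ne hab.symm]
  rw [this, avg_pin b v (fun f => g (Function.update f a u)), div_div, sq]
  congr 2
  ext f
  rw [Function.update_comm hab]

lemma avg_eval [Nonempty V] (a : Fin k) (g : V → ℝ) :
    avg (fun f : Fin k → V => g (f a)) = (∑ v, g v) / Fintype.card V := by
  classical
  have : (fun f : Fin k → V => g (f a)) = fun f => ∑ v, if f a = v then g v else 0 := by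
    ext f
    simp
  rw [this, avg_sum, Finset.sum_div]
  refine Finset.sum_congr rfl fun v _ => ?_
  rw [avg_pin a v (fun _ => g v), avg_const]

lemma avg_eval_eval [Nonempty V] {a b : Fin k} (hab : a ≠ b) (g : V → V → ℝ) :
    avg (fun f : Fin k → V => g (f a) (f b)) =
      (∑ u, ∑ v, g u v) / (Fintype.card V : ℝ) ^ 2 := by
  classical
  have : (fun f : Fin k → V => g (f a) (f b)) =
      fun f => ∑ v, if f a = v then g v (f b) else 0 := by
    ext f
    simp
  rw [this, avg_sum, Finset.sum_div]
  refine Finset.sum_congr rfl fun v _ => ?_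
  rw [avg_pin a v (fun f => g v (f b))]
  simp only [Function.update_of_ne hab.symm]
  rw [avg_eval b (g v), div_div, sq]

/-- A bound for the proportion of maps that are not injective. -/
lemma avg_not_injective_le [Nonempty V] :
    avg (fun f : Fin k → V => open Classical in if Function.Injective f then 0 else (1 : ℝ)) ≤
      (k : ℝ) ^ 2 / Fintype.card V := by
  classical
  have hn : (Fintype.card V : ℝ) ≠ 0 := by exact_mod_cast Fintype.card_ne_zero
  -- Union bound over the pairs of coordinates that may collide.
  calc _ ≤ avg (fun f : Fin k → V => ∑ a : Fin k, ∑ b : Fin k,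
        if a ≠ b then (if f a = f b then (1 : ℝ) else 0) else 0) := by
        refine avg_mono fun f => ?_
        have h0 : ∀ a b : Fin k, 0 ≤ if a ≠ b then (if f a = f b then (1 : ℝ) else 0) else 0 := by
          intro a b
          split_ifs <;> simp
        split_ifs with h
        · exact Finset.sum_nonneg fun a _ => Finset.sum_nonneg fun b _ => h0 a b
        · simp only [Function.Injective, not_forall] at h
          obtain ⟨a, b, h1, h2⟩ := h
          refine le_trans ?_ (Finset.single_le_sum (f := fun a => ∑ b : Fin k,
            if a ≠ b then (if f a = f b then (1 : ℝ) else 0) else 0)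
            (fun a _ => Finset.sum_nonneg fun b _ => h0 a b) (Finset.mem_univ a))
          refine le_trans ?_ (Finset.single_le_sum (f := fun b =>
            if a ≠ b then (if f a = f b then (1 : ℝ) else 0) else 0)
            (fun b _ => h0 a b) (Finset.mem_univ b))
          simp [h1, h2]
    _ = ∑ a : Fin k, ∑ b : Fin k, avg (fun f : Fin k → V =>
        if a ≠ b then (if f a = f b then (1 : ℝ) else 0) else 0) := by
        rw [avg_sum]
        refine Finset.sum_congr rfl fun a _ => ?_
        rw [avg_sum]
    _ ≤ ∑ a : Fin k, ∑ b : Fin k, 1 / (Fintype.card V : ℝ) := by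
        refine Finset.sum_le_sum fun a _ => Finset.sum_le_sum fun b _ => ?_
        by_cases hab : a = b
        · simp only [hab, ne_eq, not_true_eq_false, if_false]
          rw [avg_const]
          positivity
        · simp only [ne_eq, hab, not_false_eq_true, if_true]
          rw [avg_eval_eval hab (fun u v => if u = v then (1 : ℝ) else 0)]
          simp
          field_simp
          rfl
    _ = _ := by
        simp
        ring

end avg

end

end PartiteStability

namespace PartiteStability

noncomputable section

/-! ### Injective densities -/

open Classical in
/-- The value of `Γ` at the graph pulled back along `f` if `f` is injective. -/
def sample {k : ℕ} (Γ : SimpleGraph (Fin k) → ℝ) {V : Type} (G : SimpleGraph V)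
    (f : Fin k → V) : ℝ :=
  if Function.Injective f then Γ (G.comap f) else 0

/-- The average of `Γ` over all maps `Fin k → V`, where maps that are not injective
contribute zero. -/
def dens {k : ℕ} (Γ : SimpleGraph (Fin k) → ℝ) {V : Type} [Fintype V] (G : SimpleGraph V) : ℝ :=
  avg (sample Γ G)

/-- A bound for the absolute values of `Γ`. -/
def bd {k : ℕ} (Γ : SimpleGraph (Fin k) → ℝ) : ℝ := ∑ F, |Γ F|

lemma bd_nonneg {k : ℕ} (Γ : SimpleGraph (Fin k) → ℝ) : 0 ≤ bd Γ :=
  Finset.sum_nonneg fun _ _ => abs_nonneg _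

lemma abs_le_bd {k : ℕ} (Γ : SimpleGraph (Fin k) → ℝ) (F : SimpleGraph (Fin k)) :
    |Γ F| ≤ bd Γ :=
  Finset.single_le_sum (f := fun F => |Γ F|) (fun _ _ => abs_nonneg _) (Finset.mem_univ F)

lemma abs_sample_le {k : ℕ} (Γ : SimpleGraph (Fin k) → ℝ) {V : Type} (G : SimpleGraph V)
    (f : Fin k → V) : |sample Γ G f| ≤ bd Γ := by
  unfold sample
  split_ifs
  · exact abs_le_bd Γ _
  · simpa using bd_nonneg Γ

/-- Each `k`-set is the image of exactly `k!` injective maps, and isomorphism invariance makes the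
bijection chosen in `lamSum` irrelevant. -/
lemma factorial_mul_lamSum {k : ℕ} {Γ : SimpleGraph (Fin k) → ℝ} (hΓ : IsoInvariant Γ)
    {V : Type} [Fintype V] (G : SimpleGraph V) :
    (k.factorial : ℝ) * lamSum Γ G = ∑ f : Fin k → V, sample Γ G f := by
  classical
  simp only [sample]
  rw [← Finset.sum_filter]
  have hmaps : ∀ f ∈ Finset.univ.filter (fun f : Fin k → V => Function.Injective f),
      Finset.univ.image f ∈ Finset.univ.filter fun X : Finset V => X.card = k := by
    intro f hf
    simp only [Finset.mem_filter, Finset.mem_univ, true_and] at hf ⊢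
    rw [Finset.card_image_of_injective _ hf]
    simp
  rw [← Finset.sum_fiberwise_of_maps_to hmaps, lamSum, Finset.mul_sum]
  rw [← Finset.sum_subtype_of_mem (p := fun X : Finset V => X.card = k)
    (fun X => ∑ f ∈ (Finset.univ.filter (fun f : Fin k → V => Function.Injective f)).filter
      (fun f => Finset.univ.image f = X), Γ (G.comap f)) (by simp)]
  refine Finset.sum_congr (by ext X; simpa using X.2) fun X _ => ?_
  have hconst : ∀ f ∈ (Finset.univ.filter (fun f : Fin k → V => Function.Injective f)).filter
      (fun f => Finset.univ.image f = X.1), Γ (G.comap f) =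
        Γ (G.comap fun i => (((X.1.equivFinOfCardEq X.2).symm i : X.1) : V)) := by
    intro f hf
    simp only [Finset.mem_filter, Finset.mem_univ, true_and] at hf
    obtain ⟨hinj, him⟩ := hf
    refine hΓ _ _ ⟨?_⟩
    have hmem : ∀ i, f i ∈ X.1 := fun i => by
      rw [← him]
      exact Finset.mem_image_of_mem _ (Finset.mem_univ _)
    have hbij : Function.Bijective fun i => X.1.equivFinOfCardEq X.2 ⟨f i, hmem i⟩ := by
      refine Function.Injective.bijective_of_finite fun i j hij => ?_
      simpa [hinj.eq_iff] using hij
    refine ⟨Equiv.ofBijective _ hbij, ?_⟩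
    intro a b
    simp
  rw [Finset.sum_congr rfl hconst, Finset.sum_const, nsmul_eq_mul]
  congr 2
  have e : {f // f ∈ (Finset.univ.filter (fun f : Fin k → V => Function.Injective f)).filter
      (fun f => Finset.univ.image f = X.1)} ≃ (Fin k ↪ X.1) := by
    refine
      { toFun := fun f => ⟨fun i => ⟨f.1 i, ?_⟩, ?_⟩
        invFun := fun g => ⟨fun i => g i, ?_⟩
        left_inv := fun f => rfl
        right_inv := fun g => rfl }
    · have h := f.2
      simp only [Finset.mem_filter, Finset.mem_univ, true_and] at h
      exact (Finset.ext_iff.1 h.2 _).1 (Finset.mem_image_of_mem _ (Finset.mem_univ _))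
    · have h := f.2
      simp only [Finset.mem_filter, Finset.mem_univ, true_and] at h
      intro i j hij
      exact h.1 (by simpa using hij)
    · simp only [Finset.mem_filter, Finset.mem_univ, true_and]
      have hi : Function.Injective fun i => ((g i : X.1) : V) :=
        Subtype.val_injective.comp g.injective
      refine ⟨hi, Finset.eq_of_subset_of_card_le ?_ ?_⟩
      · intro v hv
        simp only [Finset.mem_image, Finset.mem_univ, true_and] at hv
        obtain ⟨i, rfl⟩ := hv
        exact (g i).2
      · rw [Finset.card_image_of_injective _ hi, X.2]
        simp
  have := Fintype.card_congr e
  rw [Fintype.card_coe, Fintype.card_embedding_eq, Fintype.card_coe, X.2, Fintype.card_fin,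
    Nat.descFactorial_self] at this
  exact this.symm

lemma lamSum_eq_dens {k : ℕ} {Γ : SimpleGraph (Fin k) → ℝ} (hΓ : IsoInvariant Γ)
    {V : Type} [Fintype V] [Nonempty V] (G : SimpleGraph V) :
    lamSum Γ G = (Fintype.card V : ℝ) ^ k / k.factorial * dens Γ G := by
  have hn : (Fintype.card V : ℝ) ≠ 0 := by exact_mod_cast Fintype.card_ne_zero
  have h := factorial_mul_lamSum hΓ G
  have hk : (k.factorial : ℝ) ≠ 0 := by exact_mod_cast k.factorial_ne_zero
  rw [dens, avg, ← h]
  field_simp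

/-- On a fixed vertex set `lam` and `dens` differ by a positive factor, so monotonicity along
symmetrisation paths transfers to densities. -/
lemma lam_le_lam_iff {k : ℕ} {Γ : SimpleGraph (Fin k) → ℝ} (hΓ : IsoInvariant Γ)
    {V : Type} [Fintype V] [Nonempty V] (hk : k ≤ Fintype.card V) (G H : SimpleGraph V) :
    lam Γ G ≤ lam Γ H ↔ dens Γ G ≤ dens Γ H := by
  have hn : (0 : ℝ) < Fintype.card V := by exact_mod_cast Fintype.card_pos
  have hc : (0 : ℝ) < (Fintype.card V).choose k := by exact_mod_cast Nat.choose_pos hk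
  have hf : (0 : ℝ) < k.factorial := by exact_mod_cast k.factorial_pos
  rw [lam, lam, div_le_div_iff_of_pos_right hc, lamSum_eq_dens hΓ, lamSum_eq_dens hΓ]
  exact mul_le_mul_iff_right₀ (by positivity)

/-! ### Differences of graphs -/

open Classical in
/-- The indicator of the pairs at which two graphs differ. -/
def dd {V : Type} (G H : SimpleGraph V) (u v : V) : ℝ := if (G.Adj u v ↔ H.Adj u v) then 0 else 1

lemma dd_nonneg {V : Type} (G H : SimpleGraph V) (u v : V) : 0 ≤ dd G H u v := by
  unfold dd; split_ifs <;> simp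

lemma dd_le_one {V : Type} (G H : SimpleGraph V) (u v : V) : dd G H u v ≤ 1 := by
  unfold dd; split_ifs <;> simp

lemma dd_symm {V : Type} (G H : SimpleGraph V) (u v : V) : dd G H u v = dd G H v u := by
  unfold dd
  rw [G.adj_comm, H.adj_comm]

lemma dd_comm {V : Type} (G H : SimpleGraph V) (u v : V) : dd G H u v = dd H G u v := by
  unfold dd
  congr 1
  exact propext iff_comm

lemma dd_triangle {V : Type} (G H K : SimpleGraph V) (u v : V) :
    dd G K u v ≤ dd G H u v + dd H K u v := by
  unfold dd
  split_ifs <;> simp_all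

lemma dd_self {V : Type} (G H : SimpleGraph V) (u : V) : dd G H u u = 0 := by simp [dd]

lemma dd_eq_zero {V : Type} {G H : SimpleGraph V} {u v : V} :
    dd G H u v = 0 ↔ (G.Adj u v ↔ H.Adj u v) := by
  unfold dd
  split_ifs <;> simp_all

lemma dd_eq_one {V : Type} {G H : SimpleGraph V} {u v : V} (h : ¬ (G.Adj u v ↔ H.Adj u v)) :
    dd G H u v = 1 := by
  unfold dd
  rw [if_neg h]

/-- The number of vertices `v` such that two graphs differ at `uv`. -/
def ddeg {V : Type} [Fintype V] (G H : SimpleGraph V) (u : V) : ℝ := ∑ v, dd G H u v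

/-- The number of ordered pairs at which two graphs differ. -/
def dsize {V : Type} [Fintype V] (G H : SimpleGraph V) : ℝ := ∑ u, ddeg G H u

section diff

variable {V : Type} [Fintype V]

lemma ddeg_nonneg (G H : SimpleGraph V) (u : V) : 0 ≤ ddeg G H u :=
  Finset.sum_nonneg fun _ _ => dd_nonneg _ _ _ _

lemma dsize_nonneg (G H : SimpleGraph V) : 0 ≤ dsize G H :=
  Finset.sum_nonneg fun _ _ => ddeg_nonneg _ _ _

lemma ddeg_comm (G H : SimpleGraph V) (u : V) : ddeg G H u = ddeg H G u :=
  Finset.sum_congr rfl fun _ _ => dd_comm _ _ _ _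

lemma dsize_comm (G H : SimpleGraph V) : dsize G H = dsize H G :=
  Finset.sum_congr rfl fun _ _ => ddeg_comm _ _ _

lemma ddeg_triangle (G H K : SimpleGraph V) (u : V) : ddeg G K u ≤ ddeg G H u + ddeg H K u := by
  rw [ddeg, ddeg, ddeg, ← Finset.sum_add_distrib]
  exact Finset.sum_le_sum fun _ _ => dd_triangle _ _ _ _ _

lemma dsize_triangle (G H K : SimpleGraph V) : dsize G K ≤ dsize G H + dsize H K := by
  rw [dsize, dsize, dsize, ← Finset.sum_add_distrib]
  exact Finset.sum_le_sum fun _ _ => ddeg_triangle _ _ _ _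

lemma ddeg_le_dsize (G H : SimpleGraph V) (u : V) : ddeg G H u ≤ dsize G H :=
  Finset.single_le_sum (f := ddeg G H) (fun _ _ => ddeg_nonneg _ _ _) (Finset.mem_univ u)

lemma dsize_self (G : SimpleGraph V) : dsize G G = 0 := by
  simp [dsize, ddeg, dd]

/-- Handshake lemma in the graph whose edges are the differing pairs. -/
lemma dsize_eq_edgeDiff (G H : SimpleGraph V) : dsize G H = 2 * edgeDiff G H := by
  classical
  set D : SimpleGraph V := symmDiff G H with hD
  have hadj : ∀ u v, D.Adj u v ↔ ¬ (G.Adj u v ↔ H.Adj u v) := by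
    intro u v
    simp only [hD, symmDiff, SimpleGraph.sup_adj, SimpleGraph.sdiff_adj]
    tauto
  have h1 : dsize G H = ∑ u, (D.degree u : ℝ) := by
    refine Finset.sum_congr rfl fun u _ => ?_
    rw [← SimpleGraph.card_neighborFinset_eq_degree, SimpleGraph.neighborFinset_eq_filter,
      Finset.card_filter]
    push_cast
    refine Finset.sum_congr rfl fun v _ => ?_
    unfold dd
    by_cases h : G.Adj u v ↔ H.Adj u v
    · rw [if_pos h, if_neg (by rw [hadj]; exact fun h' => h' h)]
    · rw [if_neg h, if_pos ((hadj u v).2 h)]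
  have h2 : symmDiff G.edgeSet H.edgeSet = D.edgeSet := by
    ext e
    induction e with
    | _ u v =>
      simp only [Set.mem_symmDiff, SimpleGraph.mem_edgeSet, hadj]
      tauto
  rw [h1, edgeDiff, h2, ← SimpleGraph.coe_edgeFinset, Set.ncard_coe_finset]
  exact_mod_cast D.sum_degrees_eq_twice_card_edges

variable {k : ℕ} (Γ : SimpleGraph (Fin k) → ℝ)

lemma sample_congr {V : Type} {G H : SimpleGraph V} {f : Fin k → V}
    (h : ∀ a b, dd G H (f a) (f b) = 0) : sample Γ G f = sample Γ H f := by
  have : G.comap f = H.comap f := by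
    ext a b
    exact dd_eq_zero.1 (h a b)
  simp only [sample, this]

/-- A map that meets a differing pair pays for itself in the sum. The weight `D` is kept general
because it will later be set to zero at the pairs through a vertex. -/
lemma one_le_sum_dd {V : Type} {D : V → V → ℝ} (hD : ∀ u v, D u v = 0 ∨ 1 ≤ D u v) {f : Fin k → V}
    (h : ¬ ∀ a b, D (f a) (f b) = 0) : 1 ≤ ∑ a, ∑ b, D (f a) (f b) := by
  have h0 : ∀ u v, 0 ≤ D u v := fun u v => by
    rcases hD u v with h | h <;> linarith
  push Not at h
  obtain ⟨a, b, hab⟩ := h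
  have h1 := (hD (f a) (f b)).resolve_left hab
  refine h1.trans (le_trans ?_ (Finset.single_le_sum (f := fun a => ∑ b, D (f a) (f b))
    (fun a _ => Finset.sum_nonneg fun b _ => h0 _ _) (Finset.mem_univ a)))
  exact Finset.single_le_sum (f := fun b => D (f a) (f b)) (fun b _ => h0 _ _)
    (Finset.mem_univ b)

lemma dd_zero_or_one {V : Type} (G H : SimpleGraph V) (u v : V) : dd G H u v = 0 ∨ 1 ≤ dd G H u v := by
  unfold dd; split_ifs <;> simp

lemma abs_sample_sub_le {V : Type} (G H : SimpleGraph V) (f : Fin k → V) :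
    |sample Γ G f - sample Γ H f| ≤ 2 * bd Γ * ∑ a, ∑ b, dd G H (f a) (f b) := by
  have hb := bd_nonneg Γ
  by_cases h : ∀ a b, dd G H (f a) (f b) = 0
  · rw [sample_congr Γ h]
    simp [h]
  · have h1 := one_le_sum_dd (dd_zero_or_one G H) h
    have h2 := abs_sample_le Γ G f
    have h3 := abs_sample_le Γ H f
    have h4 := abs_sub (sample Γ G f) (sample Γ H f)
    nlinarith

/-- The density is Lipschitz in the edit distance: a random map hits a differing pair with
probability at most `k ^ 2` times the proportion of such pairs. -/
lemma abs_dens_sub_le [Nonempty V] (G H : SimpleGraph V) :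
    |dens Γ G - dens Γ H| ≤ 2 * bd Γ * (k : ℝ) ^ 2 * (dsize G H / (Fintype.card V : ℝ) ^ 2) := by
  have hb := bd_nonneg Γ
  have hs := dsize_nonneg G H
  rw [dens, dens, ← avg_sub]
  refine (abs_avg_le _).trans ((avg_mono fun f => abs_sample_sub_le Γ G H f).trans ?_)
  rw [avg_const_mul, avg_sum, mul_assoc (2 * bd Γ)]
  refine mul_le_mul_of_nonneg_left ?_ (by linarith)
  calc _ = ∑ a : Fin k, ∑ b : Fin k, avg (fun f : Fin k → V => dd G H (f a) (f b)) :=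
        Finset.sum_congr rfl fun a _ => by rw [avg_sum]
    _ ≤ ∑ a : Fin k, ∑ b : Fin k, dsize G H / (Fintype.card V : ℝ) ^ 2 := by
        refine Finset.sum_le_sum fun a _ => Finset.sum_le_sum fun b _ => ?_
        by_cases hab : a = b
        · simp only [hab, dd_self]
          rw [avg_const]
          positivity
        · rw [avg_eval_eval hab (dd G H)]
          rfl
    _ = _ := by
        simp
        ring

/-- If a map is not hit by `P` the graphs in each of the pairs `G₁, G₂` and `H₁, H₂` look the
same along it, and if it is not hit by `D` the graphs in each of the pairs `G₁, H₁` and `G₂, H₂`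
look the same. -/
lemma abs_sample_second_diff_le {V : Type} {G₁ G₂ H₁ H₂ : SimpleGraph V} {D : V → V → ℝ}
    (hD : ∀ u v, D u v = 0 ∨ 1 ≤ D u v) (h1 : ∀ u v, dd G₁ H₁ u v ≤ D u v)
    (h2 : ∀ u v, dd G₂ H₂ u v ≤ D u v) {f : Fin k → V} {p : ℝ} (hp : p = 0 ∨ 1 ≤ p)
    (h3 : p = 0 → ∀ a b, dd G₁ G₂ (f a) (f b) = 0)
    (h4 : p = 0 → ∀ a b, dd H₁ H₂ (f a) (f b) = 0) :
    |(sample Γ G₁ f - sample Γ G₂ f) - (sample Γ H₁ f - sample Γ H₂ f)| ≤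
      4 * bd Γ * (p * ∑ a, ∑ b, D (f a) (f b)) := by
  have hb := bd_nonneg Γ
  rcases hp with hp | hp
  · rw [sample_congr Γ (h3 hp), sample_congr Γ (h4 hp), hp]
    simp
  by_cases h : ∀ a b, D (f a) (f b) = 0
  · rw [sample_congr Γ (G := G₁) (H := H₁) fun a b =>
        le_antisymm ((h1 _ _).trans (h a b).le) (dd_nonneg _ _ _ _),
      sample_congr Γ (G := G₂) (H := H₂) fun a b =>
        le_antisymm ((h2 _ _).trans (h a b).le) (dd_nonneg _ _ _ _)]
    simp [h]
  · have := one_le_sum_dd hD h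
    have a1 := abs_le.1 (abs_sample_le Γ G₁ f)
    have a2 := abs_le.1 (abs_sample_le Γ G₂ f)
    have a3 := abs_le.1 (abs_sample_le Γ H₁ f)
    have a4 := abs_le.1 (abs_sample_le Γ H₂ f)
    have a5 : 1 ≤ p * ∑ a, ∑ b, D (f a) (f b) := by nlinarith
    have a6 : |(sample Γ G₁ f - sample Γ G₂ f) - (sample Γ H₁ f - sample Γ H₂ f)| ≤
        4 * bd Γ := by
      rw [abs_le]
      constructor <;> linarith [a1.1, a1.2, a2.1, a2.2, a3.1, a3.2, a4.1, a4.2]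
    nlinarith

/-- Second differences for changes at a single vertex `z`. -/
lemma abs_star_second_diff_le [Nonempty V] {G₁ G₂ H₁ H₂ : SimpleGraph V} {D : V → V → ℝ} (z : V)
    (hD : ∀ u v, D u v = 0 ∨ 1 ≤ D u v) (hDz : ∀ v, D z v = 0) (hDz' : ∀ v, D v z = 0)
    (hDd : ∀ v, D v v = 0)
    (h1 : ∀ u v, dd G₁ H₁ u v ≤ D u v) (h2 : ∀ u v, dd G₂ H₂ u v ≤ D u v)
    (h3 : ∀ u v, u ≠ z → v ≠ z → dd G₁ G₂ u v = 0)
    (h4 : ∀ u v, u ≠ z → v ≠ z → dd H₁ H₂ u v = 0) :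
    Fintype.card V * |(dens Γ G₁ - dens Γ G₂) - (dens Γ H₁ - dens Γ H₂)| ≤
      4 * bd Γ * (k : ℝ) ^ 3 * ((∑ u, ∑ v, D u v) / (Fintype.card V : ℝ) ^ 2) := by
  classical
  have hb := bd_nonneg Γ
  have hn : (0 : ℝ) < Fintype.card V := by exact_mod_cast Fintype.card_pos
  have h0 : ∀ u v, 0 ≤ D u v := fun u v => by
    rcases hD u v with h | h <;> linarith
  have hs : 0 ≤ ∑ u, ∑ v, D u v := Finset.sum_nonneg fun u _ => Finset.sum_nonneg fun v _ => h0 u v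
  simp only [dens]
  rw [← avg_sub, ← avg_sub, ← avg_sub]
  have key : ∀ f : Fin k → V,
      |(sample Γ G₁ f - sample Γ G₂ f) - (sample Γ H₁ f - sample Γ H₂ f)| ≤
        4 * bd Γ * ∑ c : Fin k, ∑ a, ∑ b, if f c = z then D (f a) (f b) else 0 := by
    intro f
    -- Here `p` counts the coordinates that hit `z`; a map avoiding `z` sees no change in either
    -- pair of graphs.
    have hp := abs_sample_second_diff_le Γ hD h1 h2 (f := f)
      (p := ∑ c : Fin k, if f c = z then 1 else 0)
      (by
        by_cases h : ∃ c, f c = z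
        · obtain ⟨c, hc⟩ := h
          right
          refine le_trans ?_ (Finset.single_le_sum
            (f := fun c => if f c = z then (1 : ℝ) else 0) (fun c _ => ?_) (Finset.mem_univ c))
          · simp [hc]
          · split_ifs <;> simp
        · left
          push Not at h
          simp [h])
      (fun hp a b => by
        have : ∀ c, f c ≠ z := by simpa [Finset.sum_eq_zero_iff] using hp
        exact h3 _ _ (this a) (this b))
      (fun hp a b => by
        have : ∀ c, f c ≠ z := by simpa [Finset.sum_eq_zero_iff] using hp
        exact h4 _ _ (this a) (this b))
    refine hp.trans (le_of_eq ?_)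
    congr 1
    rw [Finset.sum_mul]
    refine Finset.sum_congr rfl fun c _ => ?_
    split_ifs <;> simp
  have h5 := (abs_avg_le _).trans (avg_mono key)
  rw [avg_const_mul, avg_sum] at h5
  have h6 : ∀ c : Fin k, avg (fun f : Fin k → V =>
      ∑ a, ∑ b, if f c = z then D (f a) (f b) else 0) ≤
        (k : ℝ) ^ 2 * ((∑ u, ∑ v, D u v) / (Fintype.card V : ℝ) ^ 2 / Fintype.card V) := by
    intro c
    rw [avg_sum]
    calc _ = ∑ a : Fin k, ∑ b : Fin k,
          avg (fun f : Fin k → V => if f c = z then D (f a) (f b) else 0) :=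
          Finset.sum_congr rfl fun a _ => by rw [avg_sum]
      _ ≤ ∑ a : Fin k, ∑ b : Fin k,
          ((∑ u, ∑ v, D u v) / (Fintype.card V : ℝ) ^ 2 / Fintype.card V) := by
          refine Finset.sum_le_sum fun a _ => Finset.sum_le_sum fun b _ => ?_
          rw [avg_pin c z (fun f => D (f a) (f b))]
          refine div_le_div_of_nonneg_right ?_ hn.le
          -- A coordinate pinned to `z` contributes nothing, as `D` vanishes there. Otherwise the
          -- pair is independent of the pin, which gives a full extra factor `1/n`.
          by_cases ha : a = c
          · subst ha
            simp only [Function.update_self, hDz]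
            rw [avg_const]
            positivity
          by_cases hb : b = c
          · subst hb
            simp only [Function.update_self, hDz']
            rw [avg_const]
            positivity
          simp only [Function.update_of_ne ha, Function.update_of_ne hb]
          by_cases hab : a = b
          · subst hab
            simp only [hDd]
            rw [avg_const]
            positivity
          · rw [avg_eval_eval hab D]
      _ = _ := by
          simp
          ring
  have h7 := Finset.sum_le_sum fun c (_ : c ∈ Finset.univ) => h6 c
  rw [Finset.sum_const, Finset.card_univ, Fintype.card_fin, nsmul_eq_mul] at h7
  have h8 := h5.trans (mul_le_mul_of_nonneg_left h7 (by linarith))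
  calc _ ≤ (Fintype.card V : ℝ) * (4 * bd Γ * (k * ((k : ℝ) ^ 2 *
        ((∑ u, ∑ v, D u v) / (Fintype.card V : ℝ) ^ 2 / Fintype.card V)))) :=
        mul_le_mul_of_nonneg_left h8 hn.le
    _ = _ := by
        field_simp

open Classical in
lemma flipPair_adj {V : Type} (G : SimpleGraph V) {u v : V} (huv : u ≠ v) (a b : V) :
    (flipPair G u v).Adj a b ↔
      (if (a = u ∧ b = v) ∨ (a = v ∧ b = u) then ¬ G.Adj a b else G.Adj a b) := by
  have hne : (a = u ∧ b = v) ∨ (a = v ∧ b = u) → a ≠ b := by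
    rintro (⟨rfl, rfl⟩ | ⟨rfl, rfl⟩)
    · exact huv
    · exact huv.symm
  simp only [flipPair, symmDiff, SimpleGraph.sup_adj, SimpleGraph.sdiff_adj,
    SimpleGraph.edge_adj]
  by_cases h : (a = u ∧ b = v) ∨ (a = v ∧ b = u)
  · rw [if_pos h]
    simp only [h, hne h, ne_eq, not_false_eq_true, and_self, not_true_eq_false, and_false,
      false_or, true_and]
  · rw [if_neg h]
    simp only [h, false_and, not_false_eq_true, and_true, or_false]

lemma dd_flipPair {V : Type} (G : SimpleGraph V) {u v : V} (huv : u ≠ v) (a b : V)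
    (h : ¬ ((a = u ∧ b = v) ∨ (a = v ∧ b = u))) : dd G (flipPair G u v) a b = 0 := by
  rw [dd_eq_zero, flipPair_adj G huv, if_neg h]

lemma dd_flipPair_flipPair {V : Type} (G H : SimpleGraph V) {u v : V} (huv : u ≠ v) (a b : V) :
    dd (flipPair G u v) (flipPair H u v) a b = dd G H a b := by
  unfold dd
  congr 1
  rw [flipPair_adj G huv, flipPair_adj H huv]
  split_ifs
  · rw [not_iff_not]
  · rfl

/-- Second differences for a flip of the pair `uv`. -/
lemma abs_flip_second_diff_le [Nonempty V] (G H : SimpleGraph V) {u v : V} (huv : u ≠ v)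
    (h0 : dd G H u v = 0) :
    (Fintype.card V : ℝ) ^ 2 * |(dens Γ G - dens Γ (flipPair G u v)) -
        (dens Γ H - dens Γ (flipPair H u v))| ≤
      4 * bd Γ * (k : ℝ) ^ 4 * ((ddeg G H u + ddeg G H v) / Fintype.card V +
        dsize G H / (Fintype.card V : ℝ) ^ 2) := by
  classical
  have hb := bd_nonneg Γ
  have hn : (0 : ℝ) < Fintype.card V := by exact_mod_cast Fintype.card_pos
  set E : ℝ := (ddeg G H u + ddeg G H v) / Fintype.card V +
        dsize G H / (Fintype.card V : ℝ) ^ 2 with hE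
  have hu := ddeg_nonneg G H u
  have hv := ddeg_nonneg G H v
  have hs := dsize_nonneg G H
  have hE0 : 0 ≤ E := by positivity
  have hE1 : ddeg G H u / Fintype.card V ≤ E := by
    rw [hE, add_div]
    have : 0 ≤ ddeg G H v / Fintype.card V := by positivity
    have : 0 ≤ dsize G H / (Fintype.card V : ℝ) ^ 2 := by positivity
    linarith
  have hE2 : ddeg G H v / Fintype.card V ≤ E := by
    rw [hE, add_div]
    have : 0 ≤ ddeg G H u / Fintype.card V := by positivity
    have : 0 ≤ dsize G H / (Fintype.card V : ℝ) ^ 2 := by positivity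
    linarith
  have hE3 : dsize G H / (Fintype.card V : ℝ) ^ 2 ≤ E := by
    rw [hE]
    have : 0 ≤ (ddeg G H u + ddeg G H v) / Fintype.card V := by positivity
    linarith
  simp only [dens]
  rw [← avg_sub, ← avg_sub, ← avg_sub]
  have hpos : ∀ (f : Fin k → V) (c d : Fin k), (0 : ℝ) ≤ if f c = u ∧ f d = v then 1 else 0 := by
    intro f c d
    split_ifs <;> simp
  have hno : ∀ f : Fin k → V, (∑ c, ∑ d, if f c = u ∧ f d = v then (1 : ℝ) else 0) = 0 →
      ∀ c d, ¬ (f c = u ∧ f d = v) := by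
    intro f hp c d h
    rw [Finset.sum_eq_zero_iff_of_nonneg
      (fun c _ => Finset.sum_nonneg fun d _ => hpos f c d)] at hp
    have := hp c (Finset.mem_univ _)
    rw [Finset.sum_eq_zero_iff_of_nonneg (fun d _ => hpos f c d)] at this
    have := this d (Finset.mem_univ _)
    rw [if_pos h] at this
    norm_num at this
  have key : ∀ f : Fin k → V,
      |(sample Γ G f - sample Γ (flipPair G u v) f) -
          (sample Γ H f - sample Γ (flipPair H u v) f)| ≤
        4 * bd Γ * ∑ c, ∑ d, ∑ a, ∑ b, if f c = u ∧ f d = v then dd G H (f a) (f b) else 0 := by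
    intro f
    have hp := abs_sample_second_diff_le Γ (dd_zero_or_one G H) (G₁ := G) (H₁ := H)
      (G₂ := flipPair G u v) (H₂ := flipPair H u v) (fun _ _ => le_rfl)
      (fun a b => (dd_flipPair_flipPair G H huv a b).le) (f := f)
      (p := ∑ c, ∑ d, if f c = u ∧ f d = v then 1 else 0)
      (by
        by_cases h : ∃ c d, f c = u ∧ f d = v
        · obtain ⟨c, d, hcd⟩ := h
          right
          refine le_trans ?_ (Finset.single_le_sum
            (f := fun c => ∑ d, if f c = u ∧ f d = v then (1 : ℝ) else 0)
            (fun c _ => Finset.sum_nonneg fun d _ => hpos f c d) (Finset.mem_univ c))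
          refine le_trans ?_ (Finset.single_le_sum
            (f := fun d => if f c = u ∧ f d = v then (1 : ℝ) else 0)
            (fun d _ => hpos f c d) (Finset.mem_univ d))
          simp [hcd]
        · left
          push Not at h
          refine Finset.sum_eq_zero fun c _ => Finset.sum_eq_zero fun d _ => ?_
          rw [if_neg]
          rintro ⟨h1, h2⟩
          exact h c d h1 h2)
      (fun hp a b => dd_flipPair G huv _ _ (by
        rintro (h | h)
        · exact hno f hp a b h
        · exact hno f hp b a h.symm))
      (fun hp a b => dd_flipPair H huv _ _ (by
        rintro (h | h)
        · exact hno f hp a b h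
        · exact hno f hp b a h.symm))
    refine hp.trans (le_of_eq ?_)
    congr 1
    rw [Finset.sum_mul]
    refine Finset.sum_congr rfl fun c _ => ?_
    rw [Finset.sum_mul]
    refine Finset.sum_congr rfl fun d _ => ?_
    split_ifs <;> simp
  have h5 := (abs_avg_le _).trans (avg_mono key)
  rw [avg_const_mul] at h5
  have h6 : avg (fun f : Fin k → V => ∑ c, ∑ d, ∑ a, ∑ b,
      if f c = u ∧ f d = v then dd G H (f a) (f b) else 0) ≤
        (k : ℝ) ^ 4 * (E / (Fintype.card V : ℝ) ^ 2) := by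
    have e1 : avg (fun f : Fin k → V => ∑ c, ∑ d, ∑ a, ∑ b,
        if f c = u ∧ f d = v then dd G H (f a) (f b) else 0) =
        ∑ c : Fin k, ∑ d : Fin k, ∑ a : Fin k, ∑ b : Fin k, avg (fun f : Fin k → V =>
          if f c = u ∧ f d = v then dd G H (f a) (f b) else 0) := by
      rw [avg_sum]
      refine Finset.sum_congr rfl fun c _ => ?_
      rw [avg_sum]
      refine Finset.sum_congr rfl fun d _ => ?_
      rw [avg_sum]
      refine Finset.sum_congr rfl fun a _ => ?_
      rw [avg_sum]
    rw [e1]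
    calc _ ≤ ∑ c : Fin k, ∑ d : Fin k, ∑ a : Fin k, ∑ b : Fin k,
          (E / (Fintype.card V : ℝ) ^ 2) := by
          refine Finset.sum_le_sum fun c _ => Finset.sum_le_sum fun d _ =>
            Finset.sum_le_sum fun a _ => Finset.sum_le_sum fun b _ => ?_
          by_cases hcd : c = d
          · subst hcd
            have : ∀ f : Fin k → V, ¬ (f c = u ∧ f c = v) := by
              rintro f ⟨h1, h2⟩
              exact huv (h1.symm.trans h2)
            simp only [this, if_false]
            rw [avg_const]
            positivity
          rw [avg_pin_pin hcd u v (fun f => dd G H (f a) (f b))]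
          refine div_le_div_of_nonneg_right ?_ (by positivity)
          have hz : ∀ r : ℝ, r = 0 → avg (fun _ : Fin k → V => r) ≤ E := by
            intro r hr
            rw [avg_const, hr]
            exact hE0
          -- With `c` and `d` pinned to `u` and `v`, a differing pair disjoint from both costs the
          -- normalised size, one sharing a single endpoint costs a normalised degree, and the pair
          -- `uv` itself is harmless by `h0`.
          by_cases hab : a = b
          · subst hab
            simp only [dd_self]
            exact hz 0 rfl
          by_cases hac : a = c
          · subst hac
            simp only [Function.update_of_ne hcd, Function.update_self]
            by_cases hbd : b = d
            · subst hbd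
              simp only [Function.update_self]
              exact hz _ h0
            · simp only [Function.update_of_ne hbd, Function.update_of_ne (Ne.symm hab)]
              rw [avg_eval b (fun w => dd G H u w)]
              exact hE1
          by_cases had : a = d
          · subst had
            simp only [Function.update_self]
            by_cases hbc : b = c
            · subst hbc
              simp only [Function.update_of_ne hcd, Function.update_self]
              exact hz _ (by rw [dd_symm, h0])
            · simp only [Function.update_of_ne hbc, Function.update_of_ne (Ne.symm hab)]
              rw [avg_eval b (fun w => dd G H v w)]
              exact hE2
          simp only [Function.update_of_ne hac, Function.update_of_ne had]
          by_cases hbd : b = d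
          · subst hbd
            simp only [Function.update_self]
            simp only [dd_symm G H _ v]
            rw [avg_eval a (fun w => dd G H v w)]
            exact hE2
          simp only [Function.update_of_ne hbd]
          by_cases hbc : b = c
          · subst hbc
            simp only [Function.update_self]
            simp only [dd_symm G H _ u]
            rw [avg_eval a (fun w => dd G H u w)]
            exact hE1
          simp only [Function.update_of_ne hbc]
          rw [avg_eval_eval hab (dd G H)]
          exact hE3
      _ = _ := by
          simp
          ring
  have h8 := h5.trans (mul_le_mul_of_nonneg_left h6 (by linarith))
  calc _ ≤ (Fintype.card V : ℝ) ^ 2 * (4 * bd Γ * ((k : ℝ) ^ 4 *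
        (E / (Fintype.card V : ℝ) ^ 2))) := mul_le_mul_of_nonneg_left h8 (by positivity)
    _ = _ := by
        field_simp

end diff

end

end PartiteStability

namespace PartiteStability

noncomputable section

/-! ### Limits of averages of functions of labels -/

open Classical in
/-- The proportion of elements with label `l`. -/
def cdens {V L : Type} [Fintype V] (c : V → L) (l : L) : ℝ :=
  ((Finset.univ.filter fun v => c v = l).card : ℝ) / Fintype.card V

/-- The expectation of `ψ` over `k` independent labels with distribution `w`. -/
def mean {k : ℕ} {L : Type} (w : L → ℝ) (ψ : (Fin k → L) → ℝ) : ℝ :=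
  ∑' ℓ, ψ ℓ * ∏ b, w (ℓ b)

section mean

variable {k : ℕ} {L : Type} {w : L → ℝ} {ψ : (Fin k → L) → ℝ} {B : ℝ}

/-- Finitely many words use finitely many letters, and the sum over all words in that alphabet is
the `k`-th power of a number at most one. -/
lemma sum_prod_le_one (hw0 : ∀ l, 0 ≤ w l) (hw : HasSum w 1) (u : Finset (Fin k → L)) :
    ∑ ℓ ∈ u, ∏ b, w (ℓ b) ≤ 1 := by
  classical
  set A : Finset L := u.biUnion fun ℓ => Finset.univ.image ℓ with hA
  have hu : u ⊆ Fintype.piFinset fun _ : Fin k => A := by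
    intro ℓ hℓ
    rw [Fintype.mem_piFinset]
    intro b
    rw [hA, Finset.mem_biUnion]
    exact ⟨ℓ, hℓ, Finset.mem_image_of_mem _ (Finset.mem_univ _)⟩
  refine (Finset.sum_le_sum_of_subset_of_nonneg hu
    fun ℓ _ _ => Finset.prod_nonneg fun b _ => hw0 _).trans ?_
  rw [← Finset.prod_univ_sum (fun _ => A) fun _ => w]
  refine Finset.prod_le_one (fun b _ => Finset.sum_nonneg fun l _ => hw0 l) fun b _ => ?_
  exact sum_le_hasSum A (fun l _ => hw0 l) hw

lemma summable_prod (hw0 : ∀ l, 0 ≤ w l) (hw : HasSum w 1) :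
    Summable fun ℓ : Fin k → L => ∏ b, w (ℓ b) :=
  summable_of_sum_le (fun _ => Finset.prod_nonneg fun _ _ => hw0 _) (sum_prod_le_one hw0 hw)

/-- The error is at most the bound on `ψ` times the probability that some letter falls outside `A`.
This reduces countably many labels to finitely many. -/
lemma abs_mean_sub_le (hw0 : ∀ l, 0 ≤ w l) (hw : HasSum w 1) (hψ : ∀ ℓ, |ψ ℓ| ≤ B)
    (hB : 0 ≤ B) (A : Finset L) :
    |mean w ψ - ∑ ℓ ∈ Fintype.piFinset (fun _ : Fin k => A), ψ ℓ * ∏ b, w (ℓ b)| ≤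
      B * (1 - (∑ l ∈ A, w l) ^ k) := by
  classical
  have hp : ∀ ℓ : Fin k → L, 0 ≤ ∏ b, w (ℓ b) := fun ℓ => Finset.prod_nonneg fun _ _ => hw0 _
  have hs := summable_prod (k := k) hw0 hw
  have hle : ∀ ℓ, |ψ ℓ * ∏ b, w (ℓ b)| ≤ B * ∏ b, w (ℓ b) := fun ℓ => by
    rw [abs_mul, abs_of_nonneg (hp ℓ)]
    exact mul_le_mul_of_nonneg_right (hψ ℓ) (hp ℓ)
  have hs' : Summable fun ℓ : Fin k → L => ψ ℓ * ∏ b, w (ℓ b) :=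
    Summable.of_norm_bounded (hs.mul_left B) fun ℓ => by rw [Real.norm_eq_abs]; exact hle ℓ
  set U := Fintype.piFinset (fun _ : Fin k => A)
  have h1 := hs'.sum_add_tsum_subtype_compl U
  have h2 := hs.sum_add_tsum_subtype_compl U
  have h3 : ∑' ℓ : Fin k → L, ∏ b, w (ℓ b) ≤ 1 :=
    hs.tsum_le_of_sum_le (sum_prod_le_one hw0 hw)
  have h4 : ∑ ℓ ∈ U, ∏ b, w (ℓ b) = (∑ l ∈ A, w l) ^ k := by
    rw [← Finset.prod_univ_sum (fun _ => A) fun _ => w]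
    simp
  rw [mean, ← h1, add_sub_cancel_left]
  have hc := hs.comp_injective (i := ((↑) : {ℓ // ℓ ∉ U} → (Fin k → L))) Subtype.val_injective
  have hc' := hs'.comp_injective (i := ((↑) : {ℓ // ℓ ∉ U} → (Fin k → L))) Subtype.val_injective
  calc _ ≤ ∑' ℓ : {ℓ // ℓ ∉ U}, B * ∏ b, w (ℓ.1 b) := by
        have := tsum_of_norm_bounded (f := fun ℓ : {ℓ // ℓ ∉ U} => ψ ℓ.1 * ∏ b, w (ℓ.1 b))
          (g := fun ℓ : {ℓ // ℓ ∉ U} => B * ∏ b, w (ℓ.1 b)) (hc.mul_left B).hasSum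
          fun ℓ => by rw [Real.norm_eq_abs]; exact hle ℓ.1
        rwa [Real.norm_eq_abs] at this
    _ = B * ∑' ℓ : {ℓ // ℓ ∉ U}, ∏ b, w (ℓ.1 b) := tsum_mul_left
    _ ≤ _ := by
        refine mul_le_mul_of_nonneg_left ?_ hB
        rw [h4] at h2
        linarith

variable {V : Type} [Fintype V]

lemma cdens_nonneg (c : V → L) (l : L) : 0 ≤ cdens c l := by
  unfold cdens
  positivity

lemma sum_cdens_le_one (c : V → L) (A : Finset L) : ∑ l ∈ A, cdens c l ≤ 1 := by
  classical
  unfold cdens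
  rw [← Finset.sum_div]
  refine div_le_one_of_le₀ ?_ (by positivity)
  rw [← Nat.cast_sum]
  have := Finset.card_eq_sum_card_fiberwise (f := c) (s := Finset.univ.filter fun v => c v ∈ A)
    (t := A) (by intro v; simp)
  have h2 : ∑ l ∈ A, (Finset.univ.filter fun v => c v = l).card =
      (Finset.univ.filter fun v => c v ∈ A).card := by
    rw [this]
    refine Finset.sum_congr rfl fun l hl => ?_
    congr 1
    ext v
    simp only [Finset.mem_filter, Finset.mem_univ, true_and]
    constructor
    · intro h
      exact ⟨h ▸ hl, h⟩
    · exact fun h => h.2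
  rw [h2]
  exact_mod_cast Finset.card_le_univ _

lemma sum_cdens_eq_one [Nonempty V] (c : V → L) (A : Finset L) (hA : ∀ v, c v ∈ A) :
    ∑ l ∈ A, cdens c l = 1 := by
  classical
  unfold cdens
  rw [← Finset.sum_div, ← Nat.cast_sum,
    ← Finset.card_eq_sum_card_fiberwise (f := c) (s := Finset.univ) (fun v _ => hA v),
    Finset.card_univ, div_self]
  exact_mod_cast Fintype.card_ne_zero

open Classical in
-- The maps with a given label word form a product of label classes, so their proportion is the
-- product of the label densities.
lemma avg_restrict (c : V → L) (ψ : (Fin k → L) → ℝ) (A : Finset L) :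
    avg (fun f : Fin k → V => if ∀ b, c (f b) ∈ A then ψ (c ∘ f) else 0) =
      ∑ ℓ ∈ Fintype.piFinset (fun _ : Fin k => A), ψ ℓ * ∏ b, cdens c (ℓ b) := by
  rw [avg, ← Finset.sum_filter]
  rw [← Finset.sum_fiberwise_of_maps_to (g := fun f : Fin k → V => c ∘ f)
    (t := Fintype.piFinset fun _ : Fin k => A) (by
      intro f hf
      rw [Fintype.mem_piFinset]
      simpa using hf), Finset.sum_div]
  refine Finset.sum_congr rfl fun ℓ hℓ => ?_
  rw [Finset.sum_congr rfl (g := fun _ => ψ ℓ) (by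
    intro f hf
    rw [(Finset.mem_filter.1 hf).2]), Finset.sum_const, nsmul_eq_mul]
  have : ((Finset.univ.filter fun f : Fin k → V => ∀ b, c (f b) ∈ A).filter fun f => c ∘ f = ℓ) =
      Fintype.piFinset fun b => Finset.univ.filter fun v => c v = ℓ b := by
    ext f
    simp only [Finset.mem_filter, Finset.mem_univ, true_and, Fintype.mem_piFinset]
    rw [Fintype.mem_piFinset] at hℓ
    constructor
    · rintro ⟨-, rfl⟩ b
      rfl
    · intro h
      refine ⟨fun b => ?_, funext h⟩
      rw [h b]
      exact hℓ b
  rw [this, Fintype.card_piFinset]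
  unfold cdens
  rw [Finset.prod_div_distrib, Finset.prod_const, Finset.card_univ, Fintype.card_fin]
  push_cast
  ring

/-- Finite counterpart of `abs_mean_sub_le`, with the empirical label densities in place of `w`. -/
lemma abs_avg_sub_le [Nonempty V] (c : V → L) (hψ : ∀ ℓ, |ψ ℓ| ≤ B) (A : Finset L) :
    |avg (fun f : Fin k → V => ψ (c ∘ f)) -
        ∑ ℓ ∈ Fintype.piFinset (fun _ : Fin k => A), ψ ℓ * ∏ b, cdens c (ℓ b)| ≤
      B * (1 - (∑ l ∈ A, cdens c l) ^ k) := by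
  classical
  have h1 : (∑ l ∈ A, cdens c l) ^ k =
      avg (fun f : Fin k → V => if ∀ b, c (f b) ∈ A then (1 : ℝ) else 0) := by
    rw [avg_restrict c (fun _ => (1 : ℝ)) A]
    simp only [one_mul]
    rw [← Finset.prod_univ_sum (fun _ => A) fun _ => cdens c]
    simp
  rw [← avg_restrict, h1, ← avg_sub, ← avg_const (k := k) (V := V) (1 : ℝ), ← avg_sub,
    ← avg_const_mul]
  refine (abs_avg_le _).trans (avg_mono fun f => ?_)
  rw [avg_const]
  split_ifs
  · simp
  · simpa using hψ _

/-- Averages of functions of labels converge if the densities of the labels do. -/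
lemma tendsto_avg {ι : Type*} {l : Filter ι} {V : ι → Type} [∀ i, Fintype (V i)]
    (hV : ∀ᶠ i in l, Nonempty (V i)) {c : ∀ i, V i → L} (hw0 : ∀ a, 0 ≤ w a) (hw : HasSum w 1)
    (hc : ∀ a, Tendsto (fun i => cdens (c i) a) l (𝓝 (w a))) (ψ : (Fin k → L) → ℝ)
    (hψ : ∀ ℓ, |ψ ℓ| ≤ B) :
    Tendsto (fun i => avg fun f : Fin k → V i => ψ (c i ∘ f)) l (𝓝 (mean w ψ)) := by
  classical
  -- Without any label word the bound on `ψ` says nothing about the sign of `B`, so this degenerate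
  -- case is separated.
  rcases isEmpty_or_nonempty (Fin k → L) with hE | ⟨⟨ℓ₀⟩⟩
  · have : ∀ i, avg (fun f : Fin k → V i => ψ (c i ∘ f)) = 0 := by
      intro i
      have : IsEmpty (Fin k → V i) := ⟨fun f => hE.false (c i ∘ f)⟩
      simp [avg]
    simpa [this, mean] using tendsto_const_nhds
  have hB : 0 ≤ B := (abs_nonneg _).trans (hψ ℓ₀)
  rw [Metric.tendsto_nhds]
  intro ε hε
  have hA : Tendsto (fun A : Finset L => B * (1 - (∑ a ∈ A, w a) ^ k)) atTop (𝓝 0) := by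
    have h1 : Tendsto (fun A : Finset L => ∑ a ∈ A, w a) atTop (𝓝 1) := hw
    have := ((h1.pow k).const_sub 1).const_mul B
    simpa using this
  obtain ⟨A, hA⟩ := (hA.eventually (gt_mem_nhds (show 0 < ε / 4 by linarith))).exists
  have t1 : Tendsto (fun i => ∑ ℓ ∈ Fintype.piFinset (fun _ : Fin k => A),
      ψ ℓ * ∏ b, cdens (c i) (ℓ b)) l (𝓝 (∑ ℓ ∈ Fintype.piFinset (fun _ : Fin k => A),
      ψ ℓ * ∏ b, w (ℓ b))) :=
    -- On a finite alphabet the expression is a polynomial in the densities, hence continuous. The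
    -- two truncation errors and this convergence cost `ε / 4` each.
    tendsto_finsetSum _ fun ℓ _ => (tendsto_finsetProd _ fun b _ => hc (ℓ b)).const_mul _
  have t2 : Tendsto (fun i => B * (1 - (∑ a ∈ A, cdens (c i) a) ^ k)) l
      (𝓝 (B * (1 - (∑ a ∈ A, w a) ^ k))) :=
    (((tendsto_finsetSum _ fun a _ => hc a).pow k).const_sub 1).const_mul B
  filter_upwards [hV, Metric.tendsto_nhds.1 t1 (ε / 4) (by linarith),
    t2.eventually (gt_mem_nhds hA)] with i hi h1 h2
  have h3 := abs_avg_sub_le (c i) hψ A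
  have h4 := abs_mean_sub_le hw0 hw hψ hB A
  rw [Real.dist_eq] at h1 ⊢
  rw [abs_le] at h3 h4
  rw [abs_lt] at h1 ⊢
  constructor <;> linarith [h1.1, h1.2, h3.1, h3.2, h4.1, h4.2]

end mean

end

end PartiteStability

namespace PartiteStability

noncomputable section

/-! ### Densities in graphs given by labels -/

open Classical in
-- Used to pass from sampled graphs to functions of labels alone, which agree off the maps with a
-- collision. The map `φ` allows for pinned coordinates.
lemma abs_avg_sub_le_of_injective {k : ℕ} {V : Type} [Fintype V] {g h : (Fin k → V) → ℝ}
    {φ : (Fin k → V) → (Fin k → V)} {B : ℝ}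
    (hinj : ∀ f, Function.Injective (φ f) → g f = h f) (hB : ∀ f, |g f - h f| ≤ B) :
    |avg g - avg h| ≤ B * avg fun f => if Function.Injective (φ f) then 0 else (1 : ℝ) := by
  rw [← avg_sub, ← avg_const_mul]
  refine (abs_avg_le _).trans (avg_mono fun f => ?_)
  split_ifs with hf
  · simp [hinj f hf]
  · simpa using hB f

open Classical in
lemma avg_not_injective_update_le {k : ℕ} {V : Type} [Fintype V] [Nonempty V] (a : Fin k)
    (z : V) :
    avg (fun f : Fin k → V => if Function.Injective (Function.update f a z) then 0 else (1 : ℝ)) ≤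
      ((k : ℝ) ^ 2 + k) / Fintype.card V := by
  -- A collision after the update is either one of `f` or a coordinate already equal to `z`. The sum
  -- is written as a difference so that `avg_sub` applies.
  have h1 : ∀ f : Fin k → V, (if Function.Injective (Function.update f a z) then 0 else (1 : ℝ)) ≤
      (if Function.Injective f then 0 else (1 : ℝ)) -
        ∑ d : Fin k, -(if f d = z then (1 : ℝ) else 0) := by
    intro f
    rw [Finset.sum_neg_distrib, sub_neg_eq_add]
    have hs : 0 ≤ ∑ d : Fin k, (if f d = z then (1 : ℝ) else 0) :=
      Finset.sum_nonneg fun d _ => by split_ifs <;> simp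
    by_cases hf : Function.Injective (Function.update f a z)
    · rw [if_pos hf]
      split_ifs <;> linarith
    rw [if_neg hf]
    by_cases hf' : Function.Injective f
    · rw [if_pos hf', zero_add]
      by_contra hlt
      have h0 : ∀ d, f d ≠ z := by
        intro d hd
        refine hlt (le_trans ?_ (Finset.single_le_sum
          (f := fun d => if f d = z then (1 : ℝ) else 0)
          (fun d _ => by split_ifs <;> simp) (Finset.mem_univ d)))
        simp [hd]
      refine hf fun i j hij => ?_
      by_cases hi : i = a <;> by_cases hj : j = a
      · rw [hi, hj]
      · subst hi
        rw [Function.update_self, Function.update_of_ne hj] at hij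
        exact absurd hij.symm (h0 j)
      · subst hj
        rw [Function.update_self, Function.update_of_ne hi] at hij
        exact absurd hij (h0 i)
      · rw [Function.update_of_ne hi, Function.update_of_ne hj] at hij
        exact hf' hij
    · rw [if_neg hf']
      linarith
  refine (avg_mono h1).trans ?_
  rw [avg_sub, avg_sum, add_div]
  have h2 := avg_not_injective_le (k := k) (V := V)
  have h3 : ∑ d : Fin k, avg (fun f : Fin k → V => -(if f d = z then (1 : ℝ) else 0)) =
      - (k / Fintype.card V) := by
    have : ∀ d : Fin k, avg (fun f : Fin k → V => -(if f d = z then (1 : ℝ) else 0)) =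
        - (1 / Fintype.card V) := by
      intro d
      rw [avg_eval d (fun v => -(if v = z then (1 : ℝ) else 0))]
      simp
      ring
    simp only [this]
    simp
    ring
  rw [h3]
  linarith

open Classical in
lemma avg_not_injective_update_update_le {k : ℕ} {V : Type} [Fintype V] [Nonempty V]
    (a b : Fin k) {u v : V} (huv : u ≠ v) :
    avg (fun f : Fin k → V => if Function.Injective (Function.update (Function.update f a u) b v)
      then 0 else (1 : ℝ)) ≤ 2 * (((k : ℝ) ^ 2 + k) / Fintype.card V) := by
  have h1 : ∀ f : Fin k → V,
      (if Function.Injective (Function.update (Function.update f a u) b v) then 0 else (1 : ℝ)) ≤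
      (if Function.Injective (Function.update f a u) then 0 else (1 : ℝ)) -
        -(if Function.Injective (Function.update f b v) then 0 else (1 : ℝ)) := by
    intro f
    by_cases hf : Function.Injective (Function.update f a u)
    · by_cases hf' : Function.Injective (Function.update f b v)
      · rw [if_pos]
        · rw [if_pos hf, if_pos hf']
          simp
        have key : ∀ d, d ≠ a → d ≠ b → f d ≠ u ∧ f d ≠ v := by
          intro d hda hdb
          constructor
          · intro h
            exact hda (hf (by rw [Function.update_of_ne hda, Function.update_self, h]))
          · intro h
            exact hdb (hf' (by rw [Function.update_of_ne hdb, Function.update_self, h]))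
        have eva : ∀ i, Function.update (Function.update f a u) b v i =
            if i = b then v else if i = a then u else f i := by
          intro i
          simp [Function.update_apply]
        intro i j hij
        rw [eva, eva] at hij
        by_cases hib : i = b <;> by_cases hjb : j = b
        · rw [hib, hjb]
        · rw [if_pos hib, if_neg hjb] at hij
          split_ifs at hij with h
          · exact absurd hij.symm huv
          · exact absurd hij.symm (key j h hjb).2
        · rw [if_pos hjb, if_neg hib] at hij
          split_ifs at hij with h
          · exact absurd hij huv
          · exact absurd hij (key i h hib).2
        · rw [if_neg hib, if_neg hjb] at hij
          refine hf ?_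
          rw [Function.update_apply, Function.update_apply]
          exact hij
      · rw [if_neg hf']
        split_ifs <;> simp
    · rw [if_neg hf]
      split_ifs <;> simp
  refine (avg_mono h1).trans ?_
  rw [avg_sub]
  have e : avg (fun f : Fin k → V =>
      -(if Function.Injective (Function.update f b v) then 0 else (1 : ℝ))) =
      - avg (fun f : Fin k → V =>
        if Function.Injective (Function.update f b v) then 0 else (1 : ℝ)) := by
    have := avg_const_mul (-1) fun f : Fin k → V =>
        if Function.Injective (Function.update f b v) then 0 else (1 : ℝ)
    simpa only [neg_mul, one_mul] using this
  rw [e]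
  have := avg_not_injective_update_le a u (k := k) (V := V)
  have := avg_not_injective_update_le b v (k := k) (V := V)
  linarith

lemma labelGraph_comap {V W : Type} (c : V → Option ℕ) {f : W → V} (hf : Function.Injective f) :
    (labelGraph c).comap f = labelGraph (c ∘ f) := by
  ext a b
  simp [labelGraph, hf.eq_iff]

lemma flipPair_comap {V W : Type} (G : SimpleGraph V) {f : W → V} (hf : Function.Injective f)
    {a b : W} (hab : a ≠ b) :
    (flipPair G (f a) (f b)).comap f = flipPair (G.comap f) a b := by
  classical
  ext i j
  rw [SimpleGraph.comap_adj, flipPair_adj _ (hf.ne hab), flipPair_adj _ hab]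
  simp [hf.eq_iff]

/-- The complete partite graph with parts given by the first components of the labels, where `z`
is instead adjacent to the vertices whose second label component is `true`. -/
def starGraph {V : Type} (c : V → Option ℕ × Bool) (z : V) : SimpleGraph V where
  Adj u v := u ≠ v ∧ ((u = z ∧ (c v).2 = true) ∨ (v = z ∧ (c u).2 = true) ∨
    (u ≠ z ∧ v ≠ z ∧ ((c u).1 ≠ (c v).1 ∨ (c u).1 = none)))
  symm.symm u v h := by
    obtain ⟨h0, h1 | h1 | ⟨h1, h2, h3⟩⟩ := h
    · exact ⟨h0.symm, Or.inr (Or.inl h1)⟩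
    · exact ⟨h0.symm, Or.inl h1⟩
    · refine ⟨h0.symm, Or.inr (Or.inr ⟨h2, h1, ?_⟩)⟩
      rcases h3 with h3 | h3
      · exact Or.inl h3.symm
      · by_cases hv : (c v).1 = none
        · exact Or.inr hv
        · left
          rw [h3]
          exact hv
  loopless.irrefl u h := h.1 rfl

lemma starGraph_comap {V W : Type} (c : V → Option ℕ × Bool) {f : W → V}
    (hf : Function.Injective f) (a : W) :
    (starGraph c (f a)).comap f = starGraph (c ∘ f) a := by
  ext i j
  simp [starGraph, hf.eq_iff]

/-- The label of the centre is never consulted, so it may be chosen arbitrarily. -/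
lemma starGraph_congr {V : Type} {c c' : V → Option ℕ × Bool} {z : V}
    (h : ∀ v, v ≠ z → c v = c' v) : starGraph c z = starGraph c' z := by
  ext u v
  simp only [starGraph]
  by_cases hu : u = z <;> by_cases hv : v = z
  · simp [hu, hv]
  · simp [hu, hv, h v hv]
  · simp [hu, hv, h u hu]
  · simp [hu, hv, h u hu, h v hv]

/-- The limit density of complete partite graphs. -/
def graphMean {k : ℕ} (Γ : SimpleGraph (Fin k) → ℝ) (w : Option ℕ → ℝ) : ℝ :=
  mean w fun ℓ : Fin k → Option ℕ => Γ (labelGraph ℓ)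

/-- The limit of the normalised loss in the density when a pair of vertices with labels `i` and
`j` is flipped. -/
def flipMean {k : ℕ} (Γ : SimpleGraph (Fin k) → ℝ) (w : Option ℕ → ℝ) (i j : Option ℕ) : ℝ :=
  ∑ a : Fin k, ∑ b : Fin k, if a = b then 0 else mean w fun ℓ : Fin k → Option ℕ =>
    Γ (labelGraph (Function.update (Function.update ℓ a i) b j)) -
      Γ (flipPair (labelGraph (Function.update (Function.update ℓ a i) b j)) a b)

/-- The limit of the normalised density at a single vertex. -/
def starMean {k : ℕ} (Γ : SimpleGraph (Fin k) → ℝ) (w : Option ℕ × Bool → ℝ) : ℝ :=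
  ∑ a : Fin k, mean w fun ℓ : Fin k → Option ℕ × Bool => Γ (starGraph ℓ a)

/-! ### Limits of densities, flip losses and star differences. -/

section limits

variable {k : ℕ} (Γ : SimpleGraph (Fin k) → ℝ) {ι : Type*} {l : Filter ι} {V : ι → Type}
  [∀ i, Fintype (V i)]

lemma tendsto_const_div_card (hV : Tendsto (fun i => Fintype.card (V i)) l atTop) (C : ℝ) :
    Tendsto (fun i => C / (Fintype.card (V i) : ℝ)) l (𝓝 0) :=
  (tendsto_natCast_atTop_atTop.comp hV).const_div_atTop C

lemma eventually_nonempty_of_card (hV : Tendsto (fun i => Fintype.card (V i)) l atTop) :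
    ∀ᶠ i in l, Nonempty (V i) := by
  filter_upwards [hV.eventually_ge_atTop 1] with i hi
  exact Fintype.card_pos_iff.1 hi

lemma tendsto_of_abs_sub_le {f g e : ι → ℝ} {L : ℝ} (hg : Tendsto g l (𝓝 L))
    (he : Tendsto e l (𝓝 0)) (h : ∀ᶠ i in l, |f i - g i| ≤ e i) : Tendsto f l (𝓝 L) := by
  have h1 : Tendsto (fun i => f i - g i) l (𝓝 0) :=
    squeeze_zero_norm' (by simpa only [Real.norm_eq_abs] using h) he
  simpa using h1.add hg

/-- The integrand of `graphMean` ignores whether sampled vertices coincide; this affects a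
proportion of order `1/n` of the maps. -/
lemma tendsto_dens_labelGraph {w : Option ℕ → ℝ} (hw0 : ∀ a, 0 ≤ w a) (hw : HasSum w 1)
    (hV : Tendsto (fun i => Fintype.card (V i)) l atTop) {c : ∀ i, V i → Option ℕ}
    (hc : ∀ a, Tendsto (fun i => cdens (c i) a) l (𝓝 (w a))) :
    Tendsto (fun i => dens Γ (labelGraph (c i))) l (𝓝 (graphMean Γ w)) := by
  classical
  have hN := eventually_nonempty_of_card hV
  refine tendsto_of_abs_sub_le (tendsto_avg hN hw0 hw hc _ fun ℓ => abs_le_bd Γ _)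
    (tendsto_const_div_card hV (2 * bd Γ * (k : ℝ) ^ 2)) ?_
  filter_upwards [hN] with i hi
  have h1 := abs_avg_sub_le_of_injective (φ := fun f => f) (g := sample Γ (labelGraph (c i)))
    (h := fun f : Fin k → V i => Γ (labelGraph (c i ∘ f))) (B := 2 * bd Γ)
    (fun f hf => by rw [sample, if_pos hf, labelGraph_comap _ hf])
    (fun f => by
      have h2 := abs_sample_le Γ (labelGraph (c i)) f
      have h3 := abs_le_bd Γ (labelGraph (c i ∘ f))
      have h4 := abs_sub (sample Γ (labelGraph (c i)) f) (Γ (labelGraph (c i ∘ f)))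
      linarith)
  have h5 := avg_not_injective_le (k := k) (V := V i)
  have hb := bd_nonneg Γ
  refine h1.trans ((mul_le_mul_of_nonneg_left h5 (by linarith)).trans (le_of_eq ?_))
  ring

/-- Only maps through both flipped vertices matter, and an injective one does so at a unique pair of
coordinates. The factor `n ^ 2` cancels the two pins, leaving an average of a function of labels. -/
lemma tendsto_flip {w : Option ℕ → ℝ} (hw0 : ∀ a, 0 ≤ w a) (hw : HasSum w 1)
    (hV : Tendsto (fun i => Fintype.card (V i)) l atTop) {c : ∀ i, V i → Option ℕ}
    (hc : ∀ a, Tendsto (fun i => cdens (c i) a) l (𝓝 (w a))) {u v : ∀ i, V i} {p q : Option ℕ}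
    (huv : ∀ᶠ i in l, u i ≠ v i ∧ c i (u i) = p ∧ c i (v i) = q) :
    Tendsto (fun i => (Fintype.card (V i) : ℝ) ^ 2 *
      (dens Γ (labelGraph (c i)) - dens Γ (flipPair (labelGraph (c i)) (u i) (v i)))) l
      (𝓝 (flipMean Γ w p q)) := by
  classical
  have hN := eventually_nonempty_of_card hV
  have hb := bd_nonneg Γ
  set θ : Fin k → Fin k → (Fin k → Option ℕ) → ℝ := fun a b ℓ =>
    Γ (labelGraph (Function.update (Function.update ℓ a p) b q)) -
      Γ (flipPair (labelGraph (Function.update (Function.update ℓ a p) b q)) a b) with hθ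
  have hθb : ∀ a b ℓ, |θ a b ℓ| ≤ 2 * bd Γ := by
    intro a b ℓ
    have h2 := abs_le_bd Γ (labelGraph (Function.update (Function.update ℓ a p) b q))
    have h3 := abs_le_bd Γ (flipPair (labelGraph (Function.update (Function.update ℓ a p) b q)) a b)
    exact (abs_sub _ _).trans (by linarith)
  have t1 : Tendsto (fun i => ∑ a : Fin k, ∑ b : Fin k, if a = b then 0 else
      avg fun f : Fin k → V i => θ a b (c i ∘ f)) l (𝓝 (flipMean Γ w p q)) := by
    refine tendsto_finsetSum _ fun a _ => tendsto_finsetSum _ fun b _ => ?_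
    split_ifs
    · exact tendsto_const_nhds
    · exact tendsto_avg hN hw0 hw hc _ (hθb a b)
  refine tendsto_of_abs_sub_le t1 (tendsto_const_div_card hV
    (∑ a : Fin k, ∑ b : Fin k, 4 * bd Γ * (2 * ((k : ℝ) ^ 2 + k)))) ?_
  filter_upwards [hN, huv] with i hi ⟨hne, hp, hq⟩
  have hn : (0 : ℝ) < Fintype.card (V i) := by exact_mod_cast Fintype.card_pos
  set G := labelGraph (c i)
  set G' := flipPair G (u i) (v i) with hG'
  have hsplit : ∀ f : Fin k → V i, sample Γ G f - sample Γ G' f =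
      ∑ a : Fin k, ∑ b : Fin k, if a = b then 0 else
        if f a = u i ∧ f b = v i then sample Γ G f - sample Γ G' f else 0 := by
    intro f
    by_cases hf : Function.Injective f
    · by_cases hex : ∃ a b, f a = u i ∧ f b = v i
      · obtain ⟨a, b, ha, hb⟩ := hex
        have hab : a ≠ b := by
          rintro rfl
          exact hne (ha.symm.trans hb)
        rw [Finset.sum_eq_single a, Finset.sum_eq_single b]
        · rw [if_neg hab, if_pos ⟨ha, hb⟩]
        · intro d _ hd
          split_ifs with h1 h2
          · rfl
          · exact absurd (hf (h2.2.trans hb.symm)) hd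
          · rfl
        · simp
        · intro d _ hd
          refine Finset.sum_eq_zero fun e _ => ?_
          split_ifs with h1 h2
          · rfl
          · exact absurd (hf (h2.1.trans ha.symm)) hd
          · rfl
        · simp
      · push Not at hex
        rw [Finset.sum_eq_zero]
        · rw [sample_congr Γ (G := G) (H := G'), sub_self]
          intro a b
          refine dd_flipPair G hne _ _ ?_
          rintro (⟨h1, h2⟩ | ⟨h1, h2⟩)
          · exact hex a b h1 h2
          · exact hex b a h2 h1
        · intro a _
          refine Finset.sum_eq_zero fun b _ => ?_
          split_ifs with h1 h2
          · rfl
          · exact absurd h2.2 (hex a b h2.1)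
          · rfl
    · simp [sample, hf]
  have e1 : (Fintype.card (V i) : ℝ) ^ 2 * (dens Γ G - dens Γ G') =
      ∑ a : Fin k, ∑ b : Fin k, if a = b then 0 else
        avg fun f : Fin k → V i =>
          sample Γ G (Function.update (Function.update f a (u i)) b (v i)) -
          sample Γ G' (Function.update (Function.update f a (u i)) b (v i)) := by
    rw [dens, dens, ← avg_sub]
    rw [show (fun f => sample Γ G f - sample Γ G' f) = fun f =>
      ∑ a : Fin k, ∑ b : Fin k, if a = b then 0 else
        if f a = u i ∧ f b = v i then sample Γ G f - sample Γ G' f else 0 from funext hsplit]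
    rw [avg_sum, Finset.mul_sum]
    refine Finset.sum_congr rfl fun a _ => ?_
    rw [avg_sum, Finset.mul_sum]
    refine Finset.sum_congr rfl fun b _ => ?_
    split_ifs with hab
    · simp [avg_const]
    · rw [avg_pin_pin hab (u i) (v i) (fun f => sample Γ G f - sample Γ G' f)]
      field_simp
  rw [e1, ← Finset.sum_sub_distrib, Finset.sum_div]
  refine (Finset.abs_sum_le_sum_abs _ _).trans (Finset.sum_le_sum fun a _ => ?_)
  rw [← Finset.sum_sub_distrib, Finset.sum_div]
  refine (Finset.abs_sum_le_sum_abs _ _).trans (Finset.sum_le_sum fun b _ => ?_)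
  split_ifs with hab
  · simp only [sub_self, abs_zero]
    positivity
  have h1 := abs_avg_sub_le_of_injective (B := 4 * bd Γ)
    (φ := fun f => Function.update (Function.update f a (u i)) b (v i))
    (g := fun f => sample Γ G (Function.update (Function.update f a (u i)) b (v i)) -
      sample Γ G' (Function.update (Function.update f a (u i)) b (v i)))
    (h := fun f => θ a b (c i ∘ f))
    (fun f hf => by
      simp only [sample, if_pos hf, hθ]
      have ea : Function.update (Function.update f a (u i)) b (v i) a = u i := by
        rw [Function.update_of_ne hab, Function.update_self]
      have eb : Function.update (Function.update f a (u i)) b (v i) b = v i := by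
        rw [Function.update_self]
      have ec : c i ∘ (Function.update (Function.update f a (u i)) b (v i)) =
          Function.update (Function.update (c i ∘ f) a p) b q := by
        rw [Function.comp_update, Function.comp_update, hp, hq]
      have h2 := flipPair_comap G hf hab
      rw [ea, eb] at h2
      rw [h2, labelGraph_comap _ hf, ec])
    (fun f => by
      have h2 := abs_sample_le Γ G (Function.update (Function.update f a (u i)) b (v i))
      have h3 := abs_sample_le Γ G' (Function.update (Function.update f a (u i)) b (v i))
      have h4 := hθb a b (c i ∘ f)
      have h5 := abs_sub (sample Γ G (Function.update (Function.update f a (u i)) b (v i)))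
        (sample Γ G' (Function.update (Function.update f a (u i)) b (v i)))
      exact (abs_sub _ _).trans (by linarith))
  have h5 := avg_not_injective_update_update_le a b hne (k := k)
  refine h1.trans ((mul_le_mul_of_nonneg_left h5 (by linarith)).trans (le_of_eq ?_))
  ring

/-- A single density times `n` need not converge, but in the difference all maps avoiding the centre
cancel, because the first label components agree. What remains is pinned at the centre. -/
lemma tendsto_star_sub {w w' : Option ℕ × Bool → ℝ} (hw0 : ∀ a, 0 ≤ w a) (hw : HasSum w 1)
    (hw0' : ∀ a, 0 ≤ w' a) (hw' : HasSum w' 1)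
    (hV : Tendsto (fun i => Fintype.card (V i)) l atTop) {c c' : ∀ i, V i → Option ℕ × Bool}
    (hc : ∀ a, Tendsto (fun i => cdens (c i) a) l (𝓝 (w a)))
    (hc' : ∀ a, Tendsto (fun i => cdens (c' i) a) l (𝓝 (w' a)))
    (hcc : ∀ i v, (c i v).1 = (c' i v).1) (z : ∀ i, V i) :
    Tendsto (fun i => (Fintype.card (V i) : ℝ) *
      (dens Γ (starGraph (c i) (z i)) - dens Γ (starGraph (c' i) (z i)))) l
      (𝓝 (starMean Γ w - starMean Γ w')) := by
  classical
  have hN := eventually_nonempty_of_card hV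
  have hb := bd_nonneg Γ
  have t1 : Tendsto (fun i => ∑ a : Fin k, ((avg fun f : Fin k → V i => Γ (starGraph (c i ∘ f) a)) -
      avg fun f : Fin k → V i => Γ (starGraph (c' i ∘ f) a))) l
      (𝓝 (starMean Γ w - starMean Γ w')) := by
    rw [starMean, starMean, ← Finset.sum_sub_distrib]
    refine tendsto_finsetSum _ fun a _ => ?_
    exact (tendsto_avg hN hw0 hw hc (fun ℓ => Γ (starGraph ℓ a)) fun ℓ => abs_le_bd Γ _).sub
      (tendsto_avg hN hw0' hw' hc' (fun ℓ => Γ (starGraph ℓ a)) fun ℓ => abs_le_bd Γ _)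
  refine tendsto_of_abs_sub_le t1 (tendsto_const_div_card hV
    (∑ a : Fin k, 2 * (2 * bd Γ * ((k : ℝ) ^ 2 + k)))) ?_
  filter_upwards [hN] with i hi
  have hn : (0 : ℝ) < Fintype.card (V i) := by exact_mod_cast Fintype.card_pos
  set G := starGraph (c i) (z i)
  set G' := starGraph (c' i) (z i)
  have hsplit : ∀ f : Fin k → V i, sample Γ G f - sample Γ G' f =
      ∑ a : Fin k, if f a = z i then sample Γ G f - sample Γ G' f else 0 := by
    intro f
    by_cases hf : Function.Injective f
    · by_cases hex : ∃ a, f a = z i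
      · obtain ⟨a, ha⟩ := hex
        rw [Finset.sum_eq_single a]
        · rw [if_pos ha]
        · intro d _ hd
          exact if_neg fun h => hd (hf (h.trans ha.symm))
        · simp
      · push Not at hex
        rw [Finset.sum_eq_zero fun a _ => if_neg (hex a), sample_congr Γ (G := G) (H := G'),
          sub_self]
        intro a b
        rw [dd_eq_zero]
        simp [G, G', starGraph, hex, hcc]
    · simp [sample, hf]
  have e1 : (Fintype.card (V i) : ℝ) * (dens Γ G - dens Γ G') =
      ∑ a : Fin k, ((avg fun f : Fin k → V i => sample Γ G (Function.update f a (z i))) -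
        avg fun f : Fin k → V i => sample Γ G' (Function.update f a (z i))) := by
    rw [dens, dens, ← avg_sub]
    rw [show (fun f => sample Γ G f - sample Γ G' f) = fun f =>
      ∑ a : Fin k, if f a = z i then sample Γ G f - sample Γ G' f else 0 from funext hsplit]
    rw [avg_sum, Finset.mul_sum]
    refine Finset.sum_congr rfl fun a _ => ?_
    rw [avg_pin a (z i) (fun f => sample Γ G f - sample Γ G' f), ← avg_sub]
    field_simp
  have key : ∀ (d : V i → Option ℕ × Bool) (a : Fin k),
      |(avg fun f : Fin k → V i => sample Γ (starGraph d (z i)) (Function.update f a (z i))) -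
        avg fun f : Fin k → V i => Γ (starGraph (d ∘ f) a)| ≤
        2 * bd Γ * ((k : ℝ) ^ 2 + k) / Fintype.card (V i) := by
    intro d a
    have h1 := abs_avg_sub_le_of_injective (B := 2 * bd Γ)
      (φ := fun f => Function.update f a (z i))
      (g := fun f => sample Γ (starGraph d (z i)) (Function.update f a (z i)))
      (h := fun f => Γ (starGraph (d ∘ f) a))
      (fun f hf => by
        simp only [sample, if_pos hf]
        have h2 := starGraph_comap d hf a
        rw [Function.update_self] at h2
        rw [h2]
        congr 1
        refine starGraph_congr fun v hv => ?_
        simp [Function.update_of_ne hv])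
      (fun f => by
        have h2 := abs_sample_le Γ (starGraph d (z i)) (Function.update f a (z i))
        have h3 := abs_le_bd Γ (starGraph (d ∘ f) a)
        exact (abs_sub _ _).trans (by linarith))
    have h5 := avg_not_injective_update_le a (z i) (k := k)
    refine h1.trans ((mul_le_mul_of_nonneg_left h5 (by linarith)).trans (le_of_eq ?_))
    ring
  rw [e1, ← Finset.sum_sub_distrib, Finset.sum_div]
  refine (Finset.abs_sum_le_sum_abs _ _).trans (Finset.sum_le_sum fun a _ => ?_)
  have k1 := abs_le.1 (key (c i) a)
  have k2 := abs_le.1 (key (c' i) a)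
  have e3 : 2 * (2 * bd Γ * ((k : ℝ) ^ 2 + k)) / Fintype.card (V i) =
    2 * (2 * bd Γ * ((k : ℝ) ^ 2 + k) / Fintype.card (V i)) := by ring
  rw [e3, abs_le]
  constructor <;> linarith [k1.1, k1.2, k2.1, k2.2]

end limits

end

end PartiteStability

namespace PartiteStability

noncomputable section

/-! ### Label densities in realisations -/

lemma hasSum_option {f : Option ℕ → ℝ} {s : ℝ} (h : HasSum (fun i : ℕ => f (some i)) s) :
    HasSum f (s + f none) := by
  have e : HasSum (f ∘ (Equiv.optionEquivSumPUnit.{0} ℕ).symm) (s + f none) := by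
    refine HasSum.sum ?_ ?_
    · simpa [Function.comp_def] using h
    · simp [Function.comp_def]
  exact (Equiv.hasSum_iff _).1 e

lemma hasSum_cdens {V L : Type} [Fintype V] [Nonempty V] (c : V → L) : HasSum (cdens c) 1 := by
  classical
  have h := hasSum_sum_of_ne_finset_zero (f := cdens c) (s := Finset.univ.image c)
    (L := SummationFilter.unconditional L) (by
    intro l hl
    unfold cdens
    rw [Finset.filter_eq_empty_iff.2]
    · simp
    · rintro v - rfl
      exact hl (Finset.mem_image_of_mem _ (Finset.mem_univ _)))
  rwa [sum_cdens_eq_one c _ fun v => Finset.mem_image_of_mem _ (Finset.mem_univ _)] at h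

lemma cdens_le_one {V L : Type} [Fintype V] (c : V → L) (l : L) : cdens c l ≤ 1 := by
  simpa using sum_cdens_le_one c {l}

lemma PartiteLimit.weight_nonneg (x : PartiteLimit) (i : Option ℕ) : 0 ≤ x.weight i := by
  cases i with
  | none => simpa [weight] using x.tsum_part_le
  | some i => exact x.part_nonneg i

lemma PartiteLimit.hasSum_weight (x : PartiteLimit) : HasSum x.weight 1 := by
  have := hasSum_option (f := x.weight) (s := ∑' i, x.part i) x.summable_part.hasSum
  simpa [weight] using this

lemma labelClass_card_eq {n : ℕ} (c : Fin n → Option ℕ) (i : Option ℕ) :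
    ((labelClass c i).card : ℝ) = n * cdens c i := by
  rcases Nat.eq_zero_or_pos n with rfl | hn
  · simp [labelClass]
  have : (n : ℝ) ≠ 0 := by positivity
  unfold cdens labelClass
  rw [Fintype.card_fin, mul_div_cancel₀ _ this]
  congr!

lemma cdens_eq_labelClass {n : ℕ} (c : Fin n → Option ℕ) (i : Option ℕ) :
    cdens c i = ((labelClass c i).card : ℝ) / n := by
  unfold cdens labelClass
  rw [Fintype.card_fin]
  congr!

lemma cdens_none_eq {n : ℕ} (hn : 0 < n) (c : Fin n → Option ℕ) :
    cdens c none = 1 - ∑' i : ℕ, cdens c (some i) := by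
  have : Nonempty (Fin n) := ⟨⟨0, hn⟩⟩
  have h := hasSum_cdens c
  have hs : Summable fun i : ℕ => cdens c (some i) :=
    h.summable.comp_injective (Option.some_injective ℕ)
  have := (hasSum_option hs.hasSum).unique h
  linarith

/-- The densities of the labels of realisations converge to the weights. -/
lemma tendsto_cdens_of_isRealisation {ι : Type*} {l : Filter ι} {n : ι → ℕ}
    (hn : Tendsto n l atTop) (x : PartiteLimit) {c : ∀ j, Fin (n j) → Option ℕ}
    (hc : ∀ j, IsRealisation x (c j)) (i : Option ℕ) :
    Tendsto (fun j => cdens (c j) i) l (𝓝 (x.weight i)) := by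
  have hn1 : ∀ C : ℝ, Tendsto (fun j => C / (n j : ℝ)) l (𝓝 0) := fun C =>
    (tendsto_natCast_atTop_atTop.comp hn).const_div_atTop C
  have hpos : ∀ᶠ j in l, 0 < n j := by
    filter_upwards [hn.eventually_ge_atTop 1] with j hj using hj
  by_cases hx : x.weight none = 0
  · cases i with
    | none =>
      rw [hx]
      refine tendsto_const_nhds.congr fun j => ?_
      rw [cdens_eq_labelClass, ((hc j).1 hx).1]
      simp
    | some i =>
      refine tendsto_of_abs_sub_le tendsto_const_nhds (hn1 1) ?_
      filter_upwards [hpos] with j hj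
      have hj' : (0 : ℝ) < n j := by exact_mod_cast hj
      have h := ((hc j).1 hx).2 i
      rw [cdens_eq_labelClass, le_div_iff₀ hj', ← abs_of_pos hj', ← abs_mul, abs_of_pos hj',
        sub_mul, div_mul_cancel₀ _ hj'.ne']
      exact h.le
  · have hcard := fun j => (hc j).2 hx
    have hle : ∀ j i, cdens (c j) (some i) ≤ x.part i := by
      intro j i
      have h0 := x.part_nonneg i
      rw [cdens_eq_labelClass, hcard]
      refine div_le_of_le_mul₀ (by positivity) h0 ?_
      split_ifs
      · exact Nat.floor_le (by positivity)
      · simpa using (by positivity : 0 ≤ x.part i * (n j : ℝ))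
    have hsome : ∀ i, Tendsto (fun j => cdens (c j) (some i)) l (𝓝 (x.weight (some i))) := by
      intro i
      -- Rounding down loses less than one vertex, and omitting a part loses fewer than two.
      refine tendsto_of_abs_sub_le tendsto_const_nhds (hn1 2) ?_
      filter_upwards [hpos] with j hj
      have hj' : (0 : ℝ) < n j := by exact_mod_cast hj
      have h0 := x.part_nonneg i
      rw [le_div_iff₀ hj']
      nth_rewrite 1 [← abs_of_pos hj']
      rw [← abs_mul, sub_mul, cdens_eq_labelClass, div_mul_cancel₀ _ hj'.ne', hcard]
      have h1 : (0 : ℝ) ≤ x.part i * n j := by positivity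
      simp only [PartiteLimit.weight]
      split_ifs with h2
      · have h3 := Nat.floor_le h1
        have h4 := Nat.lt_floor_add_one (x.part i * (n j : ℝ))
        rw [abs_le]
        constructor <;> linarith
      · push Not at h2
        rw [Nat.cast_zero, abs_le]
        constructor <;> linarith
    cases i with
    | some i => exact hsome i
    | none =>
      -- The density of universal vertices is the complement of infinitely many part densities.
      -- These never exceed the entries of `x`, so dominated convergence applies.
      have ht : Tendsto (fun j => ∑' i : ℕ, cdens (c j) (some i)) l (𝓝 (∑' i, x.part i)) := by
        refine tendsto_tsum_of_dominated_convergence (bound := x.part) x.summable_part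
          hsome (Eventually.of_forall fun j i => ?_)
        rw [Real.norm_eq_abs, abs_of_nonneg (cdens_nonneg _ _)]
        exact hle j i
      refine (ht.const_sub 1).congr' ?_
      filter_upwards [hpos] with j hj
      rw [cdens_none_eq hj]

lemma tendsto_pow_div_choose (m : ℕ) :
    Tendsto (fun n : ℕ => (n : ℝ) ^ m / (m.factorial * n.choose m)) atTop (𝓝 1) := by
  have h := isEquivalent_choose m
  have hm : (m.factorial : ℝ) ≠ 0 := by exact_mod_cast m.factorial_ne_zero
  have h0 : ∀ᶠ n : ℕ in atTop, (n.choose m : ℝ) ≠ 0 := by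
    filter_upwards [eventually_ge_atTop m] with n hn
    exact_mod_cast (Nat.choose_pos hn).ne'
  have h1 := (Asymptotics.isEquivalent_iff_tendsto_one h0).1 h.symm
  refine h1.congr fun n => ?_
  simp only [Pi.div_apply]
  rw [div_div]

/-! ### Limits of `lam` and of flip losses along realisations. -/

section limits

variable {k : ℕ} {Γ : SimpleGraph (Fin k) → ℝ}

/-- The two normalisations differ by a factor tending to one, and densities are bounded uniformly in
the graph; no convergence of the graphs is needed. -/
lemma tendsto_lam_sub_dens (hΓ : IsoInvariant Γ) {ι : Type*} {l : Filter ι} {n : ι → ℕ}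
    (hn : Tendsto n l atTop) (G : ∀ j, SimpleGraph (Fin (n j))) :
    Tendsto (fun j => lam Γ (G j) - dens Γ (G j)) l (𝓝 0) := by
  have h1 : Tendsto (fun j => bd Γ * |(n j : ℝ) ^ k / (k.factorial * (n j).choose k) - 1|) l
      (𝓝 0) := by
    have := ((((tendsto_pow_div_choose k).comp hn).sub_const 1).abs).const_mul (bd Γ)
    simpa using this
  refine squeeze_zero_norm' ?_ h1
  filter_upwards [hn.eventually_ge_atTop 1] with j hj
  have : Nonempty (Fin (n j)) := ⟨⟨0, hj⟩⟩
  have hk : (k.factorial : ℝ) ≠ 0 := by exact_mod_cast k.factorial_ne_zero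
  have e : lam Γ (G j) - dens Γ (G j) =
      dens Γ (G j) * ((n j : ℝ) ^ k / (k.factorial * (n j).choose k) - 1) := by
    rw [lam, lamSum_eq_dens hΓ, Fintype.card_fin, ← div_div]
    ring
  rw [e, Real.norm_eq_abs, abs_mul]
  refine mul_le_mul_of_nonneg_right ?_ (abs_nonneg _)
  refine (abs_avg_le _).trans ((avg_mono fun f => abs_sample_le Γ _ f).trans ?_)
  rw [avg_const]

lemma tendsto_card_fin {ι : Type*} {l : Filter ι} {n : ι → ℕ} (hn : Tendsto n l atTop) :
    Tendsto (fun j => Fintype.card (Fin (n j))) l atTop := by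
  simpa using hn

lemma tendsto_lam_realisation (hΓ : IsoInvariant Γ) (x : PartiteLimit) :
    Tendsto (fun n : ℕ => lam Γ (realisation x n)) atTop (𝓝 (graphMean Γ x.weight)) := by
  have h1 := tendsto_dens_labelGraph Γ x.weight_nonneg x.hasSum_weight
    (tendsto_card_fin tendsto_id) (tendsto_cdens_of_isRealisation tendsto_id x fun n =>
      realisationLabel_spec x n)
  have h2 := (tendsto_lam_sub_dens hΓ tendsto_id (fun n => realisation x n)).add h1
  simpa [realisation] using h2

lemma lamLimit_eq (hΓ : IsoInvariant Γ) (x : PartiteLimit) :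
    lamLimit Γ x = graphMean Γ x.weight :=
  (tendsto_lam_realisation hΓ x).limUnder_eq

/-- A label of positive weight is eventually carried by at least two vertices. Hence the default
value in `flipLossLimit` is irrelevant, also when both labels are equal. -/
lemma exists_pair_of_mem_suppStar (x : PartiteLimit) {i j : Option ℕ} (hi : i ∈ x.suppStar)
    (hj : j ∈ x.suppStar) : ∀ᶠ n : ℕ in atTop, ∃ p : Fin n × Fin n,
      p.1 ≠ p.2 ∧ realisationLabel x n p.1 = i ∧ realisationLabel x n p.2 = j := by
  have h : ∀ i ∈ x.suppStar, ∀ᶠ n : ℕ in atTop, 1 < (labelClass (realisationLabel x n) i).card := by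
    intro i hi
    have hi : 0 < x.weight i := hi
    have h1 := tendsto_cdens_of_isRealisation tendsto_id x (realisationLabel_spec x) i
    filter_upwards [h1.eventually (lt_mem_nhds (half_lt_self hi)),
      (tendsto_natCast_atTop_atTop (R := ℝ)).eventually_gt_atTop (2 / x.weight i)] with n h2 h3
    have h4 := labelClass_card_eq (realisationLabel x n) i
    have h5 : (1 : ℝ) < (labelClass (realisationLabel x n) i).card := by
      rw [h4]
      rw [div_lt_iff₀ hi] at h3
      simp only [id_eq] at h2
      nlinarith
    exact_mod_cast h5
  filter_upwards [h i hi, h j hj] with n h1 h2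
  obtain ⟨u, hu⟩ := Finset.card_pos.1 (lt_trans zero_lt_one h1)
  obtain ⟨v, hv, hvu⟩ := Finset.exists_mem_ne h2 u
  simp only [labelClass, Finset.mem_filter, Finset.mem_univ, true_and] at hu hv
  exact ⟨(u, v), hvu.symm, hu, hv⟩

/-- Besides exchanging normalisations, this shows that the limit exists and does not depend on the
chosen pair. -/
lemma flipLossLimit_eq (hΓ : IsoInvariant Γ) (hk : 2 ≤ k) (x : PartiteLimit) {i j : Option ℕ}
    (hi : i ∈ x.suppStar) (hj : j ∈ x.suppStar) :
    flipLossLimit Γ x i j = (k - 2).factorial / k.factorial * flipMean Γ x.weight i j := by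
  classical
  refine Tendsto.limUnder_eq ?_
  have hex := exists_pair_of_mem_suppStar x hi hj
  -- Orders are shifted by one so that a default pair of vertices exists.
  set p : ∀ n : ℕ, Fin (n + 1) × Fin (n + 1) := fun n =>
    if h : ∃ p : Fin (n + 1) × Fin (n + 1),
        p.1 ≠ p.2 ∧ realisationLabel x (n + 1) p.1 = i ∧ realisationLabel x (n + 1) p.2 = j then
      h.choose else (0, 0) with hp
  rw [← tendsto_add_atTop_iff_nat 1]
  have hex' := (tendsto_add_atTop_nat 1).eventually hex
  have hp' : ∀ᶠ n : ℕ in atTop, (p n).1 ≠ (p n).2 ∧ realisationLabel x (n + 1) (p n).1 = i ∧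
      realisationLabel x (n + 1) (p n).2 = j := by
    filter_upwards [hex'] with n hn
    rw [hp]
    simp only [dif_pos hn]
    exact hn.choose_spec
  have t1 := tendsto_flip Γ x.weight_nonneg x.hasSum_weight
    (tendsto_card_fin (tendsto_add_atTop_nat 1)) (tendsto_cdens_of_isRealisation
      (tendsto_add_atTop_nat 1) x fun n => realisationLabel_spec x (n + 1)) hp'
  have t2 : Tendsto (fun n : ℕ => (((n + 1 : ℕ) : ℝ) ^ (k - 2) /
      (k.factorial * ((n + 1) - 2).choose (k - 2)))) atTop
      (𝓝 ((k - 2).factorial / k.factorial)) := by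
    rw [← tendsto_add_atTop_iff_nat 1]
    have hf : (k.factorial : ℝ) ≠ 0 := by exact_mod_cast k.factorial_ne_zero
    have hf' : ((k - 2).factorial : ℝ) ≠ 0 := by exact_mod_cast (k - 2).factorial_ne_zero
    have t3 := tendsto_pow_div_choose (k - 2)
    have t4 : Tendsto (fun n : ℕ => (1 + 2 / (n : ℝ)) ^ (k - 2)) atTop (𝓝 1) := by
      have := ((tendsto_const_div_atTop_nhds_zero_nat (2 : ℝ)).const_add 1).pow (k - 2)
      simpa using this
    have t5 := (t3.mul t4).mul_const (((k - 2).factorial : ℝ) / k.factorial)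
    rw [one_mul, one_mul] at t5
    refine t5.congr' ?_
    filter_upwards [eventually_gt_atTop 0] with n hn
    have hn' : (n : ℝ) ≠ 0 := by exact_mod_cast hn.ne'
    have e1 : 1 + 2 / (n : ℝ) = (n + 2) / n := by field_simp
    rw [e1, div_pow, show n + 1 + 1 - 2 = n by omega]
    have hn2 : (n : ℝ) ^ (k - 2) ≠ 0 := pow_ne_zero _ hn'
    push_cast
    field_simp
    ring
  refine (t2.mul t1).congr' ?_
  filter_upwards [hex'] with n hn
  have e2 : p n = hn.choose := by
    rw [hp]
    simp only [dif_pos hn]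
  rw [dif_pos hn, flipLoss, lamSum_eq_dens hΓ, lamSum_eq_dens hΓ, e2, Fintype.card_fin]
  have e3 : ((n + 1 : ℕ) : ℝ) ^ k = ((n + 1 : ℕ) : ℝ) ^ (k - 2) * ((n + 1 : ℕ) : ℝ) ^ 2 := by
    rw [← pow_add, Nat.sub_add_cancel hk]
  rw [e3, realisation, div_mul_eq_mul_div, div_mul_eq_mul_div, div_mul_eq_mul_div,
    ← div_div]
  ring

/-- The conversion factor lies in `(0, 1]`, so a nonnegative lower bound survives its removal with
the same constant. -/
lemma le_flipMean (hΓ : IsoInvariant Γ) (hk : 2 ≤ k) (x : PartiteLimit) {i j : Option ℕ}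
    (hi : i ∈ x.suppStar) (hj : j ∈ x.suppStar) {c : ℝ} (hc : 0 ≤ c)
    (h : c ≤ flipLossLimit Γ x i j) : c ≤ flipMean Γ x.weight i j := by
  rw [flipLossLimit_eq hΓ hk x hi hj] at h
  have hf : (0 : ℝ) < k.factorial := by exact_mod_cast k.factorial_pos
  have hf' : (0 : ℝ) < (k - 2).factorial := by exact_mod_cast (k - 2).factorial_pos
  have h1 : ((k - 2).factorial : ℝ) ≤ k.factorial := by
    exact_mod_cast Nat.factorial_le (Nat.sub_le k 2)
  have h2 : (((k - 2).factorial : ℝ) / k.factorial) ≤ 1 := by rwa [div_le_one hf]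
  have h3 : 0 < (((k - 2).factorial : ℝ) / k.factorial) := by positivity
  by_contra hlt
  push Not at hlt
  have hnn : 0 ≤ flipMean Γ x.weight i j := by
    by_contra hneg
    push Not at hneg
    have := mul_neg_of_pos_of_neg h3 hneg
    linarith
  have := mul_le_of_le_one_left hnn h2
  linarith

lemma hasSum_prod_bool {w : Option ℕ × Bool → ℝ} (hw0 : ∀ a, 0 ≤ w a) {p : Option ℕ → ℝ}
    (hp : HasSum p 1) (h : ∀ i, w (i, true) + w (i, false) = p i) : HasSum w 1 := by
  have e : ∀ i, ∑' β, w (i, β) = p i := by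
    intro i
    rw [tsum_bool, ← h i, add_comm]
  have hs : Summable w := by
    rw [summable_prod_of_nonneg hw0]
    refine ⟨fun i => Summable.of_finite, ?_⟩
    simp only [e]
    exact hp.summable
  have h1 : HasSum p (∑' a, w a) := by
    refine hs.hasSum.prod_fiberwise fun i => ?_
    rw [← e i]
    exact (Summable.of_finite : Summable fun β => w (i, β)).hasSum
  rw [← h1.unique hp]
  exact hs.hasSum

/-- The limit densities of the labels for the attachment described by `b` and `α`. -/
def attachWeight (x : PartiteLimit) (b : ℕ → Bool) (α : ℝ) : Option ℕ × Bool → ℝ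
  | (some i, β) => if b i = β then x.part i else 0
  | (none, true) => α * x.weight none
  | (none, false) => (1 - α) * x.weight none

lemma attachWeight_nonneg (x : PartiteLimit) (b : ℕ → Bool) (α : unitInterval)
    (a : Option ℕ × Bool) : 0 ≤ attachWeight x b α a := by
  rcases a with ⟨_ | i, β⟩
  · cases β
    · exact mul_nonneg (by linarith [α.2.2]) (x.weight_nonneg none)
    · exact mul_nonneg α.2.1 (x.weight_nonneg none)
  · simp only [attachWeight]
    split_ifs
    · exact x.part_nonneg i
    · exact le_rfl

lemma hasSum_attachWeight (x : PartiteLimit) (b : ℕ → Bool) (α : unitInterval) :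
    HasSum (attachWeight x b α) 1 := by
  refine hasSum_prod_bool (attachWeight_nonneg x b α) x.hasSum_weight fun i => ?_
  cases i with
  | none =>
    simp only [attachWeight]
    ring
  | some i =>
    simp only [attachWeight, PartiteLimit.weight]
    cases b i <;> simp

open Classical in
/-- The labels of the vertices of `attach c b α`. -/
def attachLabel {n : ℕ} (c : Fin n → Option ℕ) (b : ℕ → Bool) (α : unitInterval) :
    Option (Fin n) → Option ℕ × Bool
  -- The label of the new vertex is arbitrary: the star ignores it, and one vertex does not affect
  -- limiting densities.
  | none => (none, false)
  | some v => (c v, decide (v ∈ ({v | ∃ i : ℕ, c v = some i ∧ b i = true} ∪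
      ((Classical.choose (exists_subset_labelClass c α) : Finset (Fin n)) : Set (Fin n)))))

lemma attach_eq_starGraph {n : ℕ} (c : Fin n → Option ℕ) (b : ℕ → Bool) (α : unitInterval) :
    attach c b α = starGraph (attachLabel c b α) none := by
  ext u v
  rcases u with _ | u <;> rcases v with _ | v <;>
    simp [attach, addVertex, starGraph, attachLabel, labelGraph]

lemma cdens_option {n : ℕ} {L : Type} (c : Option (Fin n) → L) (l : L) :
    |cdens c l - cdens (fun v => c (some v)) l * (n / (n + 1))| ≤ 1 / (n + 1 : ℝ) := by
  classical
  have h1 : (Finset.univ.filter fun v => c v = l).card =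
      (Finset.univ.filter fun v : Fin n => c (some v) = l).card + if c none = l then 1 else 0 := by
    have := Fintype.sum_option (fun v : Option (Fin n) => if c v = l then (1 : ℕ) else 0)
    simp only [Finset.sum_boole] at this
    rw [add_comm]
    exact_mod_cast this
  unfold cdens
  have h2 : ((Finset.univ.filter fun v => c v = l).card : ℝ) =
      ((Finset.univ.filter fun v : Fin n => c (some v) = l).card : ℝ) +
        if c none = l then 1 else 0 := by
    exact_mod_cast h1
  have e : ((Finset.univ.filter fun v => c v = l).card : ℝ) / Fintype.card (Option (Fin n)) -
      ((Finset.univ.filter fun v : Fin n => c (some v) = l).card : ℝ) /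
        Fintype.card (Fin n) * (n / (n + 1)) = (if c none = l then 1 else 0) / (n + 1 : ℝ) := by
    rw [h2]
    simp only [Fintype.card_option, Fintype.card_fin]
    push_cast
    rcases Nat.eq_zero_or_pos n with rfl | hn
    · simp
    have hn' : (0 : ℝ) < n := by exact_mod_cast hn
    field_simp
    ring
  have e' := congrArg abs e
  refine le_trans (le_of_eq ?_) (le_trans (le_of_eq e') ?_)
  · congr!
  · split_ifs
    · rw [abs_of_nonneg (by positivity)]
    · simp
      positivity

end limits

end

end PartiteStability

namespace PartiteStability

noncomputable section

/-! ### Elementary properties of label densities. -/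

section cdens

variable {V L L' : Type} [Fintype V]

lemma cdens_eq (c : V → L) (l : L) [DecidablePred fun v => c v = l] :
    cdens c l = ((Finset.univ.filter fun v => c v = l).card : ℝ) / Fintype.card V := by
  unfold cdens
  congr!

lemma cdens_congr {c : V → L} {c' : V → L'} {l : L} {l' : L'} (h : ∀ v, c v = l ↔ c' v = l') :
    cdens c l = cdens c' l' := by
  classical
  rw [cdens_eq, cdens_eq]
  simp only [h]

lemma cdens_eq_zero {c : V → L} {l : L} (h : ∀ v, c v ≠ l) : cdens c l = 0 := by
  classical
  rw [cdens_eq, Finset.filter_eq_empty_iff.2 fun v _ => h v]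
  simp

lemma cdens_true_add_false (c : V → L × Bool) (l : L) :
    cdens c (l, true) + cdens c (l, false) = cdens (fun v => (c v).1) l := by
  classical
  rw [cdens_eq, cdens_eq, cdens_eq, ← add_div, ← Nat.cast_add, ← Finset.card_union_of_disjoint]
  · congr 3
    ext v
    simp only [Finset.mem_union, Finset.mem_filter, Finset.mem_univ, true_and, Prod.ext_iff]
    cases (c v).2 <;> simp
  · rw [Finset.disjoint_filter]
    rintro v - h
    simp [h]

end cdens

/-! ### Limits of attachment losses along realisations. -/

section limits

variable {k : ℕ} {Γ : SimpleGraph (Fin k) → ℝ}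

/-- Each independent part goes entirely to one Boolean value, while the universal vertices are split
in proportion `α` up to rounding. The added vertex changes a density by `O(1/n)`. -/
lemma tendsto_cdens_attachLabel (x : PartiteLimit) (b : ℕ → Bool) (α : unitInterval)
    (a : Option ℕ × Bool) :
    Tendsto (fun n : ℕ => cdens (attachLabel (realisationLabel x n) b α) a) atTop
      (𝓝 (attachWeight x b α a)) := by
  classical
  have hreal := tendsto_cdens_of_isRealisation tendsto_id x (realisationLabel_spec x)
  simp only [id_eq] at hreal
  have h0 : Tendsto (fun n : ℕ => cdens (fun v => attachLabel (realisationLabel x n) b α (some v)) a)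
      atTop (𝓝 (attachWeight x b α a)) := by
    rcases a with ⟨_ | i, β⟩
    · have hA : ∀ n, ∃ A : Finset (Fin n), A ⊆ labelClass (realisationLabel x n) none ∧
          A.card = ⌊(α : ℝ) * ((labelClass (realisationLabel x n) none).card : ℝ)⌋₊ ∧
          ∀ v, realisationLabel x n v = none →
            (attachLabel (realisationLabel x n) b α (some v) = (none, true) ↔ v ∈ A) := by
        intro n
        have hs := Classical.choose_spec (exists_subset_labelClass (realisationLabel x n) α)
        refine ⟨_, hs.1, hs.2, fun v hv => ?_⟩
        simp [attachLabel, hv]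
      have ht : Tendsto (fun n : ℕ =>
          cdens (fun v => attachLabel (realisationLabel x n) b α (some v)) (none, true))
          atTop (𝓝 (α * x.weight none)) := by
        refine tendsto_of_abs_sub_le ((hreal none).const_mul (α : ℝ))
          (tendsto_const_div_atTop_nhds_zero_nat 1) ?_
        filter_upwards [eventually_gt_atTop 0] with n hn
        have hn' : (0 : ℝ) < n := by exact_mod_cast hn
        obtain ⟨A, hA1, hA2, hA3⟩ := hA n
        have e : (Finset.univ.filter fun v : Fin n =>
            attachLabel (realisationLabel x n) b α (some v) = (none, true)) = A := by
          ext v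
          simp only [Finset.mem_filter, Finset.mem_univ, true_and]
          constructor
          · intro h
            have hv : realisationLabel x n v = none := by
              simpa [attachLabel] using congrArg Prod.fst h
            exact (hA3 v hv).1 h
          · intro h
            have hv := hA1 h
            simp only [labelClass, Finset.mem_filter, Finset.mem_univ, true_and] at hv
            exact (hA3 v hv).2 h
        have e1 : cdens (fun v => attachLabel (realisationLabel x n) b α (some v)) (none, true) =
            A.card / n := by
          rw [cdens_eq, Fintype.card_fin, ← e]
        rw [e1, hA2, cdens_eq_labelClass, mul_div_assoc', ← sub_div, abs_div, abs_of_pos hn']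
        refine div_le_div_of_nonneg_right ?_ hn'.le
        have h3 := Nat.floor_le (show
          0 ≤ (α : ℝ) * ((labelClass (realisationLabel x n) none).card : ℝ) from
            mul_nonneg α.2.1 (Nat.cast_nonneg _))
        have h4 := Nat.lt_floor_add_one
          ((α : ℝ) * ((labelClass (realisationLabel x n) none).card : ℝ))
        rw [abs_le]
        constructor <;> linarith
      cases β
      · have e : ∀ n : ℕ,
            cdens (fun v => attachLabel (realisationLabel x n) b α (some v)) (none, false) =
            cdens (realisationLabel x n) none -
            cdens (fun v => attachLabel (realisationLabel x n) b α (some v)) (none, true) := by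
          intro n
          have := cdens_true_add_false
            (fun v => attachLabel (realisationLabel x n) b α (some v)) none
          simp only [attachLabel] at this ⊢
          linarith
        simp only [e]
        have := (hreal none).sub ht
        refine this.congr_dist ?_ |>.trans (le_of_eq ?_)
        · simp
        · simp only [attachWeight]
          congr 1
          ring
      · exact ht
    · by_cases hb : b i = β
      · have e : ∀ n : ℕ,
            cdens (fun v => attachLabel (realisationLabel x n) b α (some v)) (some i, β) =
            cdens (realisationLabel x n) (some i) := by
          intro n
          refine cdens_congr fun v => ?_
          simp only [attachLabel, Prod.mk.injEq]
          refine ⟨fun h => h.1, fun h => ⟨h, ?_⟩⟩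
          have hs := (Classical.choose_spec
            (exists_subset_labelClass (realisationLabel x n) α)).1
          have hv : v ∉ Classical.choose (exists_subset_labelClass (realisationLabel x n) α) := by
            intro hv
            have := hs hv
            simp [labelClass, h] at this
          rw [← hb]
          cases hbi : b i <;> simp [h, hbi, hv]
        simp only [e, attachWeight, if_pos hb]
        exact hreal (some i)
      · have e : ∀ n : ℕ,
            cdens (fun v => attachLabel (realisationLabel x n) b α (some v)) (some i, β) = 0 := by
          intro n
          refine cdens_eq_zero fun v h => ?_
          simp only [attachLabel, Prod.mk.injEq] at h
          obtain ⟨h, h'⟩ := h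
          have hs := (Classical.choose_spec
            (exists_subset_labelClass (realisationLabel x n) α)).1
          have hv : v ∉ Classical.choose (exists_subset_labelClass (realisationLabel x n) α) := by
            intro hv
            have := hs hv
            simp [labelClass, h] at this
          refine hb ?_
          rw [← h']
          cases hbi : b i <;> simp [h, hbi, hv]
        simp only [e, attachWeight, if_neg hb]
        exact tendsto_const_nhds
  have h1 : Tendsto (fun n : ℕ => (n : ℝ) / (n + 1)) atTop (𝓝 1) :=
    tendsto_natCast_div_add_atTop (1 : ℝ)
  have h2 := h0.mul h1
  rw [mul_one] at h2
  exact tendsto_of_abs_sub_le h2 tendsto_one_div_add_atTop_nhds_zero_nat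
    (Eventually.of_forall fun n => cdens_option _ a)

lemma attachLossLimit_eq (hΓ : IsoInvariant Γ) (hk : 0 < k) (x : PartiteLimit) (b : ℕ → Bool)
    (α : unitInterval) :
    attachLossLimit Γ x b α = (k - 1).factorial / k.factorial *
      (starMean Γ (attachWeight x eOne 1) - starMean Γ (attachWeight x b α)) := by
  refine Tendsto.limUnder_eq ?_
  have hcard : Tendsto (fun n : ℕ => Fintype.card (Option (Fin n))) atTop atTop := by
    simpa using tendsto_add_atTop_nat 1
  have t1 := tendsto_star_sub Γ (attachWeight_nonneg x eOne 1) (hasSum_attachWeight x eOne 1)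
    (attachWeight_nonneg x b α) (hasSum_attachWeight x b α) hcard
    (tendsto_cdens_attachLabel x eOne 1) (tendsto_cdens_attachLabel x b α)
    (fun n v => by cases v <;> simp [attachLabel]) (fun _ => none)
  have t2 : Tendsto (fun n : ℕ => (((n + 1 : ℕ) : ℝ) ^ (k - 1) /
      (k.factorial * n.choose (k - 1)))) atTop (𝓝 ((k - 1).factorial / k.factorial)) := by
    have hf : (k.factorial : ℝ) ≠ 0 := by exact_mod_cast k.factorial_ne_zero
    have hf' : ((k - 1).factorial : ℝ) ≠ 0 := by exact_mod_cast (k - 1).factorial_ne_zero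
    have t3 := tendsto_pow_div_choose (k - 1)
    have t4 : Tendsto (fun n : ℕ => (1 + 1 / (n : ℝ)) ^ (k - 1)) atTop (𝓝 1) := by
      have := ((tendsto_const_div_atTop_nhds_zero_nat (1 : ℝ)).const_add 1).pow (k - 1)
      simpa using this
    have t5 := (t3.mul t4).mul_const (((k - 1).factorial : ℝ) / k.factorial)
    rw [one_mul, one_mul] at t5
    refine t5.congr' ?_
    filter_upwards [eventually_gt_atTop 0] with n hn
    have hn' : (n : ℝ) ≠ 0 := by exact_mod_cast hn.ne'
    have e1 : 1 + 1 / (n : ℝ) = (n + 1) / n := by field_simp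
    rw [e1, div_pow]
    have hn2 : (n : ℝ) ^ (k - 1) ≠ 0 := pow_ne_zero _ hn'
    push_cast
    field_simp
  refine (t2.mul t1).congr fun n => ?_
  rw [attachLoss, lamSum_eq_dens hΓ, lamSum_eq_dens hΓ, attach_eq_starGraph, attach_eq_starGraph,
    Fintype.card_option, Fintype.card_fin]
  have e3 : ((n + 1 : ℕ) : ℝ) ^ k = ((n + 1 : ℕ) : ℝ) ^ (k - 1) * ((n + 1 : ℕ) : ℝ) := by
    rw [← pow_succ, Nat.sub_add_cancel hk]
  rw [e3, ← div_div]
  ring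

/-- As for flips, the conversion factor is at most one and can be dropped from a nonnegative bound.
-/
lemma le_starMean_sub (hΓ : IsoInvariant Γ) (hk : 0 < k) (x : PartiteLimit) (b : ℕ → Bool)
    (α : unitInterval) {c : ℝ} (hc : 0 ≤ c) (h : c ≤ attachLossLimit Γ x b α) :
    c ≤ starMean Γ (attachWeight x eOne 1) - starMean Γ (attachWeight x b α) := by
  rw [attachLossLimit_eq hΓ hk] at h
  have hf : (0 : ℝ) < k.factorial := by exact_mod_cast k.factorial_pos
  have hf' : (0 : ℝ) < (k - 1).factorial := by exact_mod_cast (k - 1).factorial_pos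
  have h1 : ((k - 1).factorial : ℝ) ≤ k.factorial := by
    exact_mod_cast Nat.factorial_le (Nat.sub_le k 1)
  have h2 : (((k - 1).factorial : ℝ) / k.factorial) ≤ 1 := by rwa [div_le_one hf]
  have h3 : 0 < (((k - 1).factorial : ℝ) / k.factorial) := by positivity
  set y := starMean Γ (attachWeight x eOne 1) - starMean Γ (attachWeight x b α)
  have hnn : 0 ≤ y := by
    by_contra hneg
    push Not at hneg
    have := mul_neg_of_pos_of_neg h3 hneg
    linarith
  exact h.trans (mul_le_of_le_one_left hnn h2)

end limits

end

end PartiteStability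

namespace PartiteStability

noncomputable section

/-! ### Matching labels and truncation -/

section matching

variable {V L : Type} [Fintype V]

open Classical in
/-- Up to a permutation, two labelings agree except for the surplus of each label. -/
lemma exists_perm_card_ne_le (c c' : V → L) (A : Finset L) (hA : ∀ v, c v ∈ A) :
    ∃ σ : Equiv.Perm V, ((Finset.univ.filter fun v => c v ≠ c' (σ v)).card : ℝ) ≤
      Fintype.card V * ∑ l ∈ A, |cdens c l - cdens c' l| := by
  -- Take a permutation with the most agreements. If some label were in surplus at one vertex and
  -- missing at another, a transposition would create a further agreement.
  obtain ⟨σ, -, hσ⟩ := Finset.exists_max_image (Finset.univ : Finset (Equiv.Perm V))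
    (fun σ => (Finset.univ.filter fun v => c v = c' (σ v)).card) ⟨1, Finset.mem_univ _⟩
  refine ⟨σ, ?_⟩
  have hno : ∀ l v v', c v = l → c' (σ v) ≠ l → c' (σ v') = l → c v' ≠ l → False := by
    intro l v v' h1 h2 h3 h4
    have hvv : v ≠ v' := by
      rintro rfl
      exact h4 h1
    have h := hσ (Equiv.swap v v' |>.trans σ) (Finset.mem_univ _)
    refine absurd h (not_le.2 (Finset.card_lt_card ?_))
    rw [Finset.ssubset_iff_of_subset]
    · refine ⟨v, Finset.mem_filter.2 ⟨Finset.mem_univ _, ?_⟩, ?_⟩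
      · simp [h1, h3]
      · simp only [Finset.mem_filter, Finset.mem_univ, true_and]
        exact fun h => h2 (h ▸ h1)
    · intro u hu
      replace hu := (Finset.mem_filter.1 hu).2
      refine Finset.mem_filter.2 ⟨Finset.mem_univ _, ?_⟩
      have hu1 : u ≠ v := by
        rintro rfl
        exact h2 (hu ▸ h1)
      have hu2 : u ≠ v' := by
        rintro rfl
        exact h4 (hu.trans h3)
      rw [Equiv.trans_apply, Equiv.swap_apply_of_ne_of_ne hu1 hu2]
      exact hu
  rcases isEmpty_or_nonempty V with hE | hN
  · simp
  have hn : (0 : ℝ) < Fintype.card V := by exact_mod_cast Fintype.card_pos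
  rw [Finset.card_eq_sum_card_fiberwise (f := c) (t := A) (fun v _ => hA v), Finset.mul_sum]
  push_cast
  refine Finset.sum_le_sum fun l _ => ?_
  have e1 : (Fintype.card V : ℝ) * |cdens c l - cdens c' l| =
      |((Finset.univ.filter fun v => c v = l).card : ℝ) -
        ((Finset.univ.filter fun v => c' (σ v) = l).card : ℝ)| := by
    have : (Finset.univ.filter fun v => c' (σ v) = l).card =
        (Finset.univ.filter fun v => c' v = l).card := by
      refine Finset.card_bij (fun v _ => σ v) ?_ ?_ ?_
      · intro v hv
        simpa using hv
      · intro v _ v' _ h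
        exact σ.injective h
      · intro v hv
        exact ⟨σ.symm v, by simpa using hv, by simp⟩
    rw [this, cdens_eq, cdens_eq, ← sub_div, abs_div, abs_of_pos hn, mul_div_cancel₀ _ hn.ne']
  rw [e1]
  have s1 := Finset.card_filter_add_card_filter_not (s := Finset.univ.filter fun v => c v = l)
    (fun v => c' (σ v) = l)
  have s2 := Finset.card_filter_add_card_filter_not
    (s := Finset.univ.filter fun v => c' (σ v) = l) (fun v => c v = l)
  rw [Finset.filter_filter, Finset.filter_filter] at s1 s2
  have e2 : ((Finset.univ.filter fun v => c v ≠ c' (σ v)).filter fun v => c v = l) =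
      Finset.univ.filter fun v => c v = l ∧ ¬ c' (σ v) = l := by
    ext v
    simp only [Finset.mem_filter, Finset.mem_univ, true_and]
    constructor
    · rintro ⟨h, rfl⟩
      exact ⟨rfl, fun h' => h h'.symm⟩
    · rintro ⟨rfl, h⟩
      exact ⟨fun h' => h h'.symm, rfl⟩
  have e3 : (Finset.univ.filter fun v => c' (σ v) = l ∧ c v = l) =
      Finset.univ.filter fun v => c v = l ∧ c' (σ v) = l := by
    ext v
    simp [and_comm]
  rw [e2]
  rw [e3] at s2
  by_cases hz : (Finset.univ.filter fun v => c v = l ∧ ¬ c' (σ v) = l).card = 0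
  · rw [hz]
    simp
  · obtain ⟨v, hv⟩ := Finset.card_pos.1 (Nat.pos_of_ne_zero hz)
    simp only [Finset.mem_filter, Finset.mem_univ, true_and] at hv
    have hz' : (Finset.univ.filter fun v => c' (σ v) = l ∧ ¬ c v = l).card = 0 := by
      rw [Finset.card_eq_zero, Finset.filter_eq_empty_iff]
      rintro v' - ⟨h3, h4⟩
      exact hno l v v' hv.1 hv.2 h3 h4
    rw [hz', add_zero] at s2
    rw [← s1, ← s2]
    push_cast
    rw [add_sub_cancel_left]
    exact le_abs_self _

open Classical in
-- A relabelled vertex affects only the ordered pairs through it.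
lemma dsize_labelGraph_le (c c' : V → Option ℕ) :
    dsize (labelGraph c) (labelGraph c') ≤
      2 * Fintype.card V * ((Finset.univ.filter fun v => c v ≠ c' v).card : ℝ) := by
  have h : ∀ u v, dd (labelGraph c) (labelGraph c') u v ≤
      (if c u ≠ c' u then 1 else 0) + (if c v ≠ c' v then 1 else 0) := by
    intro u v
    by_cases hu : c u = c' u
    · by_cases hv : c v = c' v
      · rw [dd_eq_zero.2]
        · simp [hu, hv]
        · simp [labelGraph, hu, hv]
      · have := dd_le_one (labelGraph c) (labelGraph c') u v
        simpa [hu, hv] using this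
    · refine (dd_le_one _ _ _ _).trans ?_
      rw [if_pos hu]
      split_ifs <;> norm_num
  calc _ ≤ ∑ u : V, ∑ v : V, ((if c u ≠ c' u then (1 : ℝ) else 0) +
        (if c v ≠ c' v then 1 else 0)) :=
        Finset.sum_le_sum fun u _ => Finset.sum_le_sum fun v _ => h u v
    _ = _ := by
        simp only [Finset.sum_add_distrib, Finset.sum_const, Finset.sum_boole, Finset.card_univ,
          nsmul_eq_mul, ← Finset.mul_sum]
        ring

/-- Replaces all labels from `M` on by `none`. -/
def trunc (M : ℕ) : Option ℕ → Option ℕ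
  | none => none
  | some i => if i < M then some i else none

/-- Dissolving a part into universal vertices changes only the pairs inside it, and each vertex has
at most a proportion `η` of such partners. -/
lemma dsize_trunc_le (c : V → Option ℕ) (M : ℕ) {η : ℝ}
    (h : ∀ i, M ≤ i → cdens c (some i) ≤ η) (hη : 0 ≤ η) :
    dsize (labelGraph c) (labelGraph (trunc M ∘ c)) ≤ η * (Fintype.card V : ℝ) ^ 2 := by
  classical
  rcases isEmpty_or_nonempty V with hE | hN
  · simp [dsize]
  have hn : (0 : ℝ) < Fintype.card V := by exact_mod_cast Fintype.card_pos
  have h1 : ∀ u, ddeg (labelGraph c) (labelGraph (trunc M ∘ c)) u ≤ η * Fintype.card V := by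
    intro u
    by_cases hu : ∃ i, M ≤ i ∧ c u = some i
    · obtain ⟨i, hi, hu⟩ := hu
      calc _ ≤ ∑ v : V, if c v = some i then (1 : ℝ) else 0 := by
            refine Finset.sum_le_sum fun v _ => ?_
            split_ifs with hv
            · exact dd_le_one _ _ _ _
            · refine le_of_eq (dd_eq_zero.2 ?_)
              simp only [labelGraph, Function.comp, hu, trunc, if_neg (not_lt.2 hi)]
              simp [Ne.symm hv]
        _ = cdens c (some i) * Fintype.card V := by
            rw [cdens_eq, div_mul_cancel₀ _ hn.ne']
            simp
        _ ≤ _ := mul_le_mul_of_nonneg_right (h i hi) hn.le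
    · refine le_trans (le_of_eq (Finset.sum_eq_zero fun v _ => dd_eq_zero.2 ?_))
        (mul_nonneg hη hn.le)
      have e1 : trunc M (c u) = c u := by
        rcases hc : c u with _ | i
        · rfl
        · have : i < M := by
            by_contra hlt
            exact hu ⟨i, not_lt.1 hlt, hc⟩
          simp [trunc, this]
      simp only [labelGraph, Function.comp, e1]
      rcases hc : c u with _ | i
      · simp
      · have hi : i < M := by
          by_contra hlt
          exact hu ⟨i, not_lt.1 hlt, hc⟩
        rcases hcv : c v with _ | j
        · simp [trunc]
        · by_cases hj : j < M
          · simp [trunc, hj]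
          · have : i ≠ j := by omega
            simp [trunc, hj, this]
  calc _ ≤ ∑ _u : V, η * Fintype.card V := Finset.sum_le_sum fun u _ => h1 u
    _ = _ := by
        simp
        ring

lemma cdens_trunc_some (c : V → Option ℕ) {M i : ℕ} (hi : i < M) :
    cdens (trunc M ∘ c) (some i) = cdens c (some i) := by
  refine cdens_congr fun v => ?_
  simp only [Function.comp]
  rcases c v with _ | j
  · simp [trunc]
  · simp only [trunc]
    split_ifs with hj
    · rfl
    · simp only [Option.some.injEq, false_iff]
      omega

/-- The labels that survive truncation. -/
def truncLabels (M : ℕ) : Finset (Option ℕ) :=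
  Finset.cons none ((Finset.range M).map Function.Embedding.some) (by simp)

lemma sum_truncLabels (M : ℕ) (f : Option ℕ → ℝ) :
    ∑ l ∈ truncLabels M, f l = f none + ∑ i ∈ Finset.range M, f (some i) := by
  simp [truncLabels]

lemma trunc_mem (M : ℕ) (l : Option ℕ) : trunc M l ∈ truncLabels M := by
  rcases l with _ | i
  · simp [truncLabels, trunc]
  · by_cases h : i < M <;> simp [truncLabels, trunc, h]

lemma cdens_trunc_none [Nonempty V] (c : V → Option ℕ) (M : ℕ) :
    cdens (trunc M ∘ c) none = 1 - ∑ i ∈ Finset.range M, cdens c (some i) := by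
  have h := sum_cdens_eq_one (trunc M ∘ c) (truncLabels M) fun v => trunc_mem M _
  rw [sum_truncLabels, Finset.sum_congr rfl fun i hi =>
    cdens_trunc_some c (Finset.mem_range.1 hi)] at h
  linarith

/-- Two complete partite graphs whose large parts have similar sizes are similar. -/
lemma exists_perm_dsize_le [Nonempty V] (c c' : V → Option ℕ) (M : ℕ) {η : ℝ} (hη : 0 ≤ η)
    (h : ∀ i, M ≤ i → cdens c (some i) ≤ η) (h' : ∀ i, M ≤ i → cdens c' (some i) ≤ η) :
    ∃ σ : Equiv.Perm V, dsize (labelGraph c) (labelGraph (c' ∘ σ)) ≤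
      (2 * η + 4 * ∑ i ∈ Finset.range M, |cdens c (some i) - cdens c' (some i)|) *
        (Fintype.card V : ℝ) ^ 2 := by
  classical
  obtain ⟨σ, hσ⟩ := exists_perm_card_ne_le (trunc M ∘ c) (trunc M ∘ c') (truncLabels M)
    fun v => trunc_mem M _
  refine ⟨σ, ?_⟩
  have hn : (0 : ℝ) < Fintype.card V := by exact_mod_cast Fintype.card_pos
  have hperm : ∀ l, cdens (c' ∘ σ) l = cdens c' l := by
    intro l
    rw [cdens_eq, cdens_eq]
    congr 2
    refine Finset.card_bij (fun v _ => σ v) ?_ ?_ ?_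
    · intro v hv
      simpa using hv
    · intro v _ v' _ h
      exact σ.injective h
    · intro v hv
      exact ⟨σ.symm v, by simpa using hv, by simp⟩
  have h1 := dsize_trunc_le c M h hη
  have h2 := dsize_trunc_le (c' ∘ σ) M (fun i hi => by rw [hperm]; exact h' i hi) hη
  have h3 := dsize_labelGraph_le (trunc M ∘ c) (trunc M ∘ c' ∘ σ)
  have h4 := dsize_triangle (labelGraph c) (labelGraph (trunc M ∘ c))
    (labelGraph (trunc M ∘ c' ∘ σ))
  have h5 := dsize_triangle (labelGraph c) (labelGraph (trunc M ∘ c' ∘ σ)) (labelGraph (c' ∘ σ))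
  rw [dsize_comm (labelGraph (trunc M ∘ c' ∘ σ))] at h5
  rw [sum_truncLabels, cdens_trunc_none, cdens_trunc_none] at hσ
  set T := ∑ i ∈ Finset.range M, |cdens c (some i) - cdens c' (some i)| with hT
  have e1 : ∑ i ∈ Finset.range M,
      |cdens (trunc M ∘ c) (some i) - cdens (trunc M ∘ c') (some i)| = T :=
    Finset.sum_congr rfl fun i hi => by
      rw [cdens_trunc_some c (Finset.mem_range.1 hi), cdens_trunc_some c' (Finset.mem_range.1 hi)]
  -- The density of `none` after truncation is a complement, so its discrepancy is again at most
  -- `T`. The total `2 * T` of mismatches gives the coefficient four in the bound.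
  have e2 : |(1 - ∑ i ∈ Finset.range M, cdens c (some i)) -
      (1 - ∑ i ∈ Finset.range M, cdens c' (some i))| ≤ T := by
    rw [sub_sub_sub_cancel_left, ← Finset.sum_sub_distrib, hT]
    refine (Finset.abs_sum_le_sum_abs _ _).trans (le_of_eq ?_)
    exact Finset.sum_congr rfl fun i _ => abs_sub_comm _ _
  rw [e1] at hσ
  have h6 : ((Finset.univ.filter fun v => (trunc M ∘ c) v ≠ (trunc M ∘ c' ∘ σ) v).card : ℝ) ≤
      Fintype.card V * (2 * T) := by
    refine le_trans (le_of_eq ?_) (hσ.trans (mul_le_mul_of_nonneg_left (by linarith) hn.le))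
    exact congrArg (fun s : Finset V => (s.card : ℝ)) (by ext v; simp)
  have h7 := mul_le_mul_of_nonneg_left h6 (show (0 : ℝ) ≤ 2 * Fintype.card V by positivity)
  have h8 : dsize (labelGraph (trunc M ∘ c)) (labelGraph (trunc M ∘ c' ∘ σ)) ≤
      2 * Fintype.card V * (Fintype.card V * (2 * T)) := by
    refine h3.trans (le_trans (le_of_eq ?_) h7)
    congr!
  have h9 : dsize (labelGraph (c' ∘ σ)) (labelGraph (trunc M ∘ c' ∘ σ)) ≤
      η * (Fintype.card V : ℝ) ^ 2 := h2
  nlinarith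

end matching

/-! ### Complete partite graphs -/

lemma isCompleteMultipartite_labelGraph {V : Type} (c : V → Option ℕ) :
    (labelGraph c).IsCompleteMultipartite := by
  refine ⟨fun u v w huv hvw h => ?_⟩
  simp only [labelGraph, not_and_or, not_or, not_not, ne_eq] at huv hvw h
  obtain ⟨h1, h2⟩ := h
  rcases huv with rfl | ⟨h3, h4⟩
  · rcases hvw with rfl | ⟨h5, h6⟩
    · exact h1 rfl
    · tauto
  · rcases hvw with rfl | ⟨h5, h6⟩
    · tauto
    · rw [h3, h5] at h2
      rw [h3, h5] at h4
      exact h2.elim (fun h => h rfl) h4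

/-- The non-adjacency classes are numbered by decreasing size, by sorting the sizes in the order
dual. Universal vertices are treated as ordinary parts of size one, so `none` is not used. -/
lemma exists_label_of_isCompleteMultipartite {V : Type} [Fintype V] {F : SimpleGraph V}
    (hF : F.IsCompleteMultipartite) : ∃ c : V → Option ℕ, F = labelGraph c ∧
      Antitone fun i : ℕ => cdens c (some i) := by
  classical
  have : Fintype (Quotient hF.setoid) := Fintype.ofFinite _
  set t := Fintype.card (Quotient hF.setoid)
  let e : Quotient hF.setoid ≃ Fin t := Fintype.equivFin _
  let f : Fin t → ℕᵒᵈ := fun q => OrderDual.toDual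
    (Finset.univ.filter fun v => e (Quotient.mk hF.setoid v) = q).card
  let s := Tuple.sort f
  have hs : Monotone (f ∘ s) := Tuple.monotone_sort f
  let c : V → Option ℕ := fun v => some (s.symm (e (Quotient.mk hF.setoid v))).val
  have hc : ∀ u v, c u = c v ↔ ¬ F.Adj u v := by
    intro u v
    simp only [c, Option.some.injEq, Fin.val_inj, EmbeddingLike.apply_eq_iff_eq]
    exact Quotient.eq (r := hF.setoid)
  refine ⟨c, ?_, ?_⟩
  · ext u v
    have hn : c u ≠ none := by simp [c]
    simp only [labelGraph, ne_eq, hc, hn, or_false, not_not]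
    exact ⟨fun h => ⟨h.ne, h⟩, fun h => h.2⟩
  · have hd : ∀ i (hi : i < t), cdens c (some i) =
        ((OrderDual.ofDual ((f ∘ s) ⟨i, hi⟩) : ℕ) : ℝ) / Fintype.card V := by
      intro i hi
      rw [cdens_eq]
      congr 2
      simp only [f, Function.comp]
      congr 1
      ext v
      simp only [Finset.mem_filter, Finset.mem_univ, true_and, c, Option.some.injEq]
      rw [← Equiv.symm_apply_eq, Fin.ext_iff]
    intro i j hij
    simp only
    by_cases hj : j < t
    · rw [hd i (lt_of_le_of_lt hij hj), hd j hj]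
      refine div_le_div_of_nonneg_right ?_ (by positivity)
      exact_mod_cast hs (show (⟨i, lt_of_le_of_lt hij hj⟩ : Fin t) ≤ ⟨j, hj⟩ from hij)
    · rw [cdens_eq_zero]
      · exact cdens_nonneg _ _
      · intro v hv
        simp only [c, Option.some.injEq] at hv
        exact hj (hv ▸ (s.symm (e (Quotient.mk hF.setoid v))).2)

end

end PartiteStability

namespace PartiteStability

noncomputable section

/-! ### Compactness of the space of complete partite graphs -/

/-- `G` differs in few pairs from a realisation of `x`. -/
def Close (x : PartiteLimit) (ε : ℝ) {n : ℕ} (G : SimpleGraph (Fin n)) : Prop :=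
  ∃ c : Fin n → Option ℕ, IsRealisation x c ∧ dsize G (labelGraph c) ≤ ε * (n : ℝ) ^ 2

lemma cdens_some_le_of_isRealisation {x : PartiteLimit} {n : ℕ} (hn : 0 < n)
    {c : Fin n → Option ℕ} (hc : IsRealisation x c) (i : ℕ) :
    cdens c (some i) ≤ x.part i + 1 / n := by
  have hn' : (0 : ℝ) < n := by exact_mod_cast hn
  have h0 := x.part_nonneg i
  rw [cdens_eq_labelClass, div_le_iff₀ hn', add_mul, one_div, inv_mul_cancel₀ hn'.ne']
  by_cases hx : x.weight none = 0
  · have := (abs_lt.1 ((hc.1 hx).2 i)).2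
    linarith
  · rw [hc.2 hx i]
    split_ifs
    · have := Nat.floor_le (show 0 ≤ x.part i * (n : ℝ) by positivity)
      linarith
    · have : 0 ≤ x.part i * (n : ℝ) := by positivity
      simp
      linarith

lemma isRealisation_comp_perm {x : PartiteLimit} {n : ℕ} {c : Fin n → Option ℕ}
    (hc : IsRealisation x c) (σ : Equiv.Perm (Fin n)) : IsRealisation x (c ∘ σ) := by
  have h : ∀ i, (labelClass (c ∘ σ) i).card = (labelClass c i).card := by
    intro i
    refine Finset.card_bij (fun v _ => σ v) ?_ ?_ ?_
    · intro v hv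
      simpa [labelClass] using hv
    · intro v _ v' _ h
      exact σ.injective h
    · intro v hv
      exact ⟨σ.symm v, by simpa [labelClass] using hv, by simp⟩
  unfold IsRealisation at hc ⊢
  simp only [h]
  refine ⟨fun hx => ⟨?_, (hc.1 hx).2⟩, hc.2⟩
  rw [← Finset.card_eq_zero, h, Finset.card_eq_zero]
  exact (hc.1 hx).1

/-- The first `i + 1` parts are at least as large as part `i` and together have density at most one.
This bounds the tail parts uniformly over all graphs. -/
lemma cdens_le_of_antitone {V : Type} [Fintype V] {c : V → Option ℕ}
    (h : Antitone fun i : ℕ => cdens c (some i)) (i : ℕ) : cdens c (some i) ≤ 1 / (i + 1) := by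
  have h1 := sum_cdens_le_one c ((Finset.range (i + 1)).map Function.Embedding.some)
  rw [Finset.sum_map] at h1
  have h2 : ∑ _j ∈ Finset.range (i + 1), cdens c (some i) ≤
      ∑ j ∈ Finset.range (i + 1), cdens c (some j) :=
    Finset.sum_le_sum fun j hj => h (Nat.lt_succ_iff.1 (Finset.mem_range.1 hj))
  rw [Finset.sum_const, Finset.card_range, nsmul_eq_mul] at h2
  rw [le_div_iff₀ (by positivity)]
  push_cast at h2
  simp only [Function.Embedding.some_apply] at h1
  linarith

/-- Sorted label densities converge along ultrafilters. -/
lemma exists_partiteLimit {ι : Type*} (𝓤 : Ultrafilter ι) {V : ι → Type} [∀ i, Fintype (V i)]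
    {c : ∀ i, V i → Option ℕ} (hc : ∀ i, Antitone fun j : ℕ => cdens (c i) (some j)) :
    ∃ x : PartiteLimit, ∀ j : ℕ,
      Tendsto (fun i => cdens (c i) (some j)) 𝓤 (𝓝 (x.part j)) := by
  have hlim : ∀ j : ℕ, ∃ y : ℝ, Tendsto (fun i => cdens (c i) (some j)) 𝓤 (𝓝 y) := by
    intro j
    have hmem : (𝓤.map fun i => cdens (c i) (some j) : Filter ℝ) ≤ 𝓟 (Set.Icc 0 1) := by
      rw [le_principal_iff]
      exact Filter.mem_map.2 (Filter.univ_mem' fun i => ⟨cdens_nonneg _ _, cdens_le_one _ _⟩)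
    obtain ⟨y, -, hy⟩ := isCompact_Icc.ultrafilter_le_nhds _ hmem
    exact ⟨y, hy⟩
  choose y hy using hlim
  have h0 : ∀ j, 0 ≤ y j := fun j =>
    ge_of_tendsto' (hy j) fun i => cdens_nonneg _ _
  have hs : ∀ m, ∑ j ∈ Finset.range m, y j ≤ 1 := by
    intro m
    refine le_of_tendsto' (tendsto_finsetSum _ fun j _ => hy j) fun i => ?_
    have h1 := sum_cdens_le_one (c i) ((Finset.range m).map Function.Embedding.some)
    rwa [Finset.sum_map] at h1
  exact ⟨⟨y, fun a b hab => le_of_tendsto_of_tendsto' (hy b) (hy a) fun i => hc i hab, h0,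
    summable_of_sum_range_le h0 hs, Real.tsum_le_of_sum_range_le h0 hs⟩, hy⟩

/-! ### Continuity of the density and the optimal value. -/

section limits

variable {k : ℕ} {Γ : SimpleGraph (Fin k) → ℝ}

/-- The densities of graphs close to realisations of `x` are close to the density of `x`. -/
lemma tendsto_dens_of_close {ι : Type*} {l : Filter ι} {n : ι → ℕ} (hn : Tendsto n l atTop)
    {F : ∀ i, SimpleGraph (Fin (n i))} {x : PartiteLimit}
    (h : ∀ ε : ℝ, 0 < ε → ∀ᶠ i in l, Close x ε (F i)) :
    Tendsto (fun i => dens Γ (F i)) l (𝓝 (graphMean Γ x.weight)) := by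
  classical
  rw [Metric.tendsto_nhds]
  intro ε hε
  have hb := bd_nonneg Γ
  set C := 2 * bd Γ * (k : ℝ) ^ 2 with hC
  have hC0 : 0 ≤ C := by positivity
  set η := ε / (2 * (C + 1)) with hη
  have hη0 : 0 < η := by positivity
  -- The witnesses of closeness are completed by ordinary realisations, so that convergence of the
  -- label densities holds for the whole family.
  let c : ∀ i, Fin (n i) → Option ℕ := fun i =>
    if h : Close x η (F i) then h.choose else realisationLabel x (n i)
  have hc : ∀ i, IsRealisation x (c i) := by
    intro i
    simp only [c]
    split_ifs with h
    · exact h.choose_spec.1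
    · exact realisationLabel_spec _ _
  have t1 := tendsto_dens_labelGraph Γ x.weight_nonneg x.hasSum_weight
    (tendsto_card_fin hn) (tendsto_cdens_of_isRealisation hn x hc)
  filter_upwards [h η hη0, Metric.tendsto_nhds.1 t1 (ε / 2) (by linarith),
    hn.eventually_ge_atTop 1] with i h1 h2 h3
  have : Nonempty (Fin (n i)) := ⟨⟨0, h3⟩⟩
  have hn' : (0 : ℝ) < n i := by exact_mod_cast h3
  have h4 : dsize (F i) (labelGraph (c i)) ≤ η * (n i : ℝ) ^ 2 := by
    simp only [c, dif_pos h1]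
    exact h1.choose_spec.2
  have h5 := abs_dens_sub_le Γ (F i) (labelGraph (c i))
  rw [Fintype.card_fin] at h5
  have h6 : dsize (F i) (labelGraph (c i)) / (n i : ℝ) ^ 2 ≤ η := by
    rw [div_le_iff₀ (by positivity)]
    exact h4
  have h7 : C * η < ε / 2 := by
    rw [hη, mul_div_assoc', div_lt_div_iff₀ (by positivity) (by positivity)]
    nlinarith
  have h8 := h5.trans (mul_le_mul_of_nonneg_left h6 hC0)
  rw [Real.dist_eq] at h2 ⊢
  have := abs_sub_le (dens Γ (F i)) (dens Γ (labelGraph (c i))) (graphMean Γ x.weight)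
  linarith

/-- Along an ultrafilter, complete partite graphs converge to an element of the limit space. -/
lemma exists_close_of_isCompleteMultipartite {ι : Type*} (𝓤 : Ultrafilter ι) {n : ι → ℕ}
    (hn : Tendsto n 𝓤 atTop) {F : ∀ i, SimpleGraph (Fin (n i))}
    (hF : ∀ i, (F i).IsCompleteMultipartite) :
    ∃ x : PartiteLimit, ∀ ε : ℝ, 0 < ε → ∀ᶠ i in (𝓤 : Filter ι), Close x ε (F i) := by
  choose c hc hanti using fun i => exists_label_of_isCompleteMultipartite (hF i)
  obtain ⟨x, hx⟩ := exists_partiteLimit 𝓤 hanti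
  refine ⟨x, fun ε hε => ?_⟩
  -- Parts from `M` on have density at most `1 / (M + 1)` in every graph and in the limit, so only
  -- the first `M` parts need to be matched.
  obtain ⟨M, hM⟩ := exists_nat_one_div_lt (show 0 < ε / 8 by linarith)
  have hxM : ∀ j, M ≤ j → x.part j ≤ 1 / ((M : ℝ) + 1) := fun j hj =>
    le_of_tendsto' (hx j) fun i =>
      (hanti i hj).trans (cdens_le_of_antitone (hanti i) M)
  have hreal : ∀ j : ℕ, Tendsto (fun i => cdens (realisationLabel x (n i)) (some j)) 𝓤
      (𝓝 (x.part j)) := fun j =>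
    tendsto_cdens_of_isRealisation hn x (fun i => realisationLabel_spec x (n i)) (some j)
  have t1 : Tendsto (fun i => ∑ j ∈ Finset.range M,
      |cdens (c i) (some j) - cdens (realisationLabel x (n i)) (some j)|) 𝓤 (𝓝 0) := by
    have := tendsto_finsetSum (Finset.range M) fun j _ => ((hx j).sub (hreal j)).abs
    simpa using this
  have t2 : Tendsto (fun i => 1 / (n i : ℝ)) 𝓤 (𝓝 0) :=
    (tendsto_natCast_atTop_atTop.comp hn).const_div_atTop 1
  filter_upwards [t1.eventually (gt_mem_nhds (show 0 < ε / 8 by linarith)),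
    t2.eventually (gt_mem_nhds (show 0 < ε / 8 by linarith)),
    hn.eventually_ge_atTop 1] with i h1 h2 h3
  have : Nonempty (Fin (n i)) := ⟨⟨0, h3⟩⟩
  obtain ⟨σ, hσ⟩ := exists_perm_dsize_le (c i) (realisationLabel x (n i)) M
    (η := ε / 4) (by linarith)
    (fun j hj => ((hanti i hj).trans (cdens_le_of_antitone (hanti i) M)).trans (by linarith))
    (fun j hj => (cdens_some_le_of_isRealisation h3 (realisationLabel_spec x (n i)) j).trans (by
      have := hxM j hj
      linarith))
  refine ⟨_, isRealisation_comp_perm (realisationLabel_spec x (n i)) σ, ?_⟩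
  rw [hc i]
  refine hσ.trans ?_
  rw [Fintype.card_fin]
  refine mul_le_mul_of_nonneg_right ?_ (by positivity)
  linarith

lemma tendsto_lam_of_close (hΓ : IsoInvariant Γ) {ι : Type*} {l : Filter ι} {n : ι → ℕ}
    (hn : Tendsto n l atTop) {F : ∀ i, SimpleGraph (Fin (n i))} {x : PartiteLimit}
    (h : ∀ ε : ℝ, 0 < ε → ∀ᶠ i in l, Close x ε (F i)) :
    Tendsto (fun i => lam Γ (F i)) l (𝓝 (lamLimit Γ x)) := by
  have h1 := (tendsto_lam_sub_dens hΓ hn F).add (tendsto_dens_of_close (Γ := Γ) hn h)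
  rw [lamLimit_eq hΓ]
  simpa using h1

lemma lam_le_lamOrder {n : ℕ} (G : SimpleGraph (Fin n)) : lam Γ G ≤ lamOrder Γ n :=
  le_ciSup (Set.finite_range fun G : SimpleGraph (Fin n) => lam Γ G).bddAbove G

/-- Symmetrising a maximiser cannot decrease `λ`, so the complete partite graph at the end is also a
maximiser. -/
lemma exists_extremal (hsym : Symmetrisable Γ) :
    ∃ n₀ : ℕ, ∀ n, n₀ ≤ n → ∃ F : SimpleGraph (Fin n),
      F.IsCompleteMultipartite ∧ lam Γ F = lamOrder Γ n := by
  obtain ⟨n₀, -, h⟩ := hsym 1 one_pos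
  refine ⟨n₀, fun n hn => ?_⟩
  obtain ⟨G, hG⟩ := exists_eq_ciSup_of_finite (f := fun G : SimpleGraph (Fin n) => lam Γ G)
  obtain ⟨m, S, hS0, hSm, hS⟩ := (h n hn G).1
  refine ⟨S m, hSm, le_antisymm (lam_le_lamOrder _) ?_⟩
  have : ∀ i ≤ m, lam Γ (S 0) ≤ lam Γ (S i) := by
    intro i
    induction i with
    | zero => exact fun _ => le_rfl
    | succ i ih => exact fun hi => (ih (by omega)).trans (hS i (by omega)).1
  have h1 := this m le_rfl
  rw [hS0] at h1
  exact hG.ge.trans h1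

/-- The limit of extremal complete partite graphs is optimal: its value is the limit of the maxima,
which dominate the values of all realisations. -/
lemma exists_mem_OPT_tendsto (hΓ : IsoInvariant Γ) (hsym : Symmetrisable Γ) (𝓤 : Ultrafilter ℕ)
    (h𝓤 : (𝓤 : Filter ℕ) ≤ atTop) :
    ∃ x ∈ OPT Γ, Tendsto (lamOrder Γ) 𝓤 (𝓝 (lamLimit Γ x)) := by
  obtain ⟨n₀, h⟩ := exists_extremal hsym
  have h' : ∀ n, ∃ F : SimpleGraph (Fin n), F.IsCompleteMultipartite ∧
      (n₀ ≤ n → lam Γ F = lamOrder Γ n) := by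
    intro n
    by_cases hn : n₀ ≤ n
    · obtain ⟨F, hF, hF'⟩ := h n hn
      exact ⟨F, hF, fun _ => hF'⟩
    · exact ⟨⊥, SimpleGraph.bot_isCompleteMultipartite, fun h => absurd h hn⟩
  choose F hF hF' using h'
  have hid : Tendsto (fun n : ℕ => n) 𝓤 atTop := h𝓤
  obtain ⟨x, hx⟩ := exists_close_of_isCompleteMultipartite 𝓤 hid hF
  have t1 : Tendsto (lamOrder Γ) 𝓤 (𝓝 (lamLimit Γ x)) := by
    refine (tendsto_lam_of_close hΓ hid hx).congr' ?_
    filter_upwards [h𝓤 (eventually_ge_atTop n₀)] with n hn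
    exact hF' n hn
  refine ⟨x, fun y => ?_, t1⟩
  have t2 := (tendsto_lam_realisation hΓ y).mono_left h𝓤
  rw [← lamLimit_eq hΓ] at t2
  exact le_of_tendsto_of_tendsto' t2 t1 fun n => lam_le_lamOrder _

lemma lamLimit_eq_of_mem_OPT {x y : PartiteLimit} (hx : x ∈ OPT Γ) (hy : y ∈ OPT Γ) :
    lamLimit Γ x = lamLimit Γ y :=
  le_antisymm (hy x) (hx y)

lemma OPT_nonempty (hΓ : IsoInvariant Γ) (hsym : Symmetrisable Γ) : (OPT Γ).Nonempty := by
  obtain ⟨x, hx, -⟩ := exists_mem_OPT_tendsto hΓ hsym (Ultrafilter.of atTop) (Ultrafilter.of_le _)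
  exact ⟨x, hx⟩

/-- Along every ultrafilter the maxima tend to the value of some optimal element, and all optimal
elements have the same value. -/
lemma tendsto_lamOrder (hΓ : IsoInvariant Γ) (hsym : Symmetrisable Γ) {x : PartiteLimit}
    (hx : x ∈ OPT Γ) : Tendsto (lamOrder Γ) atTop (𝓝 (lamLimit Γ x)) := by
  rw [tendsto_iff_ultrafilter]
  intro 𝓤 h𝓤
  obtain ⟨y, hy, h⟩ := exists_mem_OPT_tendsto hΓ hsym 𝓤 h𝓤
  rwa [lamLimit_eq_of_mem_OPT hx hy]

lemma lamMax_eq (hΓ : IsoInvariant Γ) (hsym : Symmetrisable Γ) {x : PartiteLimit}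
    (hx : x ∈ OPT Γ) : lamMax Γ = lamLimit Γ x :=
  (tendsto_lamOrder hΓ hsym hx).limUnder_eq

/-- Nearly optimal complete partite graphs are close to a realisation of an optimal element. -/
lemma exists_close_of_le_lam (hΓ : IsoInvariant Γ) (hsym : Symmetrisable Γ) {ε : ℝ} (hε : 0 < ε) :
    ∃ δ : ℝ, 0 < δ ∧ ∃ n₀ : ℕ, ∀ n, n₀ ≤ n → ∀ F : SimpleGraph (Fin n),
      F.IsCompleteMultipartite → lamMax Γ - δ ≤ lam Γ F → ∃ x ∈ OPT Γ, Close x ε F := by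
  by_contra hcon
  push Not at hcon
  have h : ∀ j : ℕ, ∃ n, j ≤ n ∧ ∃ F : SimpleGraph (Fin n), F.IsCompleteMultipartite ∧
      lamMax Γ - 1 / ((j : ℝ) + 1) ≤ lam Γ F ∧ ∀ x ∈ OPT Γ, ¬ Close x ε F := by
    intro j
    exact hcon (1 / ((j : ℝ) + 1)) (by positivity) j
  choose n hn F hF hlam hclose using h
  set 𝓤 : Ultrafilter ℕ := Ultrafilter.of atTop
  have h𝓤 : (𝓤 : Filter ℕ) ≤ atTop := Ultrafilter.of_le _
  have hn' : Tendsto n 𝓤 atTop := (tendsto_atTop_mono hn tendsto_id).mono_left h𝓤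
  obtain ⟨x, hx⟩ := exists_close_of_isCompleteMultipartite 𝓤 hn' hF
  have t1 := tendsto_lam_of_close hΓ hn' hx
  obtain ⟨y, hy⟩ := OPT_nonempty hΓ hsym
  have t2 : Tendsto (fun j : ℕ => lamMax Γ - 1 / ((j : ℝ) + 1)) 𝓤 (𝓝 (lamMax Γ)) := by
    have := (tendsto_one_div_add_atTop_nhds_zero_nat (𝕜 := ℝ)).const_sub (lamMax Γ)
    rw [sub_zero] at this
    exact this.mono_left h𝓤
  have h1 : lamMax Γ ≤ lamLimit Γ x := le_of_tendsto_of_tendsto' t2 t1 hlam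
  rw [lamMax_eq hΓ hsym hy] at h1
  have hxO : x ∈ OPT Γ := fun z => (hy z).trans h1
  obtain ⟨j, hj⟩ := (hx ε hε).exists
  exact hclose j x hxO hj

end limits

end

end PartiteStability

namespace PartiteStability

noncomputable section

/-! ### Consequences of strictness under flips -/

/-- For `k = 1` the sampled graphs have one vertex and never see a flip. -/
lemma two_le_of_flipLossLimit_pos {k : ℕ} (hk : 0 < k) {Γ : SimpleGraph (Fin k) → ℝ}
    {x : PartiteLimit} {i j : Option ℕ} (h : 0 < flipLossLimit Γ x i j) : 2 ≤ k := by
  by_contra hlt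
  obtain rfl : k = 1 := by omega
  have h1 : ∀ (n : ℕ) (G H : SimpleGraph (Fin n)), lamSum Γ G = lamSum Γ H := by
    intro n G H
    unfold lamSum
    refine Finset.sum_congr rfl fun X _ => congrArg Γ ?_
    ext a b
    have hab : a = b := Subsingleton.elim _ _
    subst hab
    simp
  have h2 : flipLossLimit Γ x i j = 0 := by
    unfold flipLossLimit
    refine Tendsto.limUnder_eq (tendsto_const_nhds.congr fun n => ?_)
    split_ifs with hp
    · rw [flipLoss, h1 n _ (flipPair (realisation x n) hp.choose.1 hp.choose.2), sub_self, mul_zero]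
    · rfl
  exact h.ne' h2

section mean

variable {k : ℕ} {Γ : SimpleGraph (Fin k) → ℝ}

/-- Joining two vertices of part `p` has the same effect as moving one of them to another part `q`,
as long as no other sampled vertex lies in either part. -/
lemma flipPair_labelGraph_update_same {ℓ : Fin k → Option ℕ} {a b : Fin k} (hab : a ≠ b) {p q : ℕ}
    (hpq : p ≠ q) (hℓ : ∀ d, ℓ d ≠ some p ∧ ℓ d ≠ some q) :
    flipPair (labelGraph (Function.update (Function.update ℓ a (some p)) b (some p))) a b =
      labelGraph (Function.update (Function.update ℓ a (some p)) b (some q)) := by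
  classical
  ext d e
  rw [flipPair_adj _ hab]
  simp only [labelGraph, Function.update_apply]
  have h1 := hℓ d
  have h2 := hℓ e
  have h1' := h1.1.symm
  have h1'' := h1.2.symm
  have h2' := h2.1.symm
  have h2'' := h2.2.symm
  by_cases hd : d = a
  · subst hd
    by_cases he : e = b
    · subst he
      simp [hab, hpq]
    · by_cases hed : e = d
      · subst hed
        simp [hab]
      · simp [he, hab, hed, h2']
  · by_cases hdb : d = b
    · subst hdb
      by_cases he : e = a
      · subst he
        simp [Ne.symm hab, hab, hpq.symm]
      · by_cases hed : e = d
        · subst hed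
          simp [hd]
        · simp [hed, he, hd, h2', h2'']
    · by_cases he : e = a
      · subst he
        simp [hab, hd, hdb, h1]
      · by_cases heb : e = b
        · subst heb
          simp [he, hd, hdb, h1]
        · simp [hd, hdb, he, heb]

lemma flipPair_flipPair {V : Type} (G : SimpleGraph V) (u v : V) :
    flipPair (flipPair G u v) u v = G := by
  simp [flipPair]

/-- Flipping a pair inside `p` and flipping a pair between `p` and `q` are inverse operations unless
a sampled label is `p` or `q`. The two losses therefore nearly cancel when both parts are small. -/
lemma abs_flipMean_add_le (x : PartiteLimit) {p q : ℕ} (hpq : p ≠ q) :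
    |flipMean Γ x.weight (some p) (some p) + flipMean Γ x.weight (some p) (some q)| ≤
      (k : ℝ) ^ 2 * (4 * bd Γ * (k * (x.part p + x.part q))) := by
  classical
  have hb := bd_nonneg Γ
  have hp := x.part_nonneg p
  have hq := x.part_nonneg q
  set θ : Option ℕ → Fin k → Fin k → (Fin k → Option ℕ) → ℝ := fun j a b ℓ =>
    Γ (labelGraph (Function.update (Function.update ℓ a (some p)) b j)) -
      Γ (flipPair (labelGraph (Function.update (Function.update ℓ a (some p)) b j)) a b) with hθ
  have hθb : ∀ j a b ℓ, |θ j a b ℓ| ≤ 2 * bd Γ := by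
    intro j a b ℓ
    have h2 := abs_le_bd Γ (labelGraph (Function.update (Function.update ℓ a (some p)) b j))
    have h3 := abs_le_bd Γ
      (flipPair (labelGraph (Function.update (Function.update ℓ a (some p)) b j)) a b)
    exact (abs_sub _ _).trans (by linarith)
  have hreal := tendsto_cdens_of_isRealisation (tendsto_add_atTop_nat 1) x
    (fun n => realisationLabel_spec x (n + 1))
  have key : ∀ a b : Fin k, a ≠ b →
      |mean x.weight (θ (some p) a b) + mean x.weight (θ (some q) a b)| ≤
        4 * bd Γ * (k * (x.part p + x.part q)) := by
    intro a b hab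
    -- The estimate is made in realisations, where label probabilities are finite averages, and then
    -- passed to the limit.
    have t1 : ∀ j, Tendsto (fun n : ℕ => avg fun f : Fin k → Fin (n + 1) =>
        θ j a b (realisationLabel x (n + 1) ∘ f)) atTop (𝓝 (mean x.weight (θ j a b))) := fun j =>
      tendsto_avg (Eventually.of_forall fun n => ⟨0⟩) x.weight_nonneg x.hasSum_weight hreal _
        (hθb j a b)
    have t2 := ((t1 (some p)).add (t1 (some q))).abs
    have t3 := (((hreal (some p)).add (hreal (some q))).const_mul (k : ℝ)).const_mul (4 * bd Γ)
    refine le_of_tendsto_of_tendsto' t2 t3 fun n => ?_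
    set c := realisationLabel x (n + 1)
    have h1 : ∀ f : Fin k → Fin (n + 1), |θ (some p) a b (c ∘ f) - -θ (some q) a b (c ∘ f)| ≤
        4 * bd Γ * ∑ d : Fin k, if c (f d) = some p ∨ c (f d) = some q then 1 else 0 := by
      intro f
      by_cases h : ∀ d, (c ∘ f) d ≠ some p ∧ (c ∘ f) d ≠ some q
      · have e1 := flipPair_labelGraph_update_same hab hpq h
        have e2 := flipPair_flipPair
          (labelGraph (Function.update (Function.update (c ∘ f) a (some p)) b (some p))) a b
        rw [e1] at e2
        simp only [hθ, e1, e2]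
        ring_nf
        rw [abs_zero]
        have : (0 : ℝ) ≤ ∑ d : Fin k, if c (f d) = some p ∨ c (f d) = some q then 1 else 0 :=
          Finset.sum_nonneg fun d _ => by split_ifs <;> simp
        positivity
      · push Not at h
        obtain ⟨d, hd⟩ := h
        have hd' : c (f d) = some p ∨ c (f d) = some q := by
          by_cases hc : (c ∘ f) d = some p
          · exact Or.inl hc
          · exact Or.inr (hd hc)
        have h2 : (1 : ℝ) ≤ ∑ d : Fin k, if c (f d) = some p ∨ c (f d) = some q then 1 else 0 := by
          refine le_trans ?_ (Finset.single_le_sum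
            (f := fun d => if c (f d) = some p ∨ c (f d) = some q then (1 : ℝ) else 0)
            (fun d _ => by split_ifs <;> simp) (Finset.mem_univ d))
          simp [hd']
        have h3 := abs_sub (θ (some p) a b (c ∘ f)) (-θ (some q) a b (c ∘ f))
        rw [abs_neg] at h3
        have h4 := hθb (some p) a b (c ∘ f)
        have h5 := hθb (some q) a b (c ∘ f)
        nlinarith
    have e : (avg fun f : Fin k → Fin (n + 1) => θ (some p) a b (c ∘ f)) +
        (avg fun f : Fin k → Fin (n + 1) => θ (some q) a b (c ∘ f)) =
        avg fun f : Fin k → Fin (n + 1) => θ (some p) a b (c ∘ f) - -θ (some q) a b (c ∘ f) := by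
      have h6 := avg_const_mul (-1) fun f : Fin k → Fin (n + 1) => θ (some q) a b (c ∘ f)
      simp only [neg_mul, one_mul] at h6
      rw [avg_sub (fun f => θ (some p) a b (c ∘ f)), h6, sub_neg_eq_add]
    rw [e]
    refine (abs_avg_le _).trans ((avg_mono h1).trans ?_)
    rw [avg_const_mul, avg_sum]
    refine mul_le_mul_of_nonneg_left ?_ (by linarith)
    have h7 : ∀ d : Fin k, avg (fun f : Fin k → Fin (n + 1) =>
        if c (f d) = some p ∨ c (f d) = some q then (1 : ℝ) else 0) ≤
          cdens c (some p) + cdens c (some q) := by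
      intro d
      rw [avg_eval d (fun v => if c v = some p ∨ c v = some q then (1 : ℝ) else 0), cdens_eq,
        cdens_eq, ← add_div]
      refine div_le_div_of_nonneg_right ?_ (by positivity)
      rw [← Finset.sum_boole, ← Finset.sum_boole, ← Finset.sum_add_distrib]
      refine Finset.sum_le_sum fun v _ => ?_
      by_cases h1 : c v = some p <;> by_cases h2 : c v = some q <;>
        simp [h1, h2, hpq, hpq.symm]
    refine (Finset.sum_le_sum fun d _ => h7 d).trans (le_of_eq ?_)
    simp
    ring
  unfold flipMean
  rw [← Finset.sum_add_distrib]
  refine (Finset.abs_sum_le_sum_abs _ _).trans ?_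
  have h8 : ∀ a : Fin k, |(∑ b : Fin k, if a = b then 0 else mean x.weight (θ (some p) a b)) +
      ∑ b : Fin k, if a = b then 0 else mean x.weight (θ (some q) a b)| ≤
      k * (4 * bd Γ * (k * (x.part p + x.part q))) := by
    intro a
    rw [← Finset.sum_add_distrib]
    refine (Finset.abs_sum_le_sum_abs _ _).trans ?_
    refine (Finset.sum_le_sum (g := fun _ => 4 * bd Γ * (k * (x.part p + x.part q)))
      fun b _ => ?_).trans (by simp)
    split_ifs with hab
    · rw [add_zero, abs_zero]
      positivity
    · exact key a b hab
  refine (Finset.sum_le_sum fun a _ => h8 a).trans (le_of_eq ?_)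
  simp
  ring

/-- With infinite support all parts are positive and tend to zero. For two consecutive small parts
the losses inside and across are nearly opposite, so they cannot both be at least `c`. -/
lemma finite_suppStar {x : PartiteLimit} {c : ℝ} (hc : 0 < c)
    (h : ∀ i ∈ x.suppStar, ∀ j ∈ x.suppStar, c ≤ flipMean Γ x.weight i j) :
    x.suppStar.Finite := by
  by_contra hinf
  have hpos : ∀ i, 0 < x.part i := by
    intro i
    by_contra hi
    refine hinf (Set.Finite.subset (s := insert none (some '' Set.Iio i))
      (((Set.finite_Iio i).image _).insert _) ?_)
    rintro (_ | j) hj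
    · exact Set.mem_insert _ _
    · refine Set.mem_insert_of_mem _ ⟨j, ?_, rfl⟩
      rw [Set.mem_Iio]
      by_contra hij
      have h1 := x.antitone_part (not_lt.1 hij)
      have h2 : 0 < x.part j := hj
      linarith
  have ht := x.summable_part.tendsto_atTop_zero
  have t1 : Tendsto (fun p : ℕ => (k : ℝ) ^ 2 * (4 * bd Γ * (k * (x.part p + x.part (p + 1)))))
      atTop (𝓝 0) := by
    have := (((ht.add (ht.comp (tendsto_add_atTop_nat 1))).const_mul (k : ℝ)).const_mul
      (4 * bd Γ)).const_mul ((k : ℝ) ^ 2)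
    simpa using this
  obtain ⟨p, hp⟩ := (t1.eventually (gt_mem_nhds (show 0 < 2 * c by linarith))).exists
  have h1 := abs_flipMean_add_le (Γ := Γ) x (show p ≠ p + 1 by omega)
  have h2 := h (some p) (hpos p) (some p) (hpos p)
  have h3 := h (some p) (hpos p) (some (p + 1)) (hpos (p + 1))
  have h4 := le_abs_self
    (flipMean Γ x.weight (some p) (some p) + flipMean Γ x.weight (some p) (some (p + 1)))
  linarith

end mean

/-! ### Local optimality -/

/-- The labels lie in the support of `x` and their densities are close to the weights of `x`. -/
def NearLabel (x : PartiteLimit) (δ : ℝ) {V : Type} [Fintype V] (c : V → Option ℕ) : Prop :=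
  (∀ v, c v ∈ x.suppStar) ∧ ∀ l, |cdens c l - x.weight l| ≤ δ

section uniform

variable {k : ℕ} {Γ : SimpleGraph (Fin k) → ℝ}

lemma tendsto_cdens_of_nearLabel {ι : Type*} {l : Filter ι} {V : ι → Type} [∀ i, Fintype (V i)]
    {x : PartiteLimit} {δ : ι → ℝ} (hδ : Tendsto δ l (𝓝 0)) {c : ∀ i, V i → Option ℕ}
    (h : ∀ i, NearLabel x (δ i) (c i)) (a : Option ℕ) :
    Tendsto (fun i => cdens (c i) a) l (𝓝 (x.weight a)) :=
  tendsto_of_abs_sub_le tendsto_const_nhds hδ (Eventually.of_forall fun i => (h i).2 a)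

lemma exists_eventually_eq_of_finite {ι L : Type*} (𝓤 : Ultrafilter ι) {S : Set L} (hS : S.Finite)
    {f : ι → L} (hf : ∀ i, f i ∈ S) : ∃ l ∈ S, ∀ᶠ i in (𝓤 : Filter ι), f i = l := by
  have h : (⋃ l ∈ S, {i | f i = l}) ∈ 𝓤 := by
    refine Filter.mem_of_superset Filter.univ_mem fun i _ => ?_
    simpa using hf i
  exact (Ultrafilter.finite_biUnion_mem_iff hS).1 h

/-- A sequence of counterexamples has eventually constant labels at the flipped vertices along an
ultrafilter, because the support is finite. The limit then contradicts the bound on `flipMean`. -/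
lemma exists_uniform_flip {x : PartiteLimit} (hS : x.suppStar.Finite) {c₀ c₁ : ℝ} (hc : c₁ < c₀)
    (h : ∀ i ∈ x.suppStar, ∀ j ∈ x.suppStar, c₀ ≤ flipMean Γ x.weight i j) :
    ∃ δ : ℝ, 0 < δ ∧ ∃ n₀ : ℕ, ∀ n, n₀ ≤ n → ∀ c : Fin n → Option ℕ, NearLabel x δ c →
      ∀ u v, u ≠ v →
        c₁ ≤ (n : ℝ) ^ 2 * (dens Γ (labelGraph c) - dens Γ (flipPair (labelGraph c) u v)) := by
  by_contra hcon
  push Not at hcon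
  have h' := fun j : ℕ => hcon (1 / ((j : ℝ) + 1)) (by positivity) j
  choose n hn c hnear u v huv hlt using h'
  set 𝓤 : Ultrafilter ℕ := Ultrafilter.of atTop
  have h𝓤 : (𝓤 : Filter ℕ) ≤ atTop := Ultrafilter.of_le _
  have hn' : Tendsto n 𝓤 atTop := (tendsto_atTop_mono hn tendsto_id).mono_left h𝓤
  have hδ : Tendsto (fun j : ℕ => 1 / ((j : ℝ) + 1)) 𝓤 (𝓝 0) :=
    tendsto_one_div_add_atTop_nhds_zero_nat.mono_left h𝓤
  obtain ⟨p, hp, hup⟩ := exists_eventually_eq_of_finite 𝓤 hS fun j => (hnear j).1 (u j)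
  obtain ⟨q, hq, hvq⟩ := exists_eventually_eq_of_finite 𝓤 hS fun j => (hnear j).1 (v j)
  have t := tendsto_flip Γ x.weight_nonneg x.hasSum_weight (tendsto_card_fin hn')
    (tendsto_cdens_of_nearLabel hδ hnear) (u := u) (v := v) (p := p) (q := q) (by
      filter_upwards [hup, hvq] with j h1 h2
      exact ⟨huv j, h1, h2⟩)
  have h1 : flipMean Γ x.weight p q ≤ c₁ := by
    refine le_of_tendsto' t fun j => ?_
    rw [Fintype.card_fin]
    exact (hlt j).le
  linarith [h p hp q hq]

end uniform

section localOpt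

variable {k : ℕ} {Γ : SimpleGraph (Fin k) → ℝ} {V : Type} [Fintype V]

lemma dd_flipPair_right {V : Type} (F H : SimpleGraph V) {u v : V} (huv : u ≠ v)
    (hd : ¬ (F.Adj u v ↔ H.Adj u v)) (a b : V) :
    open Classical in dd F (flipPair H u v) a b = dd F H a b -
      ((if a = u ∧ b = v then 1 else 0) + if a = v ∧ b = u then 1 else 0) := by
  classical
  by_cases h1 : a = u ∧ b = v
  · obtain ⟨rfl, rfl⟩ := h1
    rw [dd_eq_one hd, dd_eq_zero.2]
    · simp [huv]
    · rw [flipPair_adj H huv, if_pos (Or.inl ⟨rfl, rfl⟩)]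
      tauto
  by_cases h2 : a = v ∧ b = u
  · obtain ⟨rfl, rfl⟩ := h2
    have hd' : ¬ (F.Adj a b ↔ H.Adj a b) := by rwa [F.adj_comm, H.adj_comm]
    rw [dd_eq_one hd', dd_eq_zero.2]
    · simp [huv.symm]
    · rw [flipPair_adj H huv, if_pos (Or.inr ⟨rfl, rfl⟩)]
      tauto
  · rw [if_neg h1, if_neg h2, add_zero, sub_zero]
    unfold dd
    rw [flipPair_adj H huv, if_neg (not_or.2 ⟨h1, h2⟩)]

lemma ddeg_flipPair_le (F H : SimpleGraph V) {u v : V} (huv : u ≠ v)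
    (hd : ¬ (F.Adj u v ↔ H.Adj u v)) (a : V) : ddeg F (flipPair H u v) a ≤ ddeg F H a := by
  classical
  refine Finset.sum_le_sum fun b _ => ?_
  rw [dd_flipPair_right F H huv hd]
  have : (0 : ℝ) ≤ (if a = u ∧ b = v then 1 else 0) + if a = v ∧ b = u then 1 else 0 := by
    split_ifs <;> norm_num
  linarith

lemma dsize_flipPair (F H : SimpleGraph V) {u v : V} (huv : u ≠ v)
    (hd : ¬ (F.Adj u v ↔ H.Adj u v)) : dsize F (flipPair H u v) = dsize F H - 2 := by
  classical
  have h : ∀ u v : V, ∑ a : V, ∑ b : V, (if a = u ∧ b = v then (1 : ℝ) else 0) = 1 := by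
    intro u v
    simp [ite_and]
  simp only [dsize, ddeg, dd_flipPair_right F H huv hd, Finset.sum_sub_distrib,
    Finset.sum_add_distrib, h]
  norm_num

/-- If every flip of a pair in `F` loses at least `c`, then so does every sparse set of flips. -/
lemma le_dens_sub_of_flips [Nonempty V] {F : SimpleGraph V} {c η : ℝ}
    (hflip : ∀ u v, u ≠ v →
      c ≤ (Fintype.card V : ℝ) ^ 2 * (dens Γ F - dens Γ (flipPair F u v)))
    (H : SimpleGraph V) (hdeg : ∀ u, ddeg F H u ≤ η * Fintype.card V)
    (hsize : dsize F H ≤ η * (Fintype.card V : ℝ) ^ 2) :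
    (c - 12 * bd Γ * (k : ℝ) ^ 4 * η) * (dsize F H / 2) ≤
      (Fintype.card V : ℝ) ^ 2 * (dens Γ F - dens Γ H) := by
  have hb := bd_nonneg Γ
  have hn : (0 : ℝ) < Fintype.card V := by exact_mod_cast Fintype.card_pos
  obtain ⟨m, hm⟩ : ∃ m : ℕ, dsize F H = 2 * m := ⟨_, dsize_eq_edgeDiff F H⟩
  induction m generalizing H with
  | zero =>
    have hall : ∀ u v, dd F H u v = 0 := by
      intro u v
      have h1 : dd F H u v ≤ ddeg F H u :=
        Finset.single_le_sum (f := fun v => dd F H u v) (fun _ _ => dd_nonneg _ _ _ _)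
          (Finset.mem_univ v)
      have h2 := ddeg_le_dsize F H u
      have h3 := dd_nonneg F H u v
      rw [hm] at h2
      simp at h2
      linarith
    have : F = H := by
      ext u v
      exact dd_eq_zero.1 (hall u v)
    subst this
    rw [dsize_self]
    simp
  | succ m ih =>
    have hex : ∃ u v, ¬ (F.Adj u v ↔ H.Adj u v) := by
      by_contra hcon
      push Not at hcon
      have : dsize F H = 0 := Finset.sum_eq_zero fun u _ => Finset.sum_eq_zero fun v _ =>
        dd_eq_zero.2 (hcon u v)
      rw [this] at hm
      have : (0 : ℝ) < 2 * ((m + 1 : ℕ) : ℝ) := by positivity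
      linarith
    obtain ⟨u, v, hd⟩ := hex
    have huv : u ≠ v := by
      rintro rfl
      simp at hd
    set H' := flipPair H u v with hH'
    have hs := dsize_flipPair F H huv hd
    have hs0 : dsize F H' = 2 * m := by
      rw [hs, hm]
      push_cast
      ring
    have hdeg' : ∀ a, ddeg F H' a ≤ η * Fintype.card V := fun a =>
      (ddeg_flipPair_le F H huv hd a).trans (hdeg a)
    have hsize' : dsize F H' ≤ η * (Fintype.card V : ℝ) ^ 2 := by linarith
    have h1 := ih H' hdeg' hsize' hs0
    have hH : flipPair H' u v = H := flipPair_flipPair H u v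
    -- The last flip is undone: `H'` agrees with `F` at `uv`, so flipping there in `H'` and in `F`
    -- has almost the same effect.
    have h0 : dd F H' u v = 0 := by
      classical
      rw [dd_flipPair_right F H huv hd, dd_eq_one hd]
      simp [huv]
    have h2 := abs_flip_second_diff_le Γ F H' huv h0
    rw [hH] at h2
    have h3 := hflip u v huv
    -- Two degrees and the size contribute `η` each, whence the factor twelve in the statement.
    have h4 : (ddeg F H' u + ddeg F H' v) / Fintype.card V +
        dsize F H' / (Fintype.card V : ℝ) ^ 2 ≤ 3 * η := by
      have h5 : ddeg F H' u / Fintype.card V ≤ η := by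
        rw [div_le_iff₀ hn]
        exact hdeg' u
      have h6 : ddeg F H' v / Fintype.card V ≤ η := by
        rw [div_le_iff₀ hn]
        exact hdeg' v
      have h7 : dsize F H' / (Fintype.card V : ℝ) ^ 2 ≤ η := by
        rw [div_le_iff₀ (by positivity)]
        exact hsize'
      rw [add_div]
      linarith
    have h8 := h2.trans (mul_le_mul_of_nonneg_left h4
      (show 0 ≤ 4 * bd Γ * (k : ℝ) ^ 4 by positivity))
    have h9 := mul_le_mul_of_nonneg_left (le_abs_self ((dens Γ F - dens Γ (flipPair F u v)) -
      (dens Γ H' - dens Γ H))) (show 0 ≤ (Fintype.card V : ℝ) ^ 2 by positivity)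
    have h10 : c - 12 * bd Γ * (k : ℝ) ^ 4 * η ≤
        (Fintype.card V : ℝ) ^ 2 * (dens Γ H' - dens Γ H) := by
      nlinarith
    have h11 : dsize F H / 2 = dsize F H' / 2 + 1 := by
      rw [hs]
      ring
    rw [h11]
    nlinarith

end localOpt

end

end PartiteStability

namespace PartiteStability

noncomputable section

/-! ### Changing a single vertex -/

section star

variable {V : Type} [Fintype V]

lemma ddeg_eq_of_star {F H : SimpleGraph V} {z : V}
    (h : ∀ u v, u ≠ z → v ≠ z → dd F H u v = 0) {u : V} (hu : u ≠ z) :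
    ddeg F H u = dd F H z u := by
  rw [ddeg, Finset.sum_eq_single z, dd_symm]
  · intro v _ hv
    exact h u v hu hv
  · simp

lemma dsize_eq_of_star {F H : SimpleGraph V} {z : V}
    (h : ∀ u v, u ≠ z → v ≠ z → dd F H u v = 0) : dsize F H = 2 * ddeg F H z := by
  classical
  rw [dsize, ← Finset.add_sum_erase _ _ (Finset.mem_univ z),
    Finset.sum_congr rfl fun u hu => ddeg_eq_of_star h (Finset.ne_of_mem_erase hu), two_mul]
  congr 1
  rw [ddeg, ← Finset.add_sum_erase _ _ (Finset.mem_univ z), dd_self, zero_add]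

/-- Whether a vertex with label `l` is adjacent to a vertex with label `i` in a complete
partite graph. -/
def corr (i l : Option ℕ) : Bool := decide (l ≠ i ∨ l = none)

/-- Part membership of `z` becomes one choice of neighbourhood among all, so it can be compared with
an arbitrary one by the results on stars. -/
lemma labelGraph_update {V : Type} [DecidableEq V] (c : V → Option ℕ) (z : V) (i : Option ℕ) :
    labelGraph (Function.update c z i) = starGraph (fun v => (c v, corr i (c v))) z := by
  ext u v
  simp only [labelGraph, starGraph, corr, Function.update_apply, decide_eq_true_eq]
  by_cases hu : u = z <;> by_cases hv : v = z
  · subst hu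
    subst hv
    simp
  · subst hu
    simp only [if_true, hv, if_false, false_and, or_false, true_and, ne_eq,
      not_true_eq_false]
    constructor
    · rintro ⟨h, h'⟩
      refine ⟨h, ?_⟩
      rcases h' with h' | h'
      · exact Or.inl fun h => h' h.symm
      · by_cases hc : c v = none
        · exact Or.inr hc
        · left
          rw [h']
          exact hc
    · rintro ⟨h, h'⟩
      refine ⟨h, ?_⟩
      rcases h' with h' | h'
      · exact Or.inl fun h => h' h.symm
      · by_cases hc : i = none
        · exact Or.inr hc
        · left
          rw [h']
          exact hc
  · subst hv
    simp [hu]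
  · simp [hu, hv]

lemma starGraph_adj_star {V : Type} {c : V → Option ℕ} {N : V → Bool} {z v : V} (hv : v ≠ z) :
    (starGraph (fun v => (c v, N v)) z).Adj z v ↔ N v = true := by
  simp [starGraph, hv, hv.symm]

lemma dd_starGraph {V : Type} (c : V → Option ℕ) (N N' : V → Bool) {z u v : V} (hu : u ≠ z)
    (hv : v ≠ z) :
    dd (starGraph (fun v => (c v, N v)) z) (starGraph (fun v => (c v, N' v)) z) u v = 0 := by
  rw [dd_eq_zero]
  simp [starGraph, hu, hv]

/-- The graphs on a (Sym2) path are unchanged off `z`, so each is determined by the neighbourhood of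
`z`. -/
lemma eq_starGraph_of_induce_eq {V : Type} {c : V → Option ℕ} {N : V → Bool} {z : V}
    {K : SimpleGraph V}
    (h : K.induce {v | v ≠ z} = (starGraph (fun v => (c v, N v)) z).induce {v | v ≠ z}) :
    open Classical in K = starGraph (fun v => (c v, decide (K.Adj z v))) z := by
  classical
  ext u v
  by_cases hu : u = z
  · subst hu
    by_cases hv : v = u
    · subst hv
      simp
    · rw [starGraph_adj_star hv]
      simp
  · by_cases hv : v = z
    · subst hv
      rw [K.adj_comm, (starGraph _ _).adj_comm, starGraph_adj_star hu]
      simp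
    · have h1 : (K.induce {v | v ≠ z}).Adj ⟨u, hu⟩ ⟨v, hv⟩ ↔
          ((starGraph (fun v => (c v, N v)) z).induce {v | v ≠ z}).Adj ⟨u, hu⟩ ⟨v, hv⟩ := by
        rw [h]
      simp only [SimpleGraph.comap_adj, Function.Embedding.subtype_apply] at h1
      rw [h1]
      simp [starGraph, hu, hv]

lemma isCompleteMultipartite_induce_starGraph {V : Type} (c : V → Option ℕ) (N : V → Bool)
    (z : V) :
    ((starGraph (fun v => (c v, N v)) z).induce {v | v ≠ z}).IsCompleteMultipartite := by
  have : (starGraph (fun v => (c v, N v)) z).induce {v | v ≠ z} =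
      (labelGraph c).induce {v | v ≠ z} := by
    ext ⟨u, hu⟩ ⟨v, hv⟩
    have hu' : u ≠ z := hu
    have hv' : v ≠ z := hv
    simp [starGraph, labelGraph, hu', hv']
  rw [this]
  exact (isCompleteMultipartite_labelGraph c).induce

/-- Expresses the distance from part `i` through label densities, so that a lower bound on it passes
to limits. -/
lemma ddeg_star_le (c : V → Option ℕ) (N : V → Bool) (z : V) (i : Option ℕ) {A : Finset (Option ℕ)}
    (hA : ∀ v, c v ∈ A) :
    ddeg (starGraph (fun v => (c v, corr i (c v))) z) (starGraph (fun v => (c v, N v)) z) z ≤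
      Fintype.card V * ∑ l ∈ A, cdens (fun v => (c v, N v)) (l, !corr i l) := by
  classical
  have hn : (0 : ℝ) < Fintype.card V := by exact_mod_cast Fintype.card_pos_iff.2 ⟨z⟩
  rw [Finset.mul_sum]
  have e : ∀ l, (Fintype.card V : ℝ) * cdens (fun v => (c v, N v)) (l, !corr i l) =
      ∑ v, if (c v, N v) = (l, !corr i l) then (1 : ℝ) else 0 := by
    intro l
    rw [cdens_eq, mul_div_cancel₀ _ hn.ne', Finset.sum_boole]
  simp only [e]
  rw [Finset.sum_comm]
  refine Finset.sum_le_sum fun v _ => ?_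
  have h0 : ∀ l ∈ A, (0 : ℝ) ≤ if (c v, N v) = (l, !corr i l) then (1 : ℝ) else 0 := by
    intro l _
    split_ifs <;> simp
  by_cases hv : v = z
  · rw [hv, dd_self]
    rw [hv] at h0
    exact Finset.sum_nonneg h0
  by_cases hN : N v = corr i (c v)
  · rw [dd_eq_zero.2]
    · exact Finset.sum_nonneg h0
    · rw [starGraph_adj_star hv, starGraph_adj_star hv, hN]
  · refine (dd_le_one _ _ _ _).trans (le_trans ?_ (Finset.single_le_sum h0 (hA v)))
    rw [if_pos]
    rw [Prod.mk.injEq]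
    exact ⟨rfl, Bool.eq_not.2 hN⟩

end star

/-! ### Symmetrising the neighbourhood of one vertex. -/

section path

variable {k : ℕ} {Γ : SimpleGraph (Fin k) → ℝ}

/-- Symmetrising a vertex `z` that is far from all parts, we either keep the distance or stop at an
intermediate distance. -/
lemma exists_symmetrised_star (hΓ : IsoInvariant Γ) {n : ℕ} (hkn : k ≤ n) {S : Set (Option ℕ)}
    (c : Fin n → Option ℕ) (z : Fin n) (N : Fin n → Bool) {η : ℝ} (hη : 0 < η)
    (hsym : SymTwo Γ (η / 2) (starGraph (fun v => (c v, N v)) z))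
    (hfar : ∀ i ∈ S, η * n ≤ ddeg (starGraph (fun v => (c v, corr i (c v))) z)
      (starGraph (fun v => (c v, N v)) z) z) :
    ∃ N' : Fin n → Bool,
      dens Γ (starGraph (fun v => (c v, N v)) z) ≤ dens Γ (starGraph (fun v => (c v, N' v)) z) ∧
      (∀ i ∈ S, η * n ≤ ddeg (starGraph (fun v => (c v, corr i (c v))) z)
        (starGraph (fun v => (c v, N' v)) z) z) ∧
      ((∃ i ∈ S, ddeg (starGraph (fun v => (c v, corr i (c v))) z)
        (starGraph (fun v => (c v, N' v)) z) z ≤ 2 * η * n) ∨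
      ∀ u v (i : ℕ), u ≠ z → v ≠ z → c u = some i → c v = some i → N' u = N' v) := by
  classical
  have : Nonempty (Fin n) := ⟨z⟩
  have hcm := isCompleteMultipartite_induce_starGraph c N z
  obtain ⟨m, T, hT0, hTind, hTstep, hTend⟩ := hsym z hcm
  have hTeq : ∀ r ≤ m, T r = starGraph (fun v => (c v, decide ((T r).Adj z v))) z := fun r hr =>
    eq_starGraph_of_induce_eq (hTind r hr)
  have hmono : ∀ r ≤ m, dens Γ (T 0) ≤ dens Γ (T r) := by
    intro r
    induction r with
    | zero => exact fun _ => le_rfl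
    | succ r ih =>
      intro hr
      refine (ih (by omega)).trans ?_
      rw [← lam_le_lam_iff hΓ (by simpa using hkn)]
      exact (hTstep r (by omega)).1
  set P : ℕ → Prop := fun r => ∀ i ∈ S,
    η * n ≤ ddeg (starGraph (fun v => (c v, corr i (c v))) z) (T r) z with hP
  have hP0 : P 0 := by
    intro i hi
    rw [hT0]
    exact hfar i hi
  have build : ∀ r ≤ m, P r →
      ((∃ i ∈ S, ddeg (starGraph (fun v => (c v, corr i (c v))) z) (T r) z ≤ 2 * η * n) ∨
        ∀ u v (i : ℕ), u ≠ z → v ≠ z → c u = some i → c v = some i →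
          ((T r).Adj z u ↔ (T r).Adj z v)) → ∃ N' : Fin n → Bool,
      dens Γ (starGraph (fun v => (c v, N v)) z) ≤ dens Γ (starGraph (fun v => (c v, N' v)) z) ∧
      (∀ i ∈ S, η * n ≤ ddeg (starGraph (fun v => (c v, corr i (c v))) z)
        (starGraph (fun v => (c v, N' v)) z) z) ∧
      ((∃ i ∈ S, ddeg (starGraph (fun v => (c v, corr i (c v))) z)
        (starGraph (fun v => (c v, N' v)) z) z ≤ 2 * η * n) ∨
      ∀ u v (i : ℕ), u ≠ z → v ≠ z → c u = some i → c v = some i → N' u = N' v) := by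
    intro r hr hPr hor
    refine ⟨fun v => decide ((T r).Adj z v), ?_, ?_, ?_⟩
    · rw [← hTeq r hr, ← hT0]
      exact hmono r hr
    · rw [← hTeq r hr]
      exact hPr
    · rw [← hTeq r hr]
      refine hor.imp id fun h u v i hu hv hcu hcv => ?_
      simp only [decide_eq_decide]
      exact h u v i hu hv hcu hcv
  -- If all distances stay large to the end, the final neighbourhood respects the parts. Otherwise
  -- the last graph before one of them drops below `η * n` is used.
  by_cases hPm : P m
  · refine build m le_rfl hPm (Or.inr fun u v i hu hv hcu hcv => ?_)
    let u' : {v : Fin n | v ≠ z} := ⟨u, hu⟩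
    let v' : {v : Fin n | v ≠ z} := ⟨v, hv⟩
    have hclass : {w | hcm.setoid.r w u'} ∈ hcm.setoid.classes := Setoid.mem_classes _ u'
    have hu'mem : u' ∈ {w | hcm.setoid.r w u'} := hcm.setoid.refl u'
    have hv'mem : v' ∈ {w | hcm.setoid.r w u'} := by
      change ¬ ((starGraph (fun v => (c v, N v)) z).induce {v | v ≠ z}).Adj v' u'
      have hu2 : u ≠ z := hu
      have hv2 : v ≠ z := hv
      simp [u', v', starGraph, hcu, hcv, hu2, hv2]
    rcases hTend _ hclass with h | h
    · exact iff_of_true (h u' hu'mem) (h v' hv'mem)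
    · exact iff_of_false (h u' hu'mem) (h v' hv'mem)
  · have hex : ∃ r < m, P r ∧ ¬ P (r + 1) := by
      by_contra hcon
      push Not at hcon
      have : ∀ r ≤ m, P r := by
        intro r
        induction r with
        | zero => exact fun _ => hP0
        | succ r ih => exact fun hr => hcon r (by omega) (ih (by omega))
      exact hPm (this m le_rfl)
    obtain ⟨r, hr, hPr, hPr'⟩ := hex
    refine build r hr.le hPr (Or.inl ?_)
    simp only [hP] at hPr'
    push Not at hPr'
    obtain ⟨i, hi, hlt⟩ := hPr'
    refine ⟨i, hi, ?_⟩
    -- One step changes at most `η / 2 * (n - 1)` edges, counted twice in `dsize`, so the distance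
    -- just before the drop is at most `2 * η * n`.
    have h1 := ddeg_triangle (starGraph (fun v => (c v, corr i (c v))) z) (T (r + 1)) (T r) z
    have h2 := ddeg_le_dsize (T (r + 1)) (T r) z
    rw [dsize_comm, dsize_eq_edgeDiff] at h2
    have h3 := (hTstep r hr).2
    have h4 : (0 : ℝ) ≤ n := Nat.cast_nonneg n
    nlinarith

end path

end

end PartiteStability

namespace PartiteStability

noncomputable section

/-! ### Attachments and their distance from the parts. -/

section attach

/-- The label of the part to which the attachment `(e₁, 1)` adds a vertex. -/
def firstLabel (x : PartiteLimit) : Option ℕ := if 0 < x.part 0 then some 0 else none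

lemma firstLabel_mem (x : PartiteLimit) : firstLabel x ∈ x.suppStar := by
  unfold firstLabel
  split_ifs with h
  · exact h
  · have h0 : ∀ i, x.part i = 0 := fun i =>
      le_antisymm ((x.antitone_part (Nat.zero_le i)).trans (not_lt.1 h)) (x.part_nonneg i)
    simp [PartiteLimit.suppStar, PartiteLimit.weight, h0]

/-- The attachment function that agrees with membership of the part `i`. -/
def attachFun (i : Option ℕ) : ℕ → Bool := fun j => decide (some j ≠ i)

lemma corr_some (i : Option ℕ) (j : ℕ) : corr i (some j) = attachFun i j := by
  simp [corr, attachFun]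

/-- If the first part is empty then so are all others, and the Boolean function no longer matters:
the reference attachment is then a further universal vertex. -/
lemma attachWeight_firstLabel (x : PartiteLimit) :
    attachWeight x (attachFun (firstLabel x)) (1 : unitInterval) =
      attachWeight x eOne (1 : unitInterval) := by
  unfold firstLabel
  split_ifs with h
  · have : attachFun (some 0) = eOne := by
      funext j
      simp [attachFun, eOne]
    rw [this]
  · have h0 : ∀ i, x.part i = 0 := fun i =>
      le_antisymm ((x.antitone_part (Nat.zero_le i)).trans (not_lt.1 h)) (x.part_nonneg i)
    ext ⟨_ | i, β⟩
    · cases β <;> rfl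
    · simp [attachWeight, h0]

lemma tendsto_cdens_corr {ι : Type*} {l : Filter ι} {V : ι → Type} [∀ i, Fintype (V i)]
    {x : PartiteLimit} {c : ∀ i, V i → Option ℕ}
    (hc : ∀ a, Tendsto (fun i => cdens (c i) a) l (𝓝 (x.weight a))) (p : Option ℕ)
    (a : Option ℕ × Bool) :
    Tendsto (fun i => cdens (fun v => (c i v, corr p (c i v))) a) l
      (𝓝 (attachWeight x (attachFun p) (1 : unitInterval) a)) := by
  obtain ⟨q, β⟩ := a
  have h1 : corr p q = β → ∀ i, cdens (fun v => (c i v, corr p (c i v))) (q, β) =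
      cdens (c i) q := by
    intro h i
    refine cdens_congr fun v => ?_
    simp only [Prod.mk.injEq]
    refine ⟨fun h => h.1, fun h' => ⟨h', ?_⟩⟩
    rw [h', h]
  have h2 : corr p q ≠ β → ∀ i, cdens (fun v => (c i v, corr p (c i v))) (q, β) = 0 := by
    intro h i
    refine cdens_eq_zero fun v h' => h ?_
    simp only [Prod.mk.injEq] at h'
    rw [← h'.1]
    exact h'.2
  by_cases h : corr p q = β
  · simp only [h1 h]
    have : attachWeight x (attachFun p) (1 : unitInterval) (q, β) = x.weight q := by
      rcases q with _ | q
      · have : β = true := by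
          rw [← h]
          simp [corr]
        subst this
        simp [attachWeight]
      · rw [corr_some] at h
        simp [attachWeight, h, PartiteLimit.weight]
    rw [this]
    exact hc q
  · simp only [h2 h]
    have : attachWeight x (attachFun p) (1 : unitInterval) (q, β) = 0 := by
      rcases q with _ | q
      · have : β = false := by
          have h3 : corr p none = true := by simp [corr]
          rw [h3] at h
          simpa using Ne.symm h
        subst this
        simp [attachWeight]
      · rw [corr_some] at h
        simp [attachWeight, h]
    rw [this]
    exact tendsto_const_nhds

lemma editWeight_nonneg (x : PartiteLimit) (b : ℕ → Bool) (i : Option ℕ) :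
    0 ≤ editWeight x b i := by
  cases i with
  | none =>
    refine tsum_nonneg fun j => ?_
    split_ifs
    · exact le_rfl
    · exact x.part_nonneg j
  | some i =>
    refine add_nonneg ?_ (tsum_nonneg fun j => ?_)
    · split_ifs
      · exact x.part_nonneg i
      · exact le_rfl
    · split_ifs
      · exact le_rfl
      · exact x.part_nonneg j

/-- The weight of the labels at which an attachment differs from membership of the part `i`. -/
lemma sum_attachWeight_le (x : PartiteLimit) (b : ℕ → Bool) (α : unitInterval) (i : Option ℕ)
    (A : Finset (Option ℕ)) :
    ∑ l ∈ A, attachWeight x b α (l, !corr i l) ≤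
      (1 - (α : ℝ)) * x.weight none + editWeight x b i := by
  classical
  set f : Option ℕ → ℝ := fun l => attachWeight x b α (l, !corr i l) with hf
  have hf0 : ∀ l, 0 ≤ f l := fun l => attachWeight_nonneg x b α _
  have hnone : f none = (1 - (α : ℝ)) * x.weight none := by
    simp [hf, corr, attachWeight]
  have hle : ∀ j, f (some j) ≤ x.part j := by
    intro j
    simp only [hf, attachWeight]
    split_ifs
    · exact le_rfl
    · exact x.part_nonneg j
  have hs : Summable fun j : ℕ => f (some j) :=
    Summable.of_nonneg_of_le (fun j => hf0 _) hle x.summable_part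
  have h1 := sum_le_hasSum A (fun l _ => hf0 l) (hasSum_option hs.hasSum)
  refine h1.trans ?_
  rw [hnone, add_comm]
  gcongr
  cases i with
  | none =>
    refine le_of_eq (tsum_congr fun j => ?_)
    simp only [hf, corr_some, attachFun, attachWeight]
    cases b j <;> simp
  | some i =>
    have hsum2 : Summable fun j : ℕ => if j = i ∨ b j = true then 0 else x.part j := by
      refine Summable.of_nonneg_of_le (fun j => ?_) (fun j => ?_) x.summable_part
      · split_ifs
        · exact le_rfl
        · exact x.part_nonneg j
      · split_ifs
        · exact x.part_nonneg j
        · exact le_rfl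
    have h2 : (fun j : ℕ => f (some j)) = fun j =>
        (if j = i then (if b i = true then x.part i else 0) else 0) +
          if j = i ∨ b j = true then 0 else x.part j := by
      funext j
      simp only [hf, corr_some, attachFun, attachWeight]
      by_cases hj : j = i
      · subst hj
        cases b j <;> simp
      · cases b j <;> simp [hj]
    rw [h2, Summable.tsum_add (summable_of_ne_finset_zero (s := {i}) (by
      intro j hj
      rw [if_neg (by simpa using hj)])) hsum2, tsum_ite_eq]
    exact le_rfl

end attach

/-- The conditions on an optimal element that strictness provides. -/
structure LocallyStrict {k : ℕ} (Γ : SimpleGraph (Fin k) → ℝ) (x : PartiteLimit) (c₀ : ℝ) :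
    Prop where
  pos : 0 < c₀
  finite : x.suppStar.Finite
  flip : ∀ i ∈ x.suppStar, ∀ j ∈ x.suppStar, c₀ ≤ flipMean Γ x.weight i j
  attach : ∀ (b : ℕ → Bool) (α : unitInterval),
    c₀ * ((1 - (α : ℝ)) * x.weight none + ⨅ i : x.suppStar, editWeight x b i) ≤
      starMean Γ (attachWeight x eOne (1 : unitInterval)) - starMean Γ (attachWeight x b α)

/-! ### The gain from correcting one vertex. -/

section gain

variable {k : ℕ} {Γ : SimpleGraph (Fin k) → ℝ}

/-- Class-respecting labelings converge to an attachment. -/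
lemma exists_attachWeight_of_classes {ι : Type*} (𝓤 : Ultrafilter ι) {n : ι → ℕ}
    (hn : Tendsto n 𝓤 atTop) {x : PartiteLimit} {c : ∀ j, Fin (n j) → Option ℕ}
    {z : ∀ j, Fin (n j)} {N : ∀ j, Fin (n j) → Bool}
    (hcl : ∀ᶠ j in (𝓤 : Filter ι), ∀ u v (i : ℕ), u ≠ z j → v ≠ z j → c j u = some i →
      c j v = some i → N j u = N j v)
    {w : Option ℕ × Bool → ℝ}
    (hw : ∀ a, Tendsto (fun j => cdens (fun v => (c j v, N j v)) a) 𝓤 (𝓝 (w a)))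
    (hw0 : ∀ a, 0 ≤ w a) (hsum : ∀ i, w (i, true) + w (i, false) = x.weight i) :
    ∃ (b : ℕ → Bool) (α : unitInterval), w = attachWeight x b α := by
  classical
  have hn1 : Tendsto (fun j => 1 / (n j : ℝ)) 𝓤 (𝓝 0) :=
    (tendsto_natCast_atTop_atTop.comp hn).const_div_atTop 1
  -- The vertex `z` itself may violate the pattern, but it contributes only `1 / n` to the density.
  have hone : ∀ (i : ℕ) (β : Bool),
      (∀ᶠ j in (𝓤 : Filter ι), ∀ v, v ≠ z j → c j v = some i → N j v = !β) →
        w (some i, β) = 0 := by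
    intro i β h
    refine le_antisymm (le_of_tendsto_of_tendsto (hw (some i, β)) hn1 ?_) (hw0 _)
    filter_upwards [h] with j hj
    rw [cdens_eq, Fintype.card_fin]
    refine div_le_div_of_nonneg_right ?_ (Nat.cast_nonneg _)
    have : (Finset.univ.filter fun v => (c j v, N j v) = (some i, β)) ⊆ {z j} := by
      intro v hv
      simp only [Finset.mem_filter, Finset.mem_univ, true_and, Prod.mk.injEq] at hv
      rw [Finset.mem_singleton]
      by_contra hne
      have := hj v hne hv.1
      rw [hv.2] at this
      cases β <;> simp at this
    have := Finset.card_le_card this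
    rw [Finset.card_singleton] at this
    exact_mod_cast this
  -- If there is no universal weight the quotient is zero by convention, which is harmless because
  -- then both weights at `none` vanish.
  have hα : w (none, true) / x.weight none ∈ Set.Icc (0 : ℝ) 1 := by
    refine ⟨div_nonneg (hw0 _) (x.weight_nonneg _), div_le_one_of_le₀ ?_ (x.weight_nonneg _)⟩
    have := hsum none
    linarith [hw0 (none, false)]
  -- The ultrafilter decides for each part whether the centre is joined to it. If not, some vertex
  -- of the part is a non-neighbour and class-respect spreads this to the whole part.
  obtain ⟨b, hb⟩ : ∃ b : ℕ → Bool, ∀ i, b i = true ↔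
      ∀ᶠ j in (𝓤 : Filter ι), ∀ v, v ≠ z j → c j v = some i → N j v = true :=
    ⟨fun i => decide _, fun i => decide_eq_true_iff⟩
  refine ⟨b, ⟨_, hα⟩, ?_⟩
  ext ⟨_ | i, β⟩
  · have h1 : w (none, true) / x.weight none * x.weight none = w (none, true) := by
      by_cases h0 : x.weight none = 0
      · have := hsum none
        have h2 := hw0 (none, true)
        have h3 := hw0 (none, false)
        rw [h0, mul_zero]
        linarith
      · exact div_mul_cancel₀ _ h0
    cases β
    · simp only [attachWeight]
      rw [sub_mul, h1, one_mul, ← hsum none]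
      ring
    · simp only [attachWeight]
      rw [h1]
  · simp only [attachWeight]
    have hs := hsum (some i)
    simp only [PartiteLimit.weight] at hs
    by_cases h : ∀ᶠ j in (𝓤 : Filter ι), ∀ v, v ≠ z j → c j v = some i → N j v = true
    · have h0 := hone i false (by simpa using h)
      have hbi := (hb i).2 h
      cases β
      · simp [h0, hbi]
      · simp only [hbi, if_true]
        linarith
    · have h' := Ultrafilter.eventually_not.2 h
      have h0 := hone i true (by
        filter_upwards [h', hcl] with j h1 h2 v hv hcv
        push Not at h1
        obtain ⟨u, hu, hcu, hNu⟩ := h1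
        rw [h2 v u i hv hu hcv hcu]
        simpa using hNu)
      have hbi : b i = false := by
        rw [← Bool.not_eq_true, hb i]
        exact h
      cases β
      · simp only [hbi]
        simp
        linarith
      · simp [h0, hbi]

lemma nearLabel_update {x : PartiteLimit} {δ : ℝ} {n : ℕ} {c : Fin n → Option ℕ}
    (hc : NearLabel x δ c) (z : Fin n) {i : Option ℕ} (hi : i ∈ x.suppStar) :
    NearLabel x (δ + 1 / n) (Function.update c z i) := by
  classical
  have hn : (0 : ℝ) < n := by exact_mod_cast Fin.pos z
  refine ⟨fun v => ?_, fun l => ?_⟩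
  · by_cases hv : v = z
    · subst hv
      simpa using hi
    · rw [Function.update_of_ne hv]
      exact hc.1 v
  · have h1 : |cdens (Function.update c z i) l - cdens c l| ≤ 1 / n := by
      have key : ∀ c c' : Fin n → Option ℕ, (∀ v, v ≠ z → c v = c' v) →
          cdens c l - cdens c' l ≤ 1 / n := by
        intro c c' h
        rw [cdens_eq, cdens_eq, ← sub_div, Fintype.card_fin]
        refine div_le_div_of_nonneg_right ?_ hn.le
        have hsub : (Finset.univ.filter fun v => c v = l) ⊆
            insert z (Finset.univ.filter fun v => c' v = l) := by
          intro v hv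
          by_cases hvz : v = z
          · exact Finset.mem_insert.2 (Or.inl hvz)
          · refine Finset.mem_insert_of_mem ?_
            simp only [Finset.mem_filter, Finset.mem_univ, true_and] at hv ⊢
            rw [← h v hvz]
            exact hv
        have h2 := (Finset.card_le_card hsub).trans (Finset.card_insert_le _ _)
        have h3 : ((Finset.univ.filter fun v => c v = l).card : ℝ) ≤
            (Finset.univ.filter fun v => c' v = l).card + 1 := by exact_mod_cast h2
        linarith
      rw [abs_le]
      have k1 := key (Function.update c z i) c fun v hv => Function.update_of_ne hv _ _
      have k2 := key c (Function.update c z i) fun v hv => (Function.update_of_ne hv _ _).symm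
      constructor <;> linarith
    have h2 := hc.2 l
    have h3 := abs_sub_le (cdens (Function.update c z i) l) (cdens c l) (x.weight l)
    linarith

/-- A vertex whose neighbourhood is far from those of all parts can be improved. -/
lemma exists_star_gain (hΓ : IsoInvariant Γ) (hsym : Symmetrisable Γ) {x : PartiteLimit} {c₀ : ℝ}
    (hx : LocallyStrict Γ x c₀) {η : ℝ} (hη : 0 < η) :
    ∃ κ : ℝ, 0 < κ ∧ ∃ δ : ℝ, 0 < δ ∧ ∃ n₀ : ℕ, ∀ n, n₀ ≤ n → ∀ c : Fin n → Option ℕ,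
      NearLabel x δ c → ∀ (z : Fin n) (N : Fin n → Bool),
        (∀ i ∈ x.suppStar, η * n ≤ ddeg (starGraph (fun v => (c v, corr i (c v))) z)
          (starGraph (fun v => (c v, N v)) z) z) →
        κ ≤ n * (dens Γ (starGraph (fun v => (c v, corr (firstLabel x) (c v))) z) -
          dens Γ (starGraph (fun v => (c v, N v)) z)) := by
  classical
  have hc₀ := hx.pos
  have hb := bd_nonneg Γ
  set C := 12 * bd Γ * (k : ℝ) ^ 4 with hC
  have hC0 : 0 ≤ C := by positivity
  -- This threshold makes the error for degrees up to `2 * η₁ * n` at most half of the flip loss `c₀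
  -- / 2`.
  set η₁ := min η (c₀ / (8 * (C + 1))) with hη₁
  have hη₁0 : 0 < η₁ := lt_min hη (by positivity)
  have hη₁C : C * (2 * η₁) ≤ c₀ / 4 := by
    have h1 : η₁ ≤ c₀ / (8 * (C + 1)) := min_le_right _ _
    have h2 : C * (2 * η₁) ≤ C * (2 * (c₀ / (8 * (C + 1)))) :=
      mul_le_mul_of_nonneg_left (by linarith) hC0
    refine h2.trans ?_
    rw [mul_div_assoc', mul_div_assoc', div_le_div_iff₀ (by positivity) (by norm_num)]
    nlinarith
  by_contra hcon
  push Not at hcon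
  have h' := fun j : ℕ => hcon (1 / ((j : ℝ) + 1)) (by positivity) (1 / ((j : ℝ) + 1))
    (by positivity) j
  choose n hn c hnear z N hfar hlt using h'
  set 𝓤 : Ultrafilter ℕ := Ultrafilter.of atTop
  have h𝓤 : (𝓤 : Filter ℕ) ≤ atTop := Ultrafilter.of_le _
  have hn' : Tendsto n 𝓤 atTop := (tendsto_atTop_mono hn tendsto_id).mono_left h𝓤
  have hδ : Tendsto (fun j : ℕ => 1 / ((j : ℝ) + 1)) 𝓤 (𝓝 0) :=
    tendsto_one_div_add_atTop_nhds_zero_nat.mono_left h𝓤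
  have hcd := tendsto_cdens_of_nearLabel hδ hnear
  have hcard := tendsto_card_fin hn'
  have hnr : Tendsto (fun j => (n j : ℝ)) 𝓤 atTop := tendsto_natCast_atTop_atTop.comp hn'
  -- replace the neighbourhoods by symmetrised ones
  obtain ⟨n₁, -, hn₁⟩ := hsym (η₁ / 2) (by positivity)
  have hex : ∀ j, ∃ N' : Fin (n j) → Bool, max n₁ k ≤ n j →
      dens Γ (starGraph (fun v => (c j v, N j v)) (z j)) ≤
        dens Γ (starGraph (fun v => (c j v, N' v)) (z j)) ∧
      (∀ i ∈ x.suppStar, η₁ * n j ≤ ddeg (starGraph (fun v => (c j v, corr i (c j v))) (z j))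
        (starGraph (fun v => (c j v, N' v)) (z j)) (z j)) ∧
      ((∃ i ∈ x.suppStar, ddeg (starGraph (fun v => (c j v, corr i (c j v))) (z j))
        (starGraph (fun v => (c j v, N' v)) (z j)) (z j) ≤ 2 * η₁ * n j) ∨
      ∀ u v (i : ℕ), u ≠ z j → v ≠ z j → c j u = some i → c j v = some i → N' u = N' v) := by
    intro j
    by_cases hj : max n₁ k ≤ n j
    · obtain ⟨N', hN'⟩ := exists_symmetrised_star hΓ ((le_max_right _ _).trans hj)
        (S := x.suppStar) (c j) (z j) (N j) hη₁0 (hn₁ (n j) ((le_max_left _ _).trans hj) _).2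
        (fun i hi => (mul_le_mul_of_nonneg_right (min_le_left _ _)
          (Nat.cast_nonneg _)).trans (hfar j i hi))
      exact ⟨N', fun _ => hN'⟩
    · exact ⟨N j, fun h => absurd h hj⟩
  choose N' hN' using hex
  have hev : ∀ᶠ j in (𝓤 : Filter ℕ), max n₁ k ≤ n j := hn'.eventually_ge_atTop _
  -- limits of the label densities
  have hlim : ∀ a : Option ℕ × Bool, ∃ y : ℝ,
      Tendsto (fun j => cdens (fun v => (c j v, N' j v)) a) 𝓤 (𝓝 y) := by
    intro a
    have hmem : (𝓤.map fun j => cdens (fun v => (c j v, N' j v)) a : Filter ℝ) ≤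
        𝓟 (Set.Icc 0 1) := by
      rw [le_principal_iff]
      exact Filter.mem_map.2 (Filter.univ_mem' fun i => ⟨cdens_nonneg _ _, cdens_le_one _ _⟩)
    obtain ⟨y, -, hy⟩ := isCompact_Icc.ultrafilter_le_nhds _ hmem
    exact ⟨y, hy⟩
  choose w hw using hlim
  have hw0 : ∀ a, 0 ≤ w a := fun a => ge_of_tendsto' (hw a) fun j => cdens_nonneg _ _
  have hsum : ∀ i, w (i, true) + w (i, false) = x.weight i := by
    intro i
    refine tendsto_nhds_unique (((hw (i, true)).add (hw (i, false))).congr fun j => ?_) (hcd i)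
    exact cdens_true_add_false (fun v => (c j v, N' j v)) i
  have hw1 : HasSum w 1 := hasSum_prod_bool hw0 x.hasSum_weight hsum
  have hstar : ∀ p, Tendsto (fun j => (n j : ℝ) *
      (dens Γ (starGraph (fun v => (c j v, corr p (c j v))) (z j)) -
        dens Γ (starGraph (fun v => (c j v, N' j v)) (z j)))) 𝓤
      (𝓝 (starMean Γ (attachWeight x (attachFun p) (1 : unitInterval)) - starMean Γ w)) := by
    intro p
    have := tendsto_star_sub Γ (attachWeight_nonneg x (attachFun p) 1)
      (hasSum_attachWeight x (attachFun p) 1) hw0 hw1 hcard (tendsto_cdens_corr hcd p) hw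
      (fun j v => rfl) z
    simpa only [Fintype.card_fin] using this
  -- The counterexamples have vanishing gain, and symmetrising only increases the density of the
  -- competitor.
  have hle : starMean Γ (attachWeight x eOne (1 : unitInterval)) - starMean Γ w ≤ 0 := by
    have h1 := hstar (firstLabel x)
    rw [attachWeight_firstLabel] at h1
    refine le_of_tendsto_of_tendsto h1 hδ ?_
    filter_upwards [hev] with j hj
    have h2 := (hN' j hj).1
    refine le_trans ?_ (hlt j).le
    exact mul_le_mul_of_nonneg_left (by linarith) (Nat.cast_nonneg _)
  have hor : (∀ᶠ j in (𝓤 : Filter ℕ), ∃ i ∈ x.suppStar,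
      ddeg (starGraph (fun v => (c j v, corr i (c j v))) (z j))
        (starGraph (fun v => (c j v, N' j v)) (z j)) (z j) ≤ 2 * η₁ * n j) ∨
      ∀ᶠ j in (𝓤 : Filter ℕ), ∀ u v (i : ℕ), u ≠ z j → v ≠ z j → c j u = some i →
        c j v = some i → N' j u = N' j v := by
    rw [← Ultrafilter.eventually_or]
    filter_upwards [hev] with j hj
    exact (hN' j hj).2.2
  have hne : Nonempty x.suppStar := ⟨⟨_, firstLabel_mem x⟩⟩
  rcases hor with hloc | hcl
  -- Stopped case: the neighbourhood differs from that of part `i` in between `η₁ * n` and `2 * η₁ *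
  -- n` places, few enough for (Str1) to bound the loss linearly.
  · rw [Ultrafilter.eventually_exists_mem_iff hx.finite] at hloc
    obtain ⟨i, hi, hloc⟩ := hloc
    obtain ⟨δ₂, hδ₂, n₂, hn₂⟩ := exists_uniform_flip hx.finite (half_lt_self hc₀) hx.flip
    have hgain : c₀ * η₁ / 4 ≤
        starMean Γ (attachWeight x (attachFun i) (1 : unitInterval)) - starMean Γ w := by
      refine ge_of_tendsto (hstar i) ?_
      have hδ' : Tendsto (fun j : ℕ => 1 / ((j : ℝ) + 1) + 1 / (n j : ℝ)) 𝓤 (𝓝 0) := by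
        have := hδ.add (hnr.const_div_atTop 1)
        simpa using this
      filter_upwards [hev, hloc, hδ'.eventually (gt_mem_nhds hδ₂), hn'.eventually_ge_atTop n₂,
        -- The order is large enough that the degree one at other vertices and the total size also
        -- meet the bounds for `2 * η₁`.
        hnr.eventually_ge_atTop (1 / (2 * η₁)), hn'.eventually_ge_atTop 2] with j h1 h2 h3 h4 h5 h6
      have : Nonempty (Fin (n j)) := ⟨z j⟩
      have hnj : (2 : ℝ) ≤ n j := by exact_mod_cast h6
      have hnl : NearLabel x δ₂ (Function.update (c j) (z j) i) := by
        have h7 := nearLabel_update (hnear j) (z j) hi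
        exact ⟨h7.1, fun l => (h7.2 l).trans h3.le⟩
      have hfl := hn₂ (n j) h4 _ hnl
      rw [labelGraph_update] at hfl
      set F := starGraph (fun v => (c j v, corr i (c j v))) (z j) with hF
      set H := starGraph (fun v => (c j v, N' j v)) (z j) with hH
      have hdd : ∀ u v, u ≠ z j → v ≠ z j → dd F H u v = 0 := fun u v hu hv =>
        dd_starGraph (c j) _ _ hu hv
      have hds := dsize_eq_of_star hdd
      have hlow := (hN' j h1).2.1 i hi
      have h8 : 1 ≤ 2 * η₁ * n j := by
        rw [div_le_iff₀ (by positivity)] at h5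
        linarith
      have h9 := le_dens_sub_of_flips (Γ := Γ) (F := F) (c := c₀ / 2) (η := 2 * η₁)
        (by simpa only [Fintype.card_fin] using hfl) H
        (fun u => by
          rw [Fintype.card_fin]
          by_cases hu : u = z j
          · rw [hu]
            exact h2
          · rw [ddeg_eq_of_star hdd hu]
            exact (dd_le_one _ _ _ _).trans h8)
        (by
          rw [hds, Fintype.card_fin]
          nlinarith)
      rw [Fintype.card_fin, hds, ← hC] at h9
      have h10 : c₀ / 4 ≤ c₀ / 2 - C * (2 * η₁) := by linarith
      have h11 : 0 < (n j : ℝ) := by linarith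
      have h12 : c₀ / 4 * (η₁ * n j) ≤ (n j : ℝ) ^ 2 * (dens Γ F - dens Γ H) := by
        refine le_trans ?_ h9
        have h13 : η₁ * n j ≤ 2 * ddeg F H (z j) / 2 := by linarith
        exact mul_le_mul h10 h13 (by positivity) (by linarith)
      have h14 : (n j : ℝ) * (c₀ * η₁ / 4) ≤ n j * (n j * (dens Γ F - dens Γ H)) := by
        nlinarith
      exact le_of_mul_le_mul_left h14 h11
    -- Here (Str2) is used only to see that the reference attachment is at least as good as joining
    -- part `i`.
    have hatt := hx.attach (attachFun i) 1
    have hinf : 0 ≤ ⨅ p : x.suppStar, editWeight x (attachFun i) p :=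
      Real.iInf_nonneg fun p => editWeight_nonneg x _ _
    have h0 : 0 ≤ c₀ * ((1 - ((1 : unitInterval) : ℝ)) * x.weight none +
        ⨅ p : x.suppStar, editWeight x (attachFun i) p) := by
      refine mul_nonneg hc₀.le (add_nonneg ?_ hinf)
      simp
    have : 0 < c₀ * η₁ / 4 := by positivity
    linarith
  -- Class-respecting case: the limit is an attachment at distance at least `η₁` from every part, so
  -- (Str2) gives a fixed gain.
  · obtain ⟨b, α, rfl⟩ := exists_attachWeight_of_classes 𝓤 hn' hcl hw hw0 hsum
    have hfar' : ∀ i ∈ x.suppStar,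
        η₁ ≤ (1 - (α : ℝ)) * x.weight none + editWeight x b i := by
      intro i hi
      refine le_trans ?_ (sum_attachWeight_le x b α i hx.finite.toFinset)
      have t := tendsto_finsetSum hx.finite.toFinset fun l _ => hw (l, !corr i l)
      refine ge_of_tendsto t ?_
      filter_upwards [hev, hn'.eventually_ge_atTop 1] with j h1 h2
      have hnj : (0 : ℝ) < n j := by exact_mod_cast h2
      have h3 := ddeg_star_le (c j) (N' j) (z j) i (A := hx.finite.toFinset)
        (fun v => by simpa using (hnear j).1 v)
      have h4 := (hN' j h1).2.1 i hi
      rw [Fintype.card_fin] at h3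
      have h5 := h4.trans h3
      rw [mul_comm] at h5
      exact le_of_mul_le_mul_left h5 hnj
    have hinf : η₁ - (1 - (α : ℝ)) * x.weight none ≤ ⨅ i : x.suppStar, editWeight x b i :=
      le_ciInf fun i => by linarith [hfar' i.1 i.2]
    have hatt := hx.attach b α
    have h1 : c₀ * η₁ ≤ c₀ * ((1 - (α : ℝ)) * x.weight none +
        ⨅ i : x.suppStar, editWeight x b i) :=
      mul_le_mul_of_nonneg_left (by linarith) hc₀.le
    have : 0 < c₀ * η₁ := by positivity
    linarith

end gain

end

end PartiteStability

namespace PartiteStability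

noncomputable section

/-! ### Graphs close to an optimal realisation -/

lemma locallyStrict_of_strictWith {k : ℕ} (hk : 0 < k) {Γ : SimpleGraph (Fin k) → ℝ}
    (hΓ : IsoInvariant Γ) {c₀ : ℝ} (hc₀ : 0 < c₀) (hstrict : StrictWith Γ c₀) {x : PartiteLimit}
    (hx : x ∈ OPT Γ) : LocallyStrict Γ x c₀ := by
  obtain ⟨h1, h2⟩ := hstrict x hx
  have hm := firstLabel_mem x
  have hk2 : 2 ≤ k := two_le_of_flipLossLimit_pos hk (hc₀.trans_le (h1 _ hm _ hm))
  have hflip : ∀ i ∈ x.suppStar, ∀ j ∈ x.suppStar, c₀ ≤ flipMean Γ x.weight i j :=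
    fun i hi j hj => le_flipMean hΓ hk2 x hi hj hc₀.le (h1 i hi j hj)
  refine ⟨hc₀, finite_suppStar hc₀ hflip, hflip, fun b α => ?_⟩
  refine le_starMean_sub hΓ hk x b α (mul_nonneg hc₀.le (add_nonneg ?_ ?_)) (h2 b α)
  · exact mul_nonneg (by linarith [α.2.2]) (x.weight_nonneg none)
  · exact Real.iInf_nonneg fun p => editWeight_nonneg x _ _

/-- A part of weight zero is empty in every realisation, because the rounding error is strictly less
than one or the threshold two is not met. -/
lemma mem_suppStar_of_isRealisation {x : PartiteLimit} {n : ℕ} {c : Fin n → Option ℕ}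
    (hc : IsRealisation x c) (v : Fin n) : c v ∈ x.suppStar := by
  have hv : v ∈ labelClass c (c v) := by simp [labelClass]
  have hpos : 0 < (labelClass c (c v)).card := Finset.card_pos.2 ⟨v, hv⟩
  by_cases h0 : x.weight none = 0
  · obtain ⟨h1, h2⟩ := hc.1 h0
    rcases hcv : c v with _ | i
    · rw [hcv, h1] at hpos
      simp at hpos
    · rw [hcv] at hpos
      have h3 : (1 : ℝ) ≤ (labelClass c (some i)).card := by exact_mod_cast hpos
      by_contra hcon
      have h4 : x.part i = 0 := le_antisymm (not_lt.1 hcon) (x.part_nonneg i)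
      have h5 := h2 i
      rw [h4, zero_mul, sub_zero, abs_lt] at h5
      linarith
  · rcases hcv : c v with _ | i
    · exact lt_of_le_of_ne (x.weight_nonneg none) (Ne.symm h0)
    · rw [hcv, hc.2 h0 i] at hpos
      split_ifs at hpos with h
      · by_contra hcon
        have h4 : x.part i = 0 := le_antisymm (not_lt.1 hcon) (x.part_nonneg i)
        rw [h4] at h
        norm_num at h
      · simp at hpos

/-- Uniform over all labels by finiteness of the support, and over all admissible choices of the
realisation. -/
lemma exists_nearLabel_of_isRealisation {x : PartiteLimit} (hx : x.suppStar.Finite) {δ : ℝ}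
    (hδ : 0 < δ) :
    ∃ n₀ : ℕ, ∀ n, n₀ ≤ n → ∀ c : Fin n → Option ℕ, IsRealisation x c → NearLabel x δ c := by
  by_contra hcon
  push Not at hcon
  choose n hn c hc hnot using hcon
  have hl : ∀ j, ∃ l ∈ x.suppStar, δ < |cdens (c j) l - x.weight l| := by
    intro j
    by_contra h
    push Not at h
    refine hnot j ⟨mem_suppStar_of_isRealisation (hc j), fun l => ?_⟩
    by_cases hl : l ∈ x.suppStar
    · exact h l hl
    · have h1 : x.weight l = 0 := le_antisymm (not_lt.1 hl) (x.weight_nonneg l)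
      have h2 : cdens (c j) l = 0 := cdens_eq_zero fun v hv =>
        hl (hv ▸ mem_suppStar_of_isRealisation (hc j) v)
      rw [h1, h2]
      simpa using hδ.le
  choose l hl hlt using hl
  obtain ⟨a, -, ha⟩ := exists_eventually_eq_of_finite (Ultrafilter.of atTop) hx hl
  have hn' : Tendsto n (Ultrafilter.of atTop : Ultrafilter ℕ) atTop :=
    (tendsto_atTop_mono hn tendsto_id).mono_left (Ultrafilter.of_le _)
  have ht := tendsto_cdens_of_isRealisation hn' x hc a
  have := ((tendsto_order.1 ((ht.sub_const (x.weight a)).abs)).2 δ (by simpa using hδ))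
  obtain ⟨j, h1, h2⟩ := (ha.and this).exists
  have := hlt j
  rw [h1] at this
  linarith

/-- The graph that agrees with `L` at all pairs meeting `T`, and with `H` elsewhere. -/
def blend {V : Type} (L H : SimpleGraph V) (T : Finset V) : SimpleGraph V where
  Adj u v := (u ∈ T ∨ v ∈ T) ∧ L.Adj u v ∨ ¬ (u ∈ T ∨ v ∈ T) ∧ H.Adj u v
  symm.symm u v h := by
    rw [or_comm (a := v ∈ T), L.adj_comm, H.adj_comm]
    exact h
  loopless.irrefl u h := by
    rcases h with h | h
    · exact L.irrefl h.2
    · exact H.irrefl h.2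

/-! ### Replacing the pairs at a set of vertices. -/

section blend

variable {V : Type} {L H : SimpleGraph V} {T : Finset V}

lemma dd_congr {V V' : Type} {G H : SimpleGraph V} {G' H' : SimpleGraph V'} {u v : V} {u' v' : V'}
    (h : G.Adj u v ↔ G'.Adj u' v')
    (h' : H.Adj u v ↔ H'.Adj u' v') : dd G H u v = dd G' H' u' v' := by
  unfold dd
  congr 1
  rw [h, h']

lemma blend_adj_of_mem {u v : V} (h : u ∈ T ∨ v ∈ T) : (blend L H T).Adj u v ↔ L.Adj u v := by
  simp only [blend, h, true_and, not_true_eq_false, false_and, or_false]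

lemma blend_adj_of_notMem {u v : V} (hu : u ∉ T) (hv : v ∉ T) :
    (blend L H T).Adj u v ↔ H.Adj u v := by
  simp only [blend, hu, hv, false_and, or_self, not_false_eq_true, true_and, false_or]

lemma blend_empty : blend L H ∅ = H := by
  ext u v
  exact blend_adj_of_notMem (by simp) (by simp)

lemma dd_blend_left_le (u v : V) : dd (blend L H T) L u v ≤ dd H L u v := by
  by_cases h : u ∈ T ∨ v ∈ T
  · rw [dd_eq_zero.2 (blend_adj_of_mem h)]
    exact dd_nonneg _ _ _ _
  · push Not at h
    exact (dd_congr (blend_adj_of_notMem h.1 h.2) Iff.rfl).le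

variable [Fintype V]

lemma ddeg_blend_le (u : V) : ddeg (blend L H T) L u ≤ ddeg H L u :=
  Finset.sum_le_sum fun v _ => dd_blend_left_le u v

lemma ddeg_blend_of_mem {u : V} (hu : u ∈ T) : ddeg (blend L H T) L u = 0 :=
  Finset.sum_eq_zero fun _ _ => dd_eq_zero.2 (blend_adj_of_mem (Or.inl hu))

lemma ddeg_blend_right_le {u : V} (hu : u ∉ T) : ddeg H (blend L H T) u ≤ T.card := by
  classical
  calc ddeg H (blend L H T) u ≤ ∑ v, if v ∈ T then (1 : ℝ) else 0 := by
        refine Finset.sum_le_sum fun v _ => ?_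
        split_ifs with hv
        · exact dd_le_one _ _ _ _
        · rw [dd_eq_zero.2 (blend_adj_of_notMem hu hv).symm]
    _ = T.card := by simp

lemma dsize_blend_right_le : dsize H (blend L H T) ≤ 2 * Fintype.card V * T.card := by
  classical
  have h : ∀ u v, dd H (blend L H T) u v ≤
      (if u ∈ T then 1 else 0) + (if v ∈ T then 1 else 0) := by
    intro u v
    by_cases hu : u ∈ T
    · have := dd_le_one H (blend L H T) u v
      split_ifs <;> linarith
    · by_cases hv : v ∈ T
      · have := dd_le_one H (blend L H T) u v
        simp [hu, hv, this]
      · rw [dd_eq_zero.2 (blend_adj_of_notMem hu hv).symm]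
        simp [hu, hv]
  calc dsize H (blend L H T) ≤
        ∑ u : V, ∑ v : V, (((if u ∈ T then 1 else 0) + (if v ∈ T then 1 else 0) : ℝ)) :=
        Finset.sum_le_sum fun u _ => Finset.sum_le_sum fun v _ => h u v
    _ = 2 * Fintype.card V * T.card := by
        simp only [Finset.sum_add_distrib, Finset.sum_const, Finset.sum_boole, Finset.card_univ,
          nsmul_eq_mul, Finset.filter_mem_eq_inter, Finset.univ_inter, ← Finset.mul_sum]
        ring

end blend

section gain

variable {k : ℕ} {Γ : SimpleGraph (Fin k) → ℝ}

/-- The vertices of `T` are corrected one at a time. As the current graph remains close to the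
complete partite one, the gain of each correction is almost that obtained when all other pairs are
already correct, and half of `κ` survives. -/
lemma le_dens_blend_sub {n : ℕ} [Nonempty (Fin n)] {c : Fin n → Option ℕ} {S : Set (Option ℕ)}
    {η κ : ℝ} {H : SimpleGraph (Fin n)} {B : Finset (Fin n)}
    (hgain : ∀ z ∈ B, ∀ N : Fin n → Bool,
      (∀ i ∈ S, η * n ≤ ddeg (starGraph (fun v => (c v, corr i (c v))) z)
        (starGraph (fun v => (c v, N v)) z) z) →
      κ ≤ n * (dens Γ (labelGraph c) - dens Γ (starGraph (fun v => (c v, N v)) z)))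
    (hfar : ∀ z ∈ B, ∀ i ∈ S, η * n + B.card ≤ ddeg (labelGraph (Function.update c z i)) H z)
    (hsmall : 4 * bd Γ * (k : ℝ) ^ 3 * (dsize H (labelGraph c) / (n : ℝ) ^ 2) ≤ κ / 2)
    {T : Finset (Fin n)} (hT : T ⊆ B) :
    κ / 2 * T.card ≤ n * (dens Γ (blend (labelGraph c) H T) - dens Γ H) := by
  classical
  have hb := bd_nonneg Γ
  have hn : (0 : ℝ) < n := by
    have := Fintype.card_pos (α := Fin n)
    rw [Fintype.card_fin] at this
    exact_mod_cast this
  induction T using Finset.induction_on with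
  | empty => simp [blend_empty]
  | insert z T hz ih =>
    have ih' := ih ((Finset.subset_insert z T).trans hT)
    have hzB : z ∈ B := hT (Finset.mem_insert_self z T)
    have hTB : (T.card : ℝ) ≤ B.card := by
      exact_mod_cast Finset.card_le_card ((Finset.subset_insert z T).trans hT)
    set L := labelGraph c with hL
    set K := blend L H T with hK
    set N : Fin n → Bool := fun v => decide (K.Adj z v) with hN
    have hstar : ∀ v, (starGraph (fun v => (c v, N v)) z).Adj z v ↔ K.Adj z v := by
      intro v
      by_cases hv : v = z
      · rw [hv]
        simp
      · rw [starGraph_adj_star hv, hN, decide_eq_true_eq]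
    have hstar' : ∀ v, (starGraph (fun v => (c v, N v)) z).Adj v z ↔ K.Adj v z := by
      intro v
      rw [SimpleGraph.adj_comm, hstar, SimpleGraph.adj_comm]
    have hoff : ∀ u v, u ≠ z → v ≠ z →
        ((starGraph (fun v => (c v, N v)) z).Adj u v ↔ L.Adj u v) := by
      intro u v hu hv
      simp [starGraph, hL, labelGraph, hu, hv]
    have h1 : κ ≤ n * (dens Γ L - dens Γ (starGraph (fun v => (c v, N v)) z)) := by
      refine hgain z hzB N fun i hi => ?_
      have h2 := hfar z hzB i hi
      have h3 := ddeg_triangle (labelGraph (Function.update c z i)) K H z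
      -- Earlier corrections change the neighbourhood of `z` in at most `T.card` places, for which
      -- the summand `B.card` in `hfar` makes room.
      have h4 : ddeg K H z ≤ T.card := by
        rw [ddeg_comm]
        exact ddeg_blend_right_le hz
      have h5 : ddeg (starGraph (fun v => (c v, corr i (c v))) z)
          (starGraph (fun v => (c v, N v)) z) z =
          ddeg (labelGraph (Function.update c z i)) K z := by
        rw [← labelGraph_update]
        exact Finset.sum_congr rfl fun v _ => dd_congr Iff.rfl (hstar v)
      rw [h5]
      linarith
    have hKoff : ∀ u v, u ≠ z → v ≠ z → ((blend L H (insert z T)).Adj u v ↔ K.Adj u v) := by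
      intro u v hu hv
      simp [hK, blend, hu, hv]
    have h2 := abs_star_second_diff_le (Γ := Γ) (G₁ := blend L H (insert z T)) (G₂ := K)
      (H₁ := L) (H₂ := starGraph (fun v => (c v, N v)) z)
      -- Only differences away from `z` count in the comparison of the two corrections, since both
      -- start from the same neighbourhood of `z` and end with the same one.
      (D := fun u v => if u = z ∨ v = z then 0 else dd K L u v) z
      (fun u v => by
        by_cases h : u = z ∨ v = z
        · simp [h]
        · simp only [h, if_false]
          exact dd_zero_or_one _ _ _ _)
      (fun v => by simp) (fun v => by simp) (fun v => by simp [dd_self])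
      (fun u v => by
        by_cases h : u = z ∨ v = z
        · rw [dd_eq_zero.2]
          · simp [h]
          · refine blend_adj_of_mem ?_
            rcases h with rfl | rfl
            · exact Or.inl (Finset.mem_insert_self _ _)
            · exact Or.inr (Finset.mem_insert_self _ _)
        · simp only [h, if_false]
          push Not at h
          exact (dd_congr (hKoff u v h.1 h.2) Iff.rfl).le)
      (fun u v => by
        by_cases h : u = z ∨ v = z
        · rw [dd_eq_zero.2]
          · simp [h]
          · rcases h with rfl | rfl
            · exact (hstar v).symm
            · exact (hstar' u).symm
        · simp only [h, if_false]
          push Not at h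
          exact (dd_congr Iff.rfl (hoff u v h.1 h.2)).le)
      (fun u v hu hv => dd_eq_zero.2 (hKoff u v hu hv))
      (fun u v hu hv => dd_eq_zero.2 (hoff u v hu hv).symm)
    have h3 : (∑ u, ∑ v, (if u = z ∨ v = z then 0 else dd K L u v)) ≤ dsize H L := by
      refine Finset.sum_le_sum fun u _ => Finset.sum_le_sum fun v _ => ?_
      split_ifs
      · exact dd_nonneg _ _ _ _
      · exact dd_blend_left_le u v
    rw [Fintype.card_fin] at h2
    have h4 : 4 * bd Γ * (k : ℝ) ^ 3 *
        ((∑ u, ∑ v, (if u = z ∨ v = z then 0 else dd K L u v)) / (n : ℝ) ^ 2) ≤ κ / 2 := by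
      refine le_trans ?_ hsmall
      gcongr
    have h5 := neg_abs_le ((dens Γ (blend L H (insert z T)) - dens Γ K) -
      (dens Γ L - dens Γ (starGraph (fun v => (c v, N v)) z)))
    have h6 := mul_le_mul_of_nonneg_left h5 hn.le
    rw [Finset.card_insert_of_notMem hz]
    push_cast
    nlinarith

end gain

end

end PartiteStability

namespace PartiteStability

noncomputable section

/-! ### Linear gain near an optimal realisation. -/

section relabel

lemma abs_cdens_sub_le {V L : Type} [Fintype V] [DecidableEq L] (c c' : V → L) (l : L) :
    |cdens c l - cdens c' l| ≤
      ((Finset.univ.filter fun v => c v ≠ c' v).card : ℝ) / Fintype.card V := by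
  classical
  have key : ∀ c c' : V → L, cdens c l - cdens c' l ≤
      ((Finset.univ.filter fun v => c v ≠ c' v).card : ℝ) / Fintype.card V := by
    intro c c'
    rw [cdens_eq, cdens_eq, ← sub_div]
    refine div_le_div_of_nonneg_right ?_ (Nat.cast_nonneg _)
    have h : (Finset.univ.filter fun v => c v = l) ⊆
        (Finset.univ.filter fun v => c v ≠ c' v) ∪ (Finset.univ.filter fun v => c' v = l) := by
      intro v hv
      simp only [Finset.mem_union, Finset.mem_filter, Finset.mem_univ, true_and] at hv ⊢
      by_cases h : c v = c' v
      · exact Or.inr (h ▸ hv)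
      · exact Or.inl h
    have h2 := (Finset.card_le_card h).trans (Finset.card_union_le _ _)
    have h3 : ((Finset.univ.filter fun v => c v = l).card : ℝ) ≤
        (Finset.univ.filter fun v => c v ≠ c' v).card +
          (Finset.univ.filter fun v => c' v = l).card := by exact_mod_cast h2
    linarith
  rw [abs_le]
  have h1 := key c c'
  have h2 := key c' c
  simp only [ne_comm (a := c' _)] at h2
  constructor <;> linarith

lemma ddeg_update_le {V : Type} [Fintype V] [DecidableEq V] (c c' : V → Option ℕ) (z : V)
    (i : Option ℕ) :
    ddeg (labelGraph (Function.update c z i)) (labelGraph (Function.update c' z i)) z ≤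
      ((Finset.univ.filter fun v => c v ≠ c' v).card : ℝ) := by
  calc _ ≤ ∑ v, if c v ≠ c' v then (1 : ℝ) else 0 := by
        refine Finset.sum_le_sum fun v _ => ?_
        split_ifs with hv
        · exact dd_le_one _ _ _ _
        · rw [dd_eq_zero.2]
          by_cases hvz : v = z
          · rw [hvz]
            simp
          · rw [not_not] at hv
            simp [labelGraph, hvz, hv]
    _ = _ := by
        rw [Finset.sum_boole]

/-- The vertices with wrong neighbourhoods can be relabelled, such that the neighbourhoods of the
remaining wrong vertices `B` are far from those of all parts. -/
lemma exists_relabel {n : ℕ} {S : Set (Option ℕ)} {c : Fin n → Option ℕ} (hc : ∀ v, c v ∈ S)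
    {i₀ : Option ℕ} (hi₀ : i₀ ∈ S) {H : SimpleGraph (Fin n)} {η ε : ℝ}
    (hclose : dsize H (labelGraph c) ≤ ε * (n : ℝ) ^ 2) :
    ∃ (c' : Fin n → Option ℕ) (B : Finset (Fin n)) (t : ℕ), (∀ v, c' v ∈ S) ∧
      t = (Finset.univ.filter fun v => c v ≠ c' v).card ∧ (t : ℝ) * η ≤ ε * n ∧
      (B.card : ℝ) * η ≤ ε * n ∧ (∀ z ∈ B, c' z = i₀) ∧
      (∀ z ∈ B, ∀ j ∈ S, η * n - t ≤ ddeg (labelGraph (Function.update c' z j)) H z) ∧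
      ∀ z, z ∉ B → ddeg (labelGraph c') H z ≤ η * n + t := by
  classical
  rcases Nat.eq_zero_or_pos n with rfl | hn
  · exact ⟨c, ∅, 0, hc, by simp, by simp, by simp, by simp, by simp, fun z => z.elim0⟩
  have hnpos : (0 : ℝ) < n := by exact_mod_cast hn
  have hself : ∀ z, labelGraph (Function.update c z (c z)) = labelGraph c := fun z => by
    rw [Function.update_eq_self]
  -- A vertex keeps its label if that fits, takes any fitting label otherwise, and takes `i₀` if
  -- none fits.
  have hrelabel : ∀ z, ∃ i ∈ S,
      (ddeg (labelGraph c) H z < η * n → i = c z) ∧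
      (¬ ddeg (labelGraph c) H z < η * n →
        ddeg (labelGraph (Function.update c z i)) H z < η * n ∨
        (i = i₀ ∧ ∀ j ∈ S, η * n ≤ ddeg (labelGraph (Function.update c z j)) H z)) := by
    intro z
    by_cases h1 : ddeg (labelGraph c) H z < η * n
    · exact ⟨c z, hc z, fun _ => rfl, fun h => absurd h1 h⟩
    · by_cases h2 : ∃ i ∈ S, ddeg (labelGraph (Function.update c z i)) H z < η * n
      · obtain ⟨i, hi, h2⟩ := h2
        exact ⟨i, hi, fun h => absurd h h1, fun _ => Or.inl h2⟩
      · push Not at h2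
        exact ⟨_, hi₀, fun h => absurd h h1, fun _ => Or.inr ⟨rfl, h2⟩⟩
  choose c' hc'mem hc'eq hc'ne using hrelabel
  -- Every relabelled or hopeless vertex has degree at least `η * n` in the difference graph, so
  -- there are few of them.
  have hcount : ∀ A : Finset (Fin n), (∀ v ∈ A, η * n ≤ ddeg (labelGraph c) H v) →
      (A.card : ℝ) * η ≤ ε * n := by
    intro A hA
    have h1 : (A.card : ℝ) * (η * n) ≤ ε * (n : ℝ) ^ 2 := by
      calc (A.card : ℝ) * (η * n) = ∑ _v ∈ A, η * n := by rw [Finset.sum_const, nsmul_eq_mul]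
        _ ≤ ∑ v ∈ A, ddeg (labelGraph c) H v := Finset.sum_le_sum hA
        _ ≤ dsize (labelGraph c) H :=
            Finset.sum_le_sum_of_subset_of_nonneg (Finset.subset_univ _)
              fun _ _ _ => ddeg_nonneg _ _ _
        _ ≤ ε * (n : ℝ) ^ 2 := by
            rw [dsize_comm]
            exact hclose
    refine le_of_mul_le_mul_right ?_ hnpos
    linarith
  have hstar : ∀ z i, |ddeg (labelGraph (Function.update c' z i)) H z -
      ddeg (labelGraph (Function.update c z i)) H z| ≤
        ((Finset.univ.filter fun v => c v ≠ c' v).card : ℝ) := by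
    intro z i
    have h1 := ddeg_update_le c c' z i
    have h2 := ddeg_triangle (labelGraph (Function.update c z i))
      (labelGraph (Function.update c' z i)) H z
    have h3 := ddeg_triangle (labelGraph (Function.update c' z i))
      (labelGraph (Function.update c z i)) H z
    rw [ddeg_comm (labelGraph (Function.update c' z i)) (labelGraph (Function.update c z i))] at h3
    rw [abs_le]
    constructor <;> linarith
  set B := Finset.univ.filter fun z => ∀ j ∈ S,
    η * n ≤ ddeg (labelGraph (Function.update c z j)) H z with hB
  have hBfar : ∀ z ∈ B, η * n ≤ ddeg (labelGraph c) H z := by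
    intro z hz
    have := (Finset.mem_filter.1 hz).2 _ (hc z)
    rwa [hself] at this
  refine ⟨c', B, _, hc'mem, rfl, hcount _ ?_, hcount B hBfar, ?_, ?_, ?_⟩
  · intro v hv
    by_contra h
    exact (Finset.mem_filter.1 hv).2 (hc'eq v (not_le.1 h)).symm
  · intro z hz
    rcases hc'ne z (not_lt.2 (hBfar z hz)) with h2 | h2
    · exact absurd ((Finset.mem_filter.1 hz).2 _ (hc'mem z)) (not_le.2 h2)
    · exact h2.1
  · intro z hz j hj
    have h1 := (Finset.mem_filter.1 hz).2 j hj
    have h2 := (abs_le.1 (hstar z j)).1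
    linarith
  · intro z hz
    have h1 : ddeg (labelGraph (Function.update c z (c' z))) H z < η * n := by
      by_cases h : ddeg (labelGraph c) H z < η * n
      · rw [hc'eq z h, hself]
        exact h
      · rcases hc'ne z h with h2 | h2
        · exact h2
        · exact absurd (Finset.mem_filter.2 ⟨Finset.mem_univ z, h2.2⟩) hz
    have h2 := (abs_le.1 (hstar z (c' z))).2
    rw [Function.update_eq_self] at h2
    linarith

variable {k : ℕ} {Γ : SimpleGraph (Fin k) → ℝ}

/-- A graph close to an optimal realisation can be improved to a complete partite graph, with a
gain proportional to the distance. -/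
lemma exists_label_gain (hΓ : IsoInvariant Γ) (hsym : Symmetrisable Γ) {x : PartiteLimit} {c₀ : ℝ}
    (hx : LocallyStrict Γ x c₀) :
    ∃ ε : ℝ, 0 < ε ∧ ∃ κ : ℝ, 0 < κ ∧ ∃ n₀ : ℕ, ∀ n, n₀ ≤ n → ∀ H : SimpleGraph (Fin n),
      Close x ε H → ∃ c : Fin n → Option ℕ,
        κ * dsize H (labelGraph c) ≤ (n : ℝ) ^ 2 * (dens Γ (labelGraph c) - dens Γ H) := by
  classical
  have hc₀ := hx.pos
  have hb := bd_nonneg Γ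
  set C := 12 * bd Γ * (k : ℝ) ^ 4 with hC
  have hC0 : 0 ≤ C := by positivity
  set C₃ := 4 * bd Γ * (k : ℝ) ^ 3 with hC₃
  have hC₃0 : 0 ≤ C₃ := by positivity
  obtain ⟨η, hη0, hηC⟩ : ∃ η : ℝ, 0 < η ∧ C * (2 * η) ≤ c₀ / 4 := by
    refine ⟨c₀ / (8 * (C + 1)), by positivity, ?_⟩
    rw [mul_div_assoc', mul_div_assoc', div_le_div_iff₀ (by positivity) (by norm_num)]
    nlinarith
  obtain ⟨κ, hκ, δ₁, hδ₁, n₁, hn₁⟩ := exists_star_gain hΓ hsym hx (show 0 < η / 4 by positivity)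
  obtain ⟨δ₂, hδ₂, n₂, hn₂⟩ := exists_uniform_flip hx.finite (half_lt_self hc₀) hx.flip
  obtain ⟨δ, hδ0, hδ1, hδ2⟩ : ∃ δ : ℝ, 0 < δ ∧ δ ≤ δ₁ ∧ δ ≤ δ₂ :=
    ⟨min δ₁ δ₂, lt_min hδ₁ hδ₂, min_le_left _ _, min_le_right _ _⟩
  obtain ⟨n₃, hn₃⟩ := exists_nearLabel_of_isRealisation hx.finite (half_pos hδ0)
  -- The three bounds on `ε` keep the numbers of relabelled and far vertices below `η * n / 8`, keep
  -- the new labelling within `δ`, and keep the second-order error in `le_dens_blend_sub` below `κ /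
  -- 2`.
  obtain ⟨ε, hε0, hε1, hε2, hε3⟩ : ∃ ε : ℝ, 0 < ε ∧ ε ≤ η ^ 2 / 8 ∧ ε ≤ η * δ / 2 ∧
      C₃ * (ε * (1 + 2 / η)) ≤ κ / 2 := by
    refine ⟨min (min (η ^ 2 / 8) (η * δ / 2)) (κ / (2 * (C₃ + 1) * (1 + 2 / η))), by positivity,
      (min_le_left _ _).trans (min_le_left _ _), (min_le_left _ _).trans (min_le_right _ _), ?_⟩
    have h1 := min_le_right (min (η ^ 2 / 8) (η * δ / 2)) (κ / (2 * (C₃ + 1) * (1 + 2 / η)))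
    have h0 : 0 ≤ 1 + 2 / η := by positivity
    refine (mul_le_mul_of_nonneg_left (mul_le_mul_of_nonneg_right h1 h0) hC₃0).trans ?_
    rw [← sub_nonneg]
    have h3 : κ / 2 - C₃ * (κ / (2 * (C₃ + 1) * (1 + 2 / η)) * (1 + 2 / η)) =
        κ / 2 * (1 / (C₃ + 1)) := by
      have : 1 + 2 / η ≠ 0 := by positivity
      field_simp
      ring
    rw [h3]
    positivity
  refine ⟨ε, hε0, min (c₀ / 8) (κ / 4), by positivity, max (max n₁ n₂) (max n₃ 1), ?_⟩
  rintro n hn H ⟨c, hc, hclose⟩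
  simp only [max_le_iff] at hn
  obtain ⟨⟨hnn₁, hnn₂⟩, hnn₃, hn1⟩ := hn
  have hne : Nonempty (Fin n) := ⟨⟨0, hn1⟩⟩
  have hnpos : (0 : ℝ) < n := by exact_mod_cast hn1
  have hηn : 0 < η * n := by positivity
  obtain ⟨c', B, t, hmem, ht, htη, hBη, hBi, hBfar, hgood⟩ := exists_relabel (η := η)
    (mem_suppStar_of_isRealisation hc) (firstLabel_mem x) hclose
  have hbound : ∀ s : ℝ, s * η ≤ ε * n → s ≤ η * n / 8 := by
    intro s hs
    have : ε * n ≤ η ^ 2 / 8 * n := mul_le_mul_of_nonneg_right hε1 hnpos.le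
    have : s * η ≤ η * n / 8 * η := by linarith
    exact le_of_mul_le_mul_right this hη0
  have ht8 := hbound t htη
  have hB8 := hbound _ hBη
  have hnear : ∀ l, |cdens c' l - x.weight l| ≤ δ := by
    intro l
    have h1 := (hn₃ n hnn₃ c hc).2 l
    have h2 := abs_cdens_sub_le c c' l
    have h4 : (t : ℝ) / n ≤ δ / 2 := by
      rw [div_le_iff₀ hnpos]
      have : ε * n ≤ η * δ / 2 * n := mul_le_mul_of_nonneg_right hε2 hnpos.le
      have : (t : ℝ) * η ≤ δ / 2 * n * η := by linarith
      exact le_of_mul_le_mul_right this hη0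
    rw [Fintype.card_fin, abs_sub_comm, ← ht] at h2
    have h3 := abs_sub_le (cdens c' l) (cdens c l) (x.weight l)
    linarith
  have hflip := hn₂ n hnn₂ c' ⟨hmem, fun l => (hnear l).trans hδ2⟩
  have hgain := hn₁ n hnn₁ c' ⟨hmem, fun l => (hnear l).trans hδ1⟩
  have hdist : dsize H (labelGraph c') ≤ ε * (1 + 2 / η) * (n : ℝ) ^ 2 := by
    have h1 := dsize_triangle H (labelGraph c) (labelGraph c')
    have h2 := dsize_labelGraph_le c c'
    rw [← ht, Fintype.card_fin] at h2
    have h3 : (t : ℝ) ≤ ε * n / η := by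
      rw [le_div_iff₀ hη0]
      exact htη
    have h4 : 2 * (n : ℝ) * t ≤ 2 * n * (ε * n / η) :=
      mul_le_mul_of_nonneg_left h3 (by positivity)
    have h5 : 2 * (n : ℝ) * (ε * n / η) = ε * (2 / η) * (n : ℝ) ^ 2 := by
      field_simp
    linarith
  -- A quarter of `η` suffices: the remaining distance `η * n - t` exceeds `η / 4 * n + B.card`, as
  -- both counts are at most `η * n / 8`.
  have hstep := le_dens_blend_sub (Γ := Γ) (c := c') (S := x.suppStar) (η := η / 4) (κ := κ)
    (H := H) (B := B)
    (fun z hz N hN => by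
      have h1 := hgain z N hN
      rwa [← labelGraph_update, ← hBi z hz, Function.update_eq_self] at h1)
    (fun z hz i hi => by
      have h1 := hBfar z hz i hi
      linarith)
    (by
      rw [← hC₃]
      refine le_trans (mul_le_mul_of_nonneg_left ?_ hC₃0) hε3
      rw [div_le_iff₀ (by positivity)]
      exact hdist)
    (Finset.Subset.refl B)
  refine ⟨c', ?_⟩
  set L := labelGraph c' with hL
  set K := blend L H B with hK
  -- Vertices of `B` are now correct, and the others have degree at most `η * n + t`.
  have hdeg : ∀ u, ddeg L K u ≤ 2 * η * n := by
    intro u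
    rw [ddeg_comm]
    by_cases hu : u ∈ B
    · rw [ddeg_blend_of_mem hu]
      linarith
    · refine (ddeg_blend_le u).trans ?_
      have := hgood u hu
      rw [ddeg_comm]
      linarith
  have hflips := le_dens_sub_of_flips (Γ := Γ) (F := L) (c := c₀ / 2) (η := 2 * η)
    (by simpa only [Fintype.card_fin] using hflip) K
    (by simpa only [Fintype.card_fin] using hdeg)
    (by
      rw [Fintype.card_fin, dsize]
      refine (Finset.sum_le_sum fun u _ => hdeg u).trans (le_of_eq ?_)
      rw [Finset.sum_const, Finset.card_univ, Fintype.card_fin, nsmul_eq_mul]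
      ring)
  rw [Fintype.card_fin, ← hC] at hflips
  have hs0 := dsize_nonneg L K
  have h1 : c₀ / 8 * dsize L K ≤ (n : ℝ) ^ 2 * (dens Γ L - dens Γ K) := by
    refine le_trans ?_ hflips
    nlinarith
  have h2 : κ / 4 * dsize H K ≤ (n : ℝ) ^ 2 * (dens Γ K - dens Γ H) := by
    have h3 : dsize H K ≤ 2 * n * B.card := by
      have := dsize_blend_right_le (L := L) (H := H) (T := B)
      rwa [Fintype.card_fin] at this
    have h4 := mul_le_mul_of_nonneg_left hstep hnpos.le
    have h5 := mul_le_mul_of_nonneg_left h3 (show 0 ≤ κ / 4 by positivity)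
    linarith
  have h3 := dsize_triangle H K L
  rw [dsize_comm K L] at h3
  have h4 : min (c₀ / 8) (κ / 4) * dsize L K ≤ c₀ / 8 * dsize L K :=
    mul_le_mul_of_nonneg_right (min_le_left _ _) hs0
  have h5 : min (c₀ / 8) (κ / 4) * dsize H K ≤ κ / 4 * dsize H K :=
    mul_le_mul_of_nonneg_right (min_le_right _ _) (dsize_nonneg _ _)
  have h6 : min (c₀ / 8) (κ / 4) * dsize H L ≤ min (c₀ / 8) (κ / 4) * (dsize H K + dsize L K) :=
    mul_le_mul_of_nonneg_left h3 (by positivity)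
  linarith

end relabel

end

end PartiteStability

namespace PartiteStability

noncomputable section

/-! ### Bootstrapping closeness along symmetrisation paths. -/

section bootstrap

lemma Close.mono {x : PartiteLimit} {ε ε' : ℝ} {n : ℕ} {G : SimpleGraph (Fin n)}
    (h : Close x ε G) (hε : ε ≤ ε') : Close x ε' G := by
  obtain ⟨c, hc, hd⟩ := h
  exact ⟨c, hc, hd.trans (mul_le_mul_of_nonneg_right hε (by positivity))⟩

lemma Close.trans_dsize {x : PartiteLimit} {ε η : ℝ} {n : ℕ} {G H : SimpleGraph (Fin n)}
    (h : Close x ε G) (hGH : dsize H G ≤ η * (n : ℝ) ^ 2) : Close x (ε + η) H := by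
  obtain ⟨c, hc, hd⟩ := h
  refine ⟨c, hc, (dsize_triangle H G _).trans ?_⟩
  rw [add_mul, add_comm]
  exact add_le_add hd hGH

lemma exists_pos_le_of_finite {L : Type*} {S : Set L} (hS : S.Finite) {f : L → ℝ}
    (hf : ∀ x ∈ S, 0 < f x) : ∃ ε : ℝ, 0 < ε ∧ ∀ x ∈ S, ε ≤ f x := by
  have h : ∀ᶠ ε in 𝓝[>] (0 : ℝ), ∀ x ∈ S, ε ≤ f x := by
    rw [eventually_all_finite hS]
    intro x hx
    filter_upwards [Ioo_mem_nhdsGT (hf x hx)] with ε hε using hε.2.le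
  obtain ⟨ε, h1, h2⟩ := (h.and self_mem_nhdsWithin).exists
  exact ⟨ε, h2, h1⟩

variable {k : ℕ} {Γ : SimpleGraph (Fin k) → ℝ}

/-- Nearly optimal graphs that are moderately close to an optimal realisation are very close to an
optimal realisation. -/
lemma exists_close_of_close (hΓ : IsoInvariant Γ) (hsym : Symmetrisable Γ)
    (hfin : (OPT Γ).Finite) (hloc : ∀ x ∈ OPT Γ, ∃ c₀, LocallyStrict Γ x c₀) :
    ∃ ε₁ : ℝ, 0 < ε₁ ∧ ∀ ε₂ : ℝ, 0 < ε₂ → ∃ δ : ℝ, 0 < δ ∧ ∃ n₀ : ℕ, ∀ n, n₀ ≤ n →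
      ∀ H : SimpleGraph (Fin n), lamMax Γ - δ ≤ lam Γ H → (∃ x ∈ OPT Γ, Close x ε₁ H) →
        ∃ x ∈ OPT Γ, Close x ε₂ H := by
  have hgain : ∀ x : PartiteLimit, ∃ ε : ℝ, x ∈ OPT Γ → 0 < ε ∧ ∃ κ : ℝ, 0 < κ ∧ ∃ n₀ : ℕ,
      ∀ n, n₀ ≤ n → ∀ H : SimpleGraph (Fin n), Close x ε H → ∃ c : Fin n → Option ℕ,
        κ * dsize H (labelGraph c) ≤ (n : ℝ) ^ 2 * (dens Γ (labelGraph c) - dens Γ H) := by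
    intro x
    by_cases hx : x ∈ OPT Γ
    · obtain ⟨c₀, h⟩ := hloc x hx
      obtain ⟨ε, h⟩ := exists_label_gain hΓ hsym h
      exact ⟨ε, fun _ => h⟩
    · exact ⟨0, fun h => absurd h hx⟩
  choose f hf using hgain
  obtain ⟨ε₁, hε₁, hle⟩ := exists_pos_le_of_finite hfin fun x hx => (hf x hx).1
  refine ⟨ε₁, hε₁, fun ε₂ hε₂ => ?_⟩
  by_contra hcon
  push Not at hcon
  have h' := fun j : ℕ => hcon (1 / ((j : ℝ) + 1)) (by positivity) j
  choose n hn H hlam hclose hnot using h'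
  choose y hy hclose using hclose
  set 𝓤 : Ultrafilter ℕ := Ultrafilter.of atTop
  have h𝓤 : (𝓤 : Filter ℕ) ≤ atTop := Ultrafilter.of_le _
  have hn' : Tendsto n 𝓤 atTop := (tendsto_atTop_mono hn tendsto_id).mono_left h𝓤
  have hδ : Tendsto (fun j : ℕ => 1 / ((j : ℝ) + 1)) 𝓤 (𝓝 0) :=
    tendsto_one_div_add_atTop_nhds_zero_nat.mono_left h𝓤
  -- Finiteness of `OPT` allows one optimal element, and hence one constant `κ`, along the
  -- ultrafilter.
  obtain ⟨x, hx, hxy⟩ := exists_eventually_eq_of_finite 𝓤 hfin hy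
  obtain ⟨-, κ, hκ, n₀, hn₀⟩ := hf x hx
  have hex : ∀ j, ∃ c : Fin (n j) → Option ℕ, n₀ ≤ n j → y j = x →
      κ * dsize (H j) (labelGraph c) ≤
        (n j : ℝ) ^ 2 * (dens Γ (labelGraph c) - dens Γ (H j)) := by
    intro j
    by_cases hj : n₀ ≤ n j ∧ y j = x
    · obtain ⟨c, hc⟩ := hn₀ (n j) hj.1 (H j) (by
        rw [← hj.2]
        exact (hclose j).mono (hle _ (hy j)))
      exact ⟨c, fun _ _ => hc⟩
    · exact ⟨fun _ => none, fun h1 h2 => absurd ⟨h1, h2⟩ hj⟩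
  choose c hc using hex
  have hL := tendsto_lam_sub_dens hΓ hn' fun j => labelGraph (c j)
  have hH := tendsto_lam_sub_dens hΓ hn' H
  have hord : Tendsto (fun j => lamOrder Γ (n j) - lamMax Γ) 𝓤 (𝓝 0) := by
    have := ((tendsto_lamOrder hΓ hsym hx).comp hn').sub_const (lamMax Γ)
    rw [lamMax_eq hΓ hsym hx, sub_self] at this
    rw [lamMax_eq hΓ hsym hx]
    exact this
  obtain ⟨δ, hδ0, n₁, hn₁⟩ := exists_close_of_le_lam hΓ hsym (half_pos hε₂)
  -- This bounds the density gain: no graph exceeds the maximum of its order, while `H j` is nearly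
  -- maximal.
  have herr : Tendsto (fun j => (lamOrder Γ (n j) - lamMax Γ) + 1 / ((j : ℝ) + 1) +
      (lam Γ (H j) - dens Γ (H j)) - (lam Γ (labelGraph (c j)) - dens Γ (labelGraph (c j))))
      𝓤 (𝓝 0) := by
    have := ((hord.add hδ).add hH).sub hL
    simpa using this
  have herr' : Tendsto (fun j => (lam Γ (labelGraph (c j)) - dens Γ (labelGraph (c j))) -
      (lam Γ (H j) - dens Γ (H j)) - 1 / ((j : ℝ) + 1)) 𝓤 (𝓝 0) := by
    have := (hL.sub hH).sub hδ
    simpa using this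
  obtain ⟨j, hj1, hj2, hj3, hj4, hj5, hj6⟩ := (hxy.and ((hn'.eventually_ge_atTop n₀).and
    ((hn'.eventually_ge_atTop n₁).and ((hn'.eventually_ge_atTop 1).and
    ((herr.eventually (gt_mem_nhds (show 0 < κ * (ε₂ / 2) by positivity))).and
    (herr'.eventually (lt_mem_nhds (neg_lt_zero.2 hδ0)))))))).exists
  have hnj : (0 : ℝ) < n j := by exact_mod_cast hj4
  have h1 := hc j hj2 hj1
  have h2 := hlam j
  have h3 := lam_le_lamOrder (Γ := Γ) (labelGraph (c j))
  have hgain0 : 0 ≤ dens Γ (labelGraph (c j)) - dens Γ (H j) := by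
    have h4 : 0 ≤ (n j : ℝ) ^ 2 * (dens Γ (labelGraph (c j)) - dens Γ (H j)) :=
      le_trans (mul_nonneg hκ.le (dsize_nonneg _ _)) h1
    exact nonneg_of_mul_nonneg_right h4 (by positivity)
  -- The labelled graph is itself nearly optimal, since it is no worse than `H j` in density. The
  -- optimal element obtained here need not be `x`.
  obtain ⟨x', hx', hcl⟩ := hn₁ (n j) hj3 (labelGraph (c j))
    (isCompleteMultipartite_labelGraph _) (by linarith)
  refine hnot j x' hx' ?_
  have h5 : dsize (H j) (labelGraph (c j)) ≤ ε₂ / 2 * (n j : ℝ) ^ 2 := by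
    have h6 : dens Γ (labelGraph (c j)) - dens Γ (H j) ≤ κ * (ε₂ / 2) := by linarith
    have h7 := mul_le_mul_of_nonneg_left h6 (show 0 ≤ (n j : ℝ) ^ 2 by positivity)
    refine le_of_mul_le_mul_left ?_ hκ
    linarith
  have := hcl.trans_dsize h5
  rwa [add_halves] at this

/-- Nearly optimal graphs are close to an optimal realisation. -/
theorem exists_close_of_lam (hΓ : IsoInvariant Γ) (hsym : Symmetrisable Γ)
    (hfin : (OPT Γ).Finite) (hloc : ∀ x ∈ OPT Γ, ∃ c₀, LocallyStrict Γ x c₀) {ε : ℝ}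
    (hε : 0 < ε) :
    ∃ δ : ℝ, 0 < δ ∧ ∃ n₀ : ℕ, ∀ n, n₀ ≤ n → ∀ G : SimpleGraph (Fin n),
      lamMax Γ - δ ≤ lam Γ G → ∃ x ∈ OPT Γ, Close x ε G := by
  obtain ⟨ε₁, hε₁, hboot⟩ := exists_close_of_close hΓ hsym hfin hloc
  -- Leaves room for one step of the path: `ε₂ + ε₁ / 2` does not exceed `ε₁`.
  set ε₂ := min ε (ε₁ / 2) with hε₂
  have hε₂0 : 0 < ε₂ := lt_min hε (half_pos hε₁)
  obtain ⟨δ₁, hδ₁, n₁, hn₁⟩ := hboot ε₂ hε₂0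
  obtain ⟨δ₂, hδ₂, n₂, hn₂⟩ := exists_close_of_le_lam hΓ hsym hε₂0
  obtain ⟨n₃, -, hn₃⟩ := hsym (ε₁ / 2) (half_pos hε₁)
  refine ⟨min δ₁ δ₂, lt_min hδ₁ hδ₂, max n₁ (max n₂ n₃), fun n hn G hG => ?_⟩
  simp only [max_le_iff] at hn
  obtain ⟨m, S, hS0, hSm, hS⟩ := (hn₃ n hn.2.2 G).1
  have hlam : ∀ i ≤ m, lamMax Γ - min δ₁ δ₂ ≤ lam Γ (S i) := by
    intro i
    induction i with
    | zero =>
      intro _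
      rw [hS0]
      exact hG
    | succ i ih =>
      intro hi
      exact (ih (by omega)).trans (hS i (by omega)).1
  -- The path is followed backwards. The optimal element may change from step to step, but the
  -- distance is reset to `ε₂` each time.
  have hback : ∀ i ≤ m, ∃ x ∈ OPT Γ, Close x ε₂ (S (m - i)) := by
    intro i
    induction i with
    | zero =>
      intro _
      refine hn₂ n hn.2.1 _ hSm (le_trans ?_ (hlam m le_rfl))
      linarith [min_le_right δ₁ δ₂]
    | succ i ih =>
      intro hi
      obtain ⟨x, hx, hcl⟩ := ih (by omega)
      refine hn₁ n hn.1 _ (le_trans ?_ (hlam _ (by omega))) ⟨x, hx, ?_⟩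
      · linarith [min_le_left δ₁ δ₂]
      · have h1 := (hS (m - (i + 1)) (by omega)).2
        rw [show m - (i + 1) + 1 = m - i by omega] at h1
        have h2 : dsize (S (m - (i + 1))) (S (m - i)) ≤ ε₁ / 2 * (n : ℝ) ^ 2 := by
          rw [dsize_eq_edgeDiff]
          have h3 : 2 * (n.choose 2 : ℝ) ≤ (n : ℝ) ^ 2 := by
            rw [Nat.cast_choose_two]
            have : (0 : ℝ) ≤ n := Nat.cast_nonneg n
            nlinarith
          nlinarith
        refine (hcl.trans_dsize h2).mono ?_
        linarith [min_le_right ε (ε₁ / 2)]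
  obtain ⟨x, hx, hcl⟩ := hback m le_rfl
  rw [Nat.sub_self, hS0] at hcl
  exact ⟨x, hx, hcl.mono (min_le_left _ _)⟩

end bootstrap

end

end PartiteStability

namespace PartiteStability

noncomputable section

/-! ### The limit of the edit distances -/

lemma labelGraph_map {V : Type} (c : V → Option ℕ) (σ : Equiv.Perm V) :
    (labelGraph c).map σ = labelGraph (c ∘ σ.symm) := by
  ext u v
  simp only [SimpleGraph.map, labelGraph, Relation.Map, Pi.inf_apply, inf_Prop_eq, Function.comp,
    ne_eq]
  constructor
  · rintro ⟨h, a, b, ⟨-, h2⟩, rfl, rfl⟩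
    simpa using ⟨by simpa using h, h2⟩
  · rintro ⟨h, h2⟩
    exact ⟨h, σ.symm u, σ.symm v, ⟨by simpa using h, h2⟩, by simp, by simp⟩

lemma editDist_le {n : ℕ} (c : Fin n → Option ℕ) (H : SimpleGraph (Fin n))
    (σ : Equiv.Perm (Fin n)) :
    editDist (labelGraph c) H ≤ dsize H (labelGraph (c ∘ σ)) / (n : ℝ) ^ 2 := by
  have h1 : (⨅ τ : Equiv.Perm (Fin n), edgeDiff H ((labelGraph c).map τ)) ≤
      edgeDiff H ((labelGraph c).map σ.symm) := ciInf_le (OrderBot.bddBelow _) σ.symm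
  rw [labelGraph_map, Equiv.symm_symm] at h1
  rw [editDist, dsize_eq_edgeDiff, div_mul_eq_mul_div]
  gcongr

lemma exists_editDist_eq {n : ℕ} (c : Fin n → Option ℕ) (H : SimpleGraph (Fin n)) :
    ∃ σ : Equiv.Perm (Fin n),
      editDist (labelGraph c) H = dsize H (labelGraph (c ∘ σ)) / (n : ℝ) ^ 2 := by
  obtain ⟨τ, hτ⟩ := exists_eq_ciInf_of_finite
    (f := fun τ : Equiv.Perm (Fin n) => edgeDiff H ((labelGraph c).map τ))
  refine ⟨τ.symm, ?_⟩
  rw [editDist, ← hτ, labelGraph_map, dsize_eq_edgeDiff, div_mul_eq_mul_div]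

lemma dsize_le_sq {V : Type} [Fintype V] (G H : SimpleGraph V) :
    dsize G H ≤ (Fintype.card V : ℝ) ^ 2 := by
  calc dsize G H ≤ ∑ _u : V, ∑ _v : V, (1 : ℝ) :=
        Finset.sum_le_sum fun u _ => Finset.sum_le_sum fun v _ => dd_le_one _ _ _ _
    _ = (Fintype.card V : ℝ) ^ 2 := by
        simp only [Finset.sum_const, Finset.card_univ, nsmul_eq_mul, mul_one]
        ring

lemma editDist_mem_Icc {n : ℕ} (c : Fin n → Option ℕ) (H : SimpleGraph (Fin n)) :
    editDist (labelGraph c) H ∈ Set.Icc (0 : ℝ) 1 := by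
  obtain ⟨σ, hσ⟩ := exists_editDist_eq c H
  rw [hσ]
  have h := dsize_le_sq H (labelGraph (c ∘ σ))
  rw [Fintype.card_fin] at h
  exact ⟨div_nonneg (dsize_nonneg _ _) (by positivity), div_le_one_of_le₀ h (by positivity)⟩

/-! ### Folding blow-ups of different orders. -/

section fold

variable {n M : ℕ}

/-- The map of `Fin m` to `Fin n` that sends `v` to its residue modulo `M`. -/
def residue (hM : 0 < M) (hMn : M ≤ n) (m : ℕ) (v : Fin m) : Fin n :=
  ⟨v % M, (Nat.mod_lt _ hM).trans_le hMn⟩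

lemma card_residue (hM : 0 < M) (hMn : M ≤ n) (m : ℕ) (w : Fin n) (hw : (w : ℕ) < M) :
    (Finset.univ.filter fun v : Fin m => residue hM hMn m v = w).card =
      m / M + if (w : ℕ) < m % M then 1 else 0 := by
  have h := Nat.count_modEq_card (b := m) hM (w : ℕ)
  rw [Nat.mod_eq_of_lt hw] at h
  rw [← h, Nat.count_eq_card_filter_range, Finset.card_filter, Finset.card_filter,
    ← Fin.sum_univ_eq_sum_range (fun v => if v ≡ (w : ℕ) [MOD M] then 1 else 0) m]
  refine Finset.sum_congr rfl fun v _ => ?_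
  congr 1
  rw [Fin.ext_iff, Nat.ModEq, Nat.mod_eq_of_lt hw]
  rfl

lemma card_residue_le (hM : 0 < M) (hMn : M ≤ n) (m : ℕ) (w : Fin n) :
    ((Finset.univ.filter fun v : Fin m => residue hM hMn m v = w).card : ℝ) ≤ m / M + 1 := by
  by_cases hw : (w : ℕ) < M
  · rw [card_residue hM hMn m w hw]
    have h1 : ((m / M : ℕ) : ℝ) ≤ m / M := Nat.cast_div_le
    have h2 : (((if (w : ℕ) < m % M then 1 else 0 : ℕ)) : ℝ) ≤ 1 := by split_ifs <;> simp
    push_cast at h1 h2 ⊢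
    linarith
  · rw [Finset.filter_false_of_mem]
    · simp only [Finset.card_empty, Nat.cast_zero]
      positivity
    · intro v _ h
      apply hw
      rw [← h]
      exact Nat.mod_lt _ hM

lemma le_card_residue (hM : 0 < M) (hMn : M ≤ n) (m : ℕ) (w : Fin n) (hw : (w : ℕ) < M) :
    (m : ℝ) / M - 1 ≤ ((Finset.univ.filter fun v : Fin m => residue hM hMn m v = w).card : ℝ) := by
  have hM' : (0 : ℝ) < M := by exact_mod_cast hM
  rw [card_residue hM hMn m w hw, sub_le_iff_le_add, div_le_iff₀ hM']
  have h1 : m < (m / M + 1) * M := by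
    rw [mul_comm]
    exact Nat.lt_mul_div_succ m hM
  have h2 : (m : ℝ) < ((m / M : ℕ) + 1) * M := by exact_mod_cast h1
  have h3 : (0 : ℝ) ≤ ((if (w : ℕ) < m % M then 1 else 0 : ℕ) : ℝ) := Nat.cast_nonneg _
  push_cast at h2 h3 ⊢
  nlinarith

lemma sum_residue (hM : 0 < M) (hMn : M ≤ n) (m : ℕ) (f : Fin n → ℝ) :
    ∑ v : Fin m, f (residue hM hMn m v) =
      ∑ w, ((Finset.univ.filter fun v : Fin m => residue hM hMn m v = w).card : ℝ) * f w := by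
  simp only [Finset.card_filter, Nat.cast_sum, Finset.sum_mul]
  rw [Finset.sum_comm]
  refine Finset.sum_congr rfl fun v _ => ?_
  rw [Finset.sum_eq_single (residue hM hMn m v)]
  · simp
  · intro w _ hw
    simp [Ne.symm hw]
  · simp

lemma sum_residue_le (hM : 0 < M) (hMn : M ≤ n) (m : ℕ) {f : Fin n → ℝ} (hf : ∀ w, 0 ≤ f w) :
    ∑ v : Fin m, f (residue hM hMn m v) ≤ (m / M + 1) * ∑ w, f w := by
  rw [sum_residue, Finset.mul_sum]
  exact Finset.sum_le_sum fun w _ =>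
    mul_le_mul_of_nonneg_right (card_residue_le hM hMn m w) (hf w)

lemma le_sum_residue (hM : 0 < M) (hMn : M ≤ n) (m : ℕ) {f : Fin n → ℝ} (hf : ∀ w, 0 ≤ f w) :
    ((m : ℝ) / M - 1) * ∑ w ∈ Finset.univ.filter (fun w : Fin n => (w : ℕ) < M), f w ≤
      ∑ v : Fin m, f (residue hM hMn m v) := by
  rw [sum_residue, Finset.mul_sum]
  refine (Finset.sum_le_sum fun w hw => mul_le_mul_of_nonneg_right
    (le_card_residue hM hMn m w (Finset.mem_filter.1 hw).2) (hf w)).trans ?_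
  exact Finset.sum_le_sum_of_subset_of_nonneg (Finset.filter_subset _ _)
    fun w _ _ => mul_nonneg (Nat.cast_nonneg _) (hf w)

/-- Pulling back uses only the first `M` vertices, almost equally often: the first error term comes
from the omitted vertices, the second from rounding. -/
lemma abs_cdens_residue_sub_le {L : Type} [DecidableEq L] (hM : 0 < M) (hMn : M ≤ n) {m : ℕ}
    (hm : 0 < m) (c : Fin n → L) (l : L) :
    |cdens (c ∘ residue hM hMn m) l - cdens c l| ≤ ((n : ℝ) - M) / M + n / m := by
  have hm' : (0 : ℝ) < m := by exact_mod_cast hm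
  have hM' : (0 : ℝ) < M := by exact_mod_cast hM
  have hMn' : (M : ℝ) ≤ n := by exact_mod_cast hMn
  have hn' : (0 : ℝ) < n := by linarith
  set f : Fin n → ℝ := fun w => if c w = l then 1 else 0 with hf
  have hf0 : ∀ w, 0 ≤ f w := fun w => by
    simp only [hf]
    split_ifs <;> simp
  have hf1 : ∀ w, f w ≤ 1 := fun w => by
    simp only [hf]
    split_ifs <;> simp
  set C := ∑ w, f w with hC
  set t := ∑ w ∈ Finset.univ.filter (fun w : Fin n => (w : ℕ) < M), f w with ht
  set s := ∑ v : Fin m, f (residue hM hMn m v) with hs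
  have e1 : cdens c l = C / n := by
    rw [cdens_eq, Fintype.card_fin, hC, hf, Finset.sum_boole]
  have e2 : cdens (c ∘ residue hM hMn m) l = s / m := by
    rw [cdens_eq, Fintype.card_fin, hs, hf, Finset.sum_boole]
    rfl
  have hC0 : 0 ≤ C := Finset.sum_nonneg fun w _ => hf0 w
  have ht0 : 0 ≤ t := Finset.sum_nonneg fun w _ => hf0 w
  have hCn : C ≤ n := by
    calc C ≤ ∑ _w : Fin n, (1 : ℝ) := Finset.sum_le_sum fun w _ => hf1 w
      _ = n := by simp
  have htC : t ≤ C := Finset.sum_le_sum_of_subset_of_nonneg (Finset.filter_subset _ _)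
    fun w _ _ => hf0 w
  have hCt : C - t ≤ n - M := by
    have h1 := Finset.sum_filter_add_sum_filter_not Finset.univ (fun w : Fin n => (w : ℕ) < M) f
    have h2 : ∑ w ∈ Finset.univ.filter (fun w : Fin n => ¬ (w : ℕ) < M), f w ≤ n - M := by
      calc _ ≤ ∑ _w ∈ Finset.univ.filter (fun w : Fin n => ¬ (w : ℕ) < M), (1 : ℝ) :=
            Finset.sum_le_sum fun w _ => hf1 w
        _ = n - M := by
          rw [Finset.sum_const, nsmul_eq_mul, mul_one]
          have h3 := Finset.card_filter_add_card_filter_not (s := (Finset.univ : Finset (Fin n)))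
            (fun w : Fin n => (w : ℕ) < M)
          have h4 : (Finset.univ.filter fun w : Fin n => (w : ℕ) < M).card = M := by
            rw [Fin.card_filter_val_lt]
            omega
          rw [h4, Finset.card_univ, Fintype.card_fin] at h3
          rw [← h3]
          push_cast
          rw [add_sub_cancel_left]
          congr!
    linarith
  have hup : s ≤ (m / M + 1) * C := sum_residue_le hM hMn m hf0
  have hlow : ((m : ℝ) / M - 1) * t ≤ s := le_sum_residue hM hMn m hf0
  rw [e1, e2, abs_le]
  constructor
  · have h1 : t / M - t / m ≤ s / m := by
      rw [le_div_iff₀ hm']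
      refine le_trans (le_of_eq ?_) hlow
      field_simp
    have h2 : t / m ≤ n / m := by gcongr; linarith
    have h3 : t / n ≤ t / M := by gcongr
    have h4 : C / n ≤ t / n + (n - M) / M := by
      have : C / n ≤ (t + (n - M)) / n := by gcongr; linarith
      rw [add_div] at this
      have h5 : ((n : ℝ) - M) / n ≤ (n - M) / M := by
        have : (0 : ℝ) ≤ n - M := by linarith
        gcongr
      linarith
    linarith
  · have h1 : s / m ≤ C / M + C / m := by
      rw [div_le_iff₀ hm']
      refine hup.trans (le_of_eq ?_)
      field_simp
    have h2 : C / m ≤ n / m := by gcongr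
    have h3 : C / M - C / n ≤ (n - M) / M := by
      have : C / M - C / n = C / n * ((n - M) / M) := by field_simp
      rw [this]
      refine mul_le_of_le_one_left (div_nonneg (by linarith) hM'.le) (div_le_one_of_le₀ hCn hn'.le)
    linarith

/-- Reduction modulo a multiple of `N` preserves residues modulo `N`, which alone determine
adjacency. -/
lemma blowUp_adj_residue {N : ℕ} (G : SimpleGraph (Fin N)) (hM : 0 < M) (hMn : M ≤ n)
    (hN : N ∣ M) {m : ℕ} (u v : Fin m) :
    (blowUp G m).Adj u v ↔ (blowUp G n).Adj (residue hM hMn m u) (residue hM hMn m v) := by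
  simp only [blowUp, residue, Nat.mod_mod_of_dvd _ hN]

/-- Each differing pair has a bounded number of preimages. Pairs inside a fibre are all charged,
because universal labels make equal images adjacent there. -/
lemma dsize_blowUp_le {N : ℕ} (G : SimpleGraph (Fin N)) (hM : 0 < M) (hMn : M ≤ n) (hN : N ∣ M)
    (m : ℕ) (c : Fin n → Option ℕ) :
    dsize (blowUp G m) (labelGraph (c ∘ residue hM hMn m)) ≤
      ((m : ℝ) / M + 1) ^ 2 * dsize (blowUp G n) (labelGraph c) + m * ((m : ℝ) / M + 1) := by
  set π := residue hM hMn m with hπ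
  have h1 : ∀ u v : Fin m, dd (blowUp G m) (labelGraph (c ∘ π)) u v ≤
      dd (blowUp G n) (labelGraph c) (π u) (π v) + if π u = π v then 1 else 0 := by
    intro u v
    by_cases h : π u = π v
    · rw [if_pos h]
      linarith [dd_nonneg (blowUp G n) (labelGraph c) (π u) (π v),
        dd_le_one (blowUp G m) (labelGraph (c ∘ π)) u v]
    · have huv : u ≠ v := fun h' => h (by rw [h'])
      rw [if_neg h, add_zero]
      refine (dd_congr (blowUp_adj_residue G hM hMn hN u v) ?_).le
      simp only [labelGraph, Function.comp, ne_eq, huv, not_false_eq_true, true_and, ← hπ, h]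
  have h2 : ∑ u : Fin m, ∑ v : Fin m, dd (blowUp G n) (labelGraph c) (π u) (π v) ≤
      ((m : ℝ) / M + 1) ^ 2 * dsize (blowUp G n) (labelGraph c) := by
    calc _ ≤ ∑ u : Fin m, ((m : ℝ) / M + 1) * ddeg (blowUp G n) (labelGraph c) (π u) :=
          Finset.sum_le_sum fun u _ => sum_residue_le hM hMn m
            (f := fun w => dd (blowUp G n) (labelGraph c) (π u) w) fun w => dd_nonneg _ _ _ _
      _ = ((m : ℝ) / M + 1) * ∑ u : Fin m, ddeg (blowUp G n) (labelGraph c) (π u) := by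
          rw [Finset.mul_sum]
      _ ≤ ((m : ℝ) / M + 1) * (((m : ℝ) / M + 1) * dsize (blowUp G n) (labelGraph c)) :=
          mul_le_mul_of_nonneg_left (sum_residue_le hM hMn m fun w => ddeg_nonneg _ _ _)
            (by positivity)
      _ = _ := by ring
  have h3 : ∑ u : Fin m, ∑ v : Fin m, (if π u = π v then (1 : ℝ) else 0) ≤
      m * ((m : ℝ) / M + 1) := by
    calc _ ≤ ∑ _u : Fin m, ((m : ℝ) / M + 1) := by
          refine Finset.sum_le_sum fun u _ => ?_
          rw [Finset.sum_boole]
          have := card_residue_le hM hMn m (π u)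
          simpa only [eq_comm (a := π u)] using this
      _ = _ := by
          rw [Finset.sum_const, Finset.card_univ, Fintype.card_fin, nsmul_eq_mul]
  calc _ ≤ ∑ u : Fin m, ∑ v : Fin m, (dd (blowUp G n) (labelGraph c) (π u) (π v) +
        if π u = π v then 1 else 0) :=
        Finset.sum_le_sum fun u _ => Finset.sum_le_sum fun v _ => h1 u v
    _ ≤ _ := by
        simp only [Finset.sum_add_distrib]
        linarith

end fold

end

end PartiteStability

namespace PartiteStability

noncomputable section

/-! ### Existence and control of the limiting edit distance. -/

section limit

lemma editDist_residue_le {n M N : ℕ} (G : SimpleGraph (Fin N)) (hM : 0 < M) (hMn : M ≤ n)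
    (hN : N ∣ M) {m : ℕ} (hm : 0 < m) {c : Fin n → Option ℕ} {A : Finset (Option ℕ)}
    (hA : ∀ v, c v ∈ A) (c' : Fin m → Option ℕ) :
    editDist (labelGraph c') (blowUp G m) ≤
      (1 / (M : ℝ) + 1 / m) ^ 2 * dsize (blowUp G n) (labelGraph c) + (1 / (M : ℝ) + 1 / m) +
        2 * ∑ l ∈ A, |cdens (c ∘ residue hM hMn m) l - cdens c' l| := by
  have hm' : (0 : ℝ) < m := by exact_mod_cast hm
  have hM' : (0 : ℝ) < M := by exact_mod_cast hM
  obtain ⟨σ, hσ⟩ := exists_perm_card_ne_le (c ∘ residue hM hMn m) c' A fun v => hA _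
  rw [Fintype.card_fin] at hσ
  refine (editDist_le c' (blowUp G m) σ).trans ?_
  rw [div_le_iff₀ (by positivity)]
  have h1 := dsize_triangle (blowUp G m) (labelGraph (c ∘ residue hM hMn m)) (labelGraph (c' ∘ σ))
  have h2 := dsize_blowUp_le G hM hMn hN m c
  have h3 := dsize_labelGraph_le (c ∘ residue hM hMn m) (c' ∘ σ)
  rw [Fintype.card_fin] at h3
  simp only [Function.comp_apply] at h3 hσ
  have h4 := mul_le_mul_of_nonneg_left hσ (show 0 ≤ 2 * (m : ℝ) by positivity)
  have h5 : dsize (labelGraph (c ∘ residue hM hMn m)) (labelGraph (c' ∘ σ)) ≤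
      2 * (m : ℝ) * (m * ∑ l ∈ A, |cdens (c ∘ residue hM hMn m) l - cdens c' l|) := by
    refine h3.trans (le_trans (le_of_eq ?_) h4)
    congr!
  refine (h1.trans (add_le_add h2 h5)).trans (le_of_eq ?_)
  field_simp

/-- A bound for the limits of the edit distances in terms of a single labeling. -/
lemma limit_editDist_le {x : PartiteLimit} (hx : x.suppStar.Finite) {n M N : ℕ}
    (G : SimpleGraph (Fin N)) (hM : 0 < M) (hMn : M ≤ n) (hN : N ∣ M) {c : Fin n → Option ℕ}
    (hc : ∀ v, c v ∈ x.suppStar) {l : Filter ℕ} [l.NeBot] (hl : l ≤ atTop) {a : ℝ}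
    (ha : Tendsto (fun m => editDist (realisation x m) (blowUp G m)) l (𝓝 a)) :
    a ≤ (1 / (M : ℝ)) ^ 2 * dsize (blowUp G n) (labelGraph c) + 1 / (M : ℝ) +
      2 * ∑ i ∈ hx.toFinset, (((n : ℝ) - M) / M + |cdens c i - x.weight i|) := by
  have hcast : Tendsto (fun m : ℕ => (m : ℝ)) l atTop := tendsto_natCast_atTop_atTop.mono_left hl
  have h1 : Tendsto (fun m : ℕ => 1 / (M : ℝ) + 1 / m) l (𝓝 (1 / M)) := by
    simpa using (hcast.const_div_atTop 1).const_add (1 / (M : ℝ))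
  have h2 : ∀ i, Tendsto (fun m : ℕ => ((n : ℝ) - M) / M + n / m + |cdens c i - x.weight i| +
      |x.weight i - cdens (realisationLabel x m) i|) l
        (𝓝 (((n : ℝ) - M) / M + |cdens c i - x.weight i|)) := by
    intro i
    have h3 := (tendsto_cdens_of_isRealisation (l := l) (n := fun m => m) (tendsto_id.mono_left hl)
      x (fun m => realisationLabel_spec x m) i).const_sub (x.weight i)
    have h4 := (((hcast.const_div_atTop (n : ℝ)).const_add (((n : ℝ) - M) / M)).add_const
      |cdens c i - x.weight i|).add h3.abs
    simpa using h4
  refine le_of_tendsto_of_tendsto ha ((((h1.pow 2).mul_const _).add h1).add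
    ((tendsto_finsetSum hx.toFinset fun i _ => h2 i).const_mul 2)) ?_
  filter_upwards [hl (eventually_gt_atTop 0)] with m hm
  refine (editDist_residue_le G hM hMn hN hm (A := hx.toFinset) (fun v => by simpa using hc v)
    (realisationLabel x m)).trans ?_
  gcongr with i
  have h3 := abs_cdens_residue_sub_le hM hMn hm c i
  have h4 := abs_sub_le (cdens (c ∘ residue hM hMn m) i) (cdens c i)
    (cdens (realisationLabel x m) i)
  have h5 := abs_sub_le (cdens c i) (x.weight i) (cdens (realisationLabel x m) i)
  linarith

lemma exists_tendsto_editDist {x : PartiteLimit} (𝓤 : Ultrafilter ℕ) {N : ℕ}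
    (G : SimpleGraph (Fin N)) :
    ∃ a ∈ Set.Icc (0 : ℝ) 1,
      Tendsto (fun m => editDist (realisation x m) (blowUp G m)) 𝓤 (𝓝 a) := by
  have hmem : (𝓤.map fun m => editDist (realisation x m) (blowUp G m) : Filter ℝ) ≤
      𝓟 (Set.Icc 0 1) := by
    rw [le_principal_iff]
    exact Filter.mem_map.2 (Filter.univ_mem' fun m => editDist_mem_Icc _ _)
  obtain ⟨a, ha, h⟩ := isCompact_Icc.ultrafilter_le_nhds _ hmem
  exact ⟨a, ha, h⟩

/-- Optimal matchings at orders along `𝓥` are transferred by folding to all large orders along `𝓤`.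
By symmetry any two subsequential limits agree. -/
lemma limit_editDist_le_limit {x : PartiteLimit} (hx : x.suppStar.Finite) {N : ℕ} (hN : 0 < N)
    (G : SimpleGraph (Fin N)) {𝓤 𝓥 : Filter ℕ} [𝓤.NeBot] [𝓥.NeBot] (h𝓤 : 𝓤 ≤ atTop)
    (h𝓥 : 𝓥 ≤ atTop) {a b : ℝ}
    (ha : Tendsto (fun m => editDist (realisation x m) (blowUp G m)) 𝓤 (𝓝 a))
    (hb : Tendsto (fun m => editDist (realisation x m) (blowUp G m)) 𝓥 (𝓝 b)) : a ≤ b := by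
  choose σ hσ using fun m => exists_editDist_eq (realisationLabel x m) (blowUp G m)
  have hcast : Tendsto (fun m : ℕ => (m : ℝ)) 𝓥 atTop := tendsto_natCast_atTop_atTop.mono_left h𝓥
  -- The largest multiple of `N` not exceeding `n`, so that folding respects the blow-up while
  -- omitting fewer than `N` vertices.
  set M : ℕ → ℕ := fun n => n - n % N with hMdef
  have hMle : ∀ n, M n ≤ n := fun n => Nat.sub_le _ _
  have hdvd : ∀ n, N ∣ M n := fun n => Nat.dvd_sub_mod n
  have hMcast : ∀ n : ℕ, (n : ℝ) - N ≤ M n := by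
    intro n
    have h1 : n ≤ M n + N := by
      have := Nat.mod_lt n hN
      simp only [hMdef]
      omega
    have : (n : ℝ) ≤ M n + N := by exact_mod_cast h1
    linarith
  have hMtop : Tendsto (fun n => (M n : ℝ)) 𝓥 atTop :=
    tendsto_atTop_mono hMcast (tendsto_atTop_add_const_right _ (-(N : ℝ)) hcast)
  have hratio : Tendsto (fun n : ℕ => ((n : ℝ) - M n) / M n) 𝓥 (𝓝 0) := by
    refine tendsto_of_tendsto_of_tendsto_of_le_of_le' tendsto_const_nhds
      (hMtop.const_div_atTop (N : ℝ)) ?_ ?_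
    · refine Eventually.of_forall fun n => div_nonneg ?_ (Nat.cast_nonneg _)
      have : (M n : ℝ) ≤ n := by exact_mod_cast hMle n
      linarith
    · refine Eventually.of_forall fun n => div_le_div_of_nonneg_right ?_ (Nat.cast_nonneg _)
      linarith [hMcast n]
  have hdens : ∀ i, Tendsto (fun n : ℕ => ((n : ℝ) - M n) / M n +
      |cdens (realisationLabel x n ∘ σ n) i - x.weight i|) 𝓥 (𝓝 0) := by
    intro i
    have h3 := ((tendsto_cdens_of_isRealisation (l := 𝓥) (n := fun m => m)
      (tendsto_id.mono_left h𝓥) x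
      (fun m => isRealisation_comp_perm (realisationLabel_spec x m) (σ m)) i).sub_const
        (x.weight i)).abs
    simpa using hratio.add h3
  have hmain : Tendsto (fun n : ℕ => (1 + ((n : ℝ) - M n) / M n) ^ 2 *
      editDist (realisation x n) (blowUp G n) + 1 / (M n : ℝ) +
      2 * ∑ i ∈ hx.toFinset, (((n : ℝ) - M n) / M n +
        |cdens (realisationLabel x n ∘ σ n) i - x.weight i|)) 𝓥 (𝓝 b) := by
    have h1 := ((((hratio.const_add 1).pow 2).mul hb).add (hMtop.const_div_atTop 1)).add
      ((tendsto_finsetSum hx.toFinset fun i _ => hdens i).const_mul 2)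
    simpa using h1
  refine ge_of_tendsto hmain ?_
  filter_upwards [hMtop.eventually_gt_atTop 0] with n hn
  have hMn : 0 < M n := by exact_mod_cast hn
  have hn' : (0 : ℝ) < n := hn.trans_le (by exact_mod_cast hMle n)
  refine (limit_editDist_le hx G hMn (hMle n) (hdvd n) (c := realisationLabel x n ∘ σ n)
    (fun v => mem_suppStar_of_isRealisation (realisationLabel_spec x n) _) h𝓤 ha).trans
      (le_of_eq ?_)
  congr 2
  rw [realisation, hσ n]
  field_simp
  ring

/-- Limits along ultrafilters exist by compactness and coincide by `limit_editDist_le_limit`, so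
`limUnder` is a genuine limit. -/
lemma tendsto_editDist {x : PartiteLimit} (hx : x.suppStar.Finite) {N : ℕ} (hN : 0 < N)
    (G : SimpleGraph (Fin N)) :
    Tendsto (fun m => editDist (realisation x m) (blowUp G m)) atTop (𝓝 (editDistLimit G x)) := by
  obtain ⟨a, -, ha⟩ := exists_tendsto_editDist (x := x) (Ultrafilter.of atTop) G
  refine tendsto_nhds_limUnder ⟨a, ?_⟩
  rw [tendsto_iff_ultrafilter]
  intro 𝓥 h𝓥
  obtain ⟨b, -, hb⟩ := exists_tendsto_editDist (x := x) 𝓥 G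
  have h : a = b := le_antisymm
    (limit_editDist_le_limit hx hN G (Ultrafilter.of_le _) h𝓥 ha hb)
    (limit_editDist_le_limit hx hN G h𝓥 (Ultrafilter.of_le _) hb ha)
  rwa [h]

lemma blowUp_self {N : ℕ} (G : SimpleGraph (Fin N)) : blowUp G N = G := by
  ext u v
  simp only [blowUp, Nat.mod_eq_of_lt u.2, Nat.mod_eq_of_lt v.2]
  constructor
  · rintro ⟨a, a', h, h', hG⟩
    rwa [Fin.ext h, Fin.ext h'] at hG
  · exact fun h => ⟨u, v, rfl, rfl, h⟩

/-- A graph that differs little from a realisation has small edit distance from the limit. -/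
lemma exists_editDistLimit_le {x : PartiteLimit} (hx : x.suppStar.Finite) {ε : ℝ} (hε : 0 < ε) :
    ∃ N₀ : ℕ, ∀ N, N₀ ≤ N → ∀ G : SimpleGraph (Fin N), Close x (ε / 2) G →
      editDistLimit G x ≤ ε := by
  set s : ℝ := (hx.toFinset.card : ℝ) with hs
  have hs0 : 0 ≤ s := Nat.cast_nonneg _
  obtain ⟨n₁, hn₁⟩ := exists_nearLabel_of_isRealisation hx
    (show 0 < ε / (8 * (s + 1)) by positivity)
  obtain ⟨n₂, hn₂⟩ := exists_nat_gt (4 / ε)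
  refine ⟨max n₁ (max n₂ 1), fun N hN G hG => ?_⟩
  simp only [max_le_iff] at hN
  obtain ⟨hN1, hN2, hN3⟩ := hN
  have hN' : (0 : ℝ) < N := by exact_mod_cast hN3
  obtain ⟨c, hc, hd⟩ := hG
  -- Taking order and modulus equal to `N`, no vertices are omitted and the blow-up is `G` itself.
  have h := limit_editDist_le hx G hN3 le_rfl dvd_rfl (c := c) (mem_suppStar_of_isRealisation hc)
    (l := atTop) le_rfl (tendsto_editDist hx hN3 G)
  rw [blowUp_self] at h
  have h1 : (1 / (N : ℝ)) ^ 2 * dsize G (labelGraph c) ≤ ε / 2 := by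
    rw [one_div, inv_pow, ← div_eq_inv_mul, div_le_iff₀ (by positivity)]
    exact hd
  have h2 : 1 / (N : ℝ) ≤ ε / 4 := by
    have h3 : 4 / ε < N := hn₂.trans_le (by exact_mod_cast hN2)
    rw [div_lt_iff₀ hε] at h3
    rw [div_le_iff₀ hN']
    linarith
  have h3 : ∑ i ∈ hx.toFinset, (((N : ℝ) - N) / N + |cdens c i - x.weight i|) ≤ ε / 8 := by
    calc _ ≤ ∑ _i ∈ hx.toFinset, ε / (8 * (s + 1)) := by
          refine Finset.sum_le_sum fun i _ => ?_
          rw [sub_self, zero_div, zero_add]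
          exact (hn₁ N hN1 c hc).2 i
      _ = s * (ε / (8 * (s + 1))) := by rw [Finset.sum_const, nsmul_eq_mul]
      _ ≤ ε / 8 := by
          rw [mul_div_assoc', div_le_div_iff₀ (by positivity) (by norm_num)]
          nlinarith
  linarith

end limit

end

end PartiteStability

/-! ### The stability theorem. -/

theorem corollary3p6 (k : ℕ) (hk : 0 < k) (Γ : SimpleGraph (Fin k) → ℝ)
    (hΓ : PartiteStability.IsoInvariant Γ)
    (hsym : PartiteStability.Symmetrisable Γ)
    (hfin : (PartiteStability.OPT Γ).Finite)
    (hstrict : PartiteStability.IsStrict Γ) :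
    ∀ ε : ℝ, 0 < ε → ∃ δ : ℝ, 0 < δ ∧ ∃ n₀ : ℕ, 0 < n₀ ∧
      ∀ n : ℕ, n₀ ≤ n → ∀ G : SimpleGraph (Fin n),
        PartiteStability.lamMax Γ - δ ≤ PartiteStability.lam Γ G →
          ∃ x ∈ PartiteStability.OPT Γ, PartiteStability.editDistLimit G x ≤ ε := by
  intro ε hε
  obtain ⟨c₀, hc₀, hstr⟩ := hstrict
  have hloc : ∀ x ∈ PartiteStability.OPT Γ, PartiteStability.LocallyStrict Γ x c₀ :=
    fun x hx => PartiteStability.locallyStrict_of_strictWith hk hΓ hc₀ hstr hx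
  obtain ⟨δ, hδ, n₁, hn₁⟩ := PartiteStability.exists_close_of_lam hΓ hsym hfin
    (fun x hx => ⟨c₀, hloc x hx⟩) (half_pos hε)
  have hex : ∀ x : PartiteStability.PartiteLimit, ∃ N₀ : ℕ, x ∈ PartiteStability.OPT Γ →
      ∀ N, N₀ ≤ N → ∀ G : SimpleGraph (Fin N), PartiteStability.Close x (ε / 2) G →
        PartiteStability.editDistLimit G x ≤ ε := by
    intro x
    by_cases hx : x ∈ PartiteStability.OPT Γ
    · obtain ⟨N₀, h⟩ := PartiteStability.exists_editDistLimit_le (hloc x hx).finite hε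
      exact ⟨N₀, fun _ => h⟩
    · exact ⟨0, fun h => absurd h hx⟩
  choose N₀ hN₀ using hex
  obtain ⟨n₂, hn₂⟩ := (hfin.image N₀).bddAbove
  refine ⟨δ, hδ, max 1 (max n₁ n₂), by positivity, fun n hn G hG => ?_⟩
  simp only [max_le_iff] at hn
  obtain ⟨x, hx, hcl⟩ := hn₁ n hn.2.1 G hG
  exact ⟨x, hx, hN₀ x hx n ((hn₂ ⟨x, hx, rfl⟩).trans hn.2.2) G hcl⟩
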